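/- **Setting.** Let $n,m\ge 2$ (in particular $n=m$), and let $U\subset\mathbb R^n\times\mathbb R^m$ be an open domain of bundle coordinates $u=(x^i,y^a)$ in the total space of a vector bundle. Let $U$ carry a smooth N-connection $N_i^a(x,y)$, with N-adapted frame $\mathbf e_i=\partial_{x^i}-N_i^a\partial_{y^a}$, $e_a=\partial_{y^a}$, and a prescribed smooth d-metric $\mathbf g=g_{ij}\,dx^i\otimes dx^j+h_{ab}\,\mathbf e^a\otimes\mathbf e^b$, where $\mathbf e^a=dy^a+N^a_i dx^i$ and $g,h$ are positive definite. Let $\mathbf D$ be a metric d-connection of canonical type: a smooth linear connection that preserves the splitting into the horizontal (h) and vertical (v) subspaces, with $\mathbf D\mathbf g=0$, $T^i{}_{jk}=0$, $T^a{}_{bc}=0$. (The canonical d-connection of $\mathbf g$ is one of these.) Assume that $\mathbf D$ has constant d-curvature: for real constants $\chi_h,\chi_v$, the only nonzero curvature components are $\mathbf R(\mathbf e_k,\mathbf e_l)\mathbf e_j=\chi_h(g_{lj}\mathbf e_k-g_{kj}\mathbf e_l)$ and $\mathbf R(e_c,e_d)e_b=\chi_v(h_{db}e_c-h_{cb}e_d)$.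 A flow of curves is a smooth map $\gamma(\tau,l)$ into $U$, for $\tau$ in an open set and $l$ in an open interval, with $X=\gamma_l$, $Y=\gamma_\tau$. Below, $(\gamma,X,Y,\mathbf D,\chi,r)$ stands for either the horizontal part $(h\gamma,hX,hY,h\mathbf D,\chi_h,n)$ or the vertical part $(v\gamma,vX,vY,v\mathbf D,\chi_v,m)$; $\mathbf D_X,\mathbf D_Y$ are the covariant derivatives along $\gamma$ acting on vectors of that part. We consider flows that are non-stretching in that part, $|X|=1$, and along which that part of the d-torsion $\mathbf T(\gamma_\tau,\gamma_l)$ vanishes. Let $X,E_1,\dots,E_{r-1}$ be any smooth orthonormal parallel frame along the flow, i.e. $\mathbf D_XE_i=-v_iX$, $\mathbf D_XX=\sum_i v_iE_i$. Put $Y=e_\parallel X+\sum_i e_\perp^iE_i$, $\mathbf D_YX=\sum_i\varpi^iE_i$, $\Theta_{ij}=\langle \mathbf D_YE_i,E_j\rangle$. On $\mathbb R^{r-1}$-valued differential polynomials in $v$, with $D=\partial_l$ and with $D^{-1}f$ the antiderivative with zero constant term when it exists as a differential polynomial, consider the (partially defined) operators $$\mathcal J(e)=De+D^{-1}(v\cdot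 e)\,v,\qquad \mathcal H(w)=Dw+v\rfloor D^{-1}(v\wedge w),\qquad \mathfrak R=\mathcal H\circ\mathcal J,$$ where $a\wedge b=a\otimes b-b\otimes a$ and $a\rfloor(b\otimes c)=(a\cdot b)c$. **Theorem.** 1. $\mathcal H$ is a Hamiltonian operator: on local functionals whose variational derivatives lie in its domain, $\{F,G\}=\int\frac{\delta F}{\delta v}\cdot\mathcal H\big(\frac{\delta G}{\delta v}\big)\,dl$ is skew and satisfies the Jacobi identity. $\mathcal J$ is a symplectic operator: $\omega(P,Q)=\int P\cdot\mathcal J(Q)\,dl$ is skew and closed on its domain. They are compatible: $c_1\mathcal H+c_2\mathcal J^{-1}$ is a Hamiltonian operator for all $c_1,c_2\in\mathbb R$. 2. For each part there is a hierarchy of differential-polynomial vector fields $K_k=\mathfrak R^k(v_l)$, $k\ge0$ (all the inverse derivatives exist as differential polynomials), and Hamiltonians $H_k$, with $\delta H_0/\delta v=v$ and $$K_k=\mathcal H\Big(\frac{\delta H_k}{\delta v}\Big),\qquad \mathcal J(K_k)=\frac{\delta H_{k+1}}{\delta v}.$$ All $K_k$ commute, and each $\frac{\delta H_j}{\delta v}\cdot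 K_k$ is a total derivative. 3. There are map operators $f_k=\mathbf D_X^{2k+2}X+\sum_{j<2k+2}c_{k,j}\,\mathbf D_X^jX$ whose coefficients $c_{k,j}$ are polynomials in the inner products $\langle\mathbf D_X^aX,\mathbf D_X^bX\rangle$, with $f_0=\mathbf D_X^2X+\frac32|\mathbf D_XX|^2X$. For each part of any flow as above, and in any parallel frame: * Every flow has Hamiltonian form: $\partial_le_\parallel=v\cdot e_\perp$; $\varpi=\mathcal J(e_\perp)$ with $D^{-1}(v\cdot e_\perp)=e_\parallel$; and $v_\tau=\mathcal H(\varpi)+\chi e_\perp$ with $D^{-1}(v\wedge\varpi)=-\Theta$. * ($0$ flow.) The convective (traveling wave) map equation $\gamma_\tau=\gamma_l$ (that is, $Y=X$ in that part) holds if and only if $e_\parallel=1$ and $e_\perp=0$. In that case $v_\tau=v_l$, up to a term $v\rfloor C(\tau)$. * ($+1,+2,\dots$ flows.) The geometric map equation $-\gamma_\tau=f_k$ holds if and only if $e_\perp=-K_k$ and $e_\parallel=-D^{-1}(v\cdot K_k)$. In that case $-v_\tau=K_{k+1}+\chi K_k$, up to a term $v\rfloor C(\tau)$. For $k=0$ this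 is the $+1$ flow, given by the non-stretching mKdV map $$-\gamma_\tau=\mathbf D_X^2\gamma_X+\tfrac32|\mathbf D_X\gamma_X|^2\gamma_X ,\qquad \gamma_X=X;$$ $k\ge1$ gives its higher-order analogs. * ($-1$ flow.) The non-stretching wave map equation $\mathbf D_Y\gamma_X=0$ holds if and only if $\mathcal J(e_\perp)=\partial_le_\perp+e_\parallel v=0$ (with $D^{-1}(v\cdot e_\perp)=e_\parallel$), so that $e_\perp$ lies in the kernel of $\mathfrak R$. In that case $v_\tau=\chi e_\perp$, up to a term $v\rfloor C(\tau)$. Here each $C(\tau)$ is a skew matrix constant along each curve; it is, up to sign, the constant of integration of $\Theta$, i.e. the rotation that a frame parallel along each curve leaves free as $\tau$ varies. -/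

import Mathlib

open scoped ContDiff

namespace CurveFlow

/-! ## Differential polynomials in a vector variable `v = (v¹, …, v^N)` of arclength `l` -/

/-- Differential polynomials: the generator `X (i, j)` stands for `∂_l^j vⁱ`. -/
abbrev Jet (N : ℕ) := MvPolynomial (Fin N × ℕ) ℝ

/-- Total derivative with respect to arclength. -/
noncomputable def totalD (N : ℕ) : Derivation ℝ (Jet N) (Jet N) :=
  MvPolynomial.mkDerivation ℝ (fun p => MvPolynomial.X (p.1, p.2 + 1))

/-- The evolutionary derivation of the vector field `v_τ = Q`: it commutes with the total
derivative and sends `vⁱ` to `Qⁱ`. -/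
noncomputable def evolD {N : ℕ} (Q : Fin N → Jet N) : Derivation ℝ (Jet N) (Jet N) :=
  MvPolynomial.mkDerivation ℝ (fun p => (totalD N)^[p.2] (Q p.1))

/-- Componentwise total derivative. -/
noncomputable def vecD {N : ℕ} (Q : Fin N → Jet N) : Fin N → Jet N := fun i => totalD N (Q i)

/-- Componentwise evolutionary derivative. -/
noncomputable def vecEvolD {N : ℕ} (P Q : Fin N → Jet N) : Fin N → Jet N := fun i => evolD P (Q i)

/-- The variational derivative `δF/δvⁱ = ∑_j (-D)^j ∂F/∂v_jⁱ`. -/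
noncomputable def euler {N : ℕ} (F : Jet N) : Fin N → Jet N := fun i =>
  ∑ j ∈ Finset.range (F.vars.sup Prod.snd + 1),
    (-1) ^ j * (totalD N)^[j] (MvPolynomial.pderiv (i, j) F)

/-- `∫ F dl = 0` in the formal sense: `F` is a total derivative. -/
def IsTotalDeriv {N : ℕ} (F : Jet N) : Prop := ∃ G : Jet N, totalD N G = F

/-- `g = D⁻¹ f`: the antiderivative with zero constant of integration. -/
def IsAntideriv {N : ℕ} (f g : Jet N) : Prop :=
  totalD N g = f ∧ MvPolynomial.constantCoeff g = 0

/-- The flow variable `v`. -/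
noncomputable def jetV (N : ℕ) : Fin N → Jet N := fun i => MvPolynomial.X (i, 0)

/-- The skew product `a ∧ b = a ⊗ b - b ⊗ a`. -/
def wedge {R : Type*} [CommRing R] {N : ℕ} (a b : Fin N → R) : Matrix (Fin N) (Fin N) R :=
  Matrix.vecMulVec a b - Matrix.vecMulVec b a

/-- The graph of `𝒥 = D + D⁻¹(v ·) v`: the relation `w = 𝒥(e)`. -/
def JRel {N : ℕ} (e w : Fin N → Jet N) : Prop :=
  ∃ t : Jet N, IsAntideriv (jetV N ⬝ᵥ e) t ∧ w = vecD e + t • jetV N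

/-- The graph of `ℋ = D + v ⌋ D⁻¹(v ∧ )`: the relation `u = ℋ(w)`. -/
def HRel {N : ℕ} (w u : Fin N → Jet N) : Prop :=
  ∃ Θ : Matrix (Fin N) (Fin N) (Jet N),
    (∀ i j, IsAntideriv (wedge (jetV N) w i j) (Θ i j)) ∧ u = vecD w + Matrix.vecMul (jetV N) Θ

/-- The graph of `c₁ ℋ + c₂ 𝒥⁻¹`. -/
def pencilRel {N : ℕ} (c₁ c₂ : ℝ) (w u : Fin N → Jet N) : Prop :=
  ∃ u₁ u₂ : Fin N → Jet N, HRel w u₁ ∧ JRel u₂ w ∧ u = c₁ • u₁ + c₂ • u₂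

/-- A (possibly nonlocal) operator, given by its graph `P`, is a Hamiltonian operator: the bracket
`{F, G} = ∫ δF · P(δG) dl` of functionals with `δF`, `δG` in the domain of `P` is skew and
satisfies the Jacobi identity. -/
def IsHamiltonianOp {N : ℕ} (P : (Fin N → Jet N) → (Fin N → Jet N) → Prop) : Prop :=
  ∀ (F G K : Jet N) (X Y Z : Fin N → Jet N),
    P (euler F) X → P (euler G) Y → P (euler K) Z →
      IsTotalDeriv (euler F ⬝ᵥ Y + euler G ⬝ᵥ X) ∧
      IsTotalDeriv (euler (euler F ⬝ᵥ Y) ⬝ᵥ Z + euler (euler G ⬝ᵥ Z) ⬝ᵥ X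
        + euler (euler K ⬝ᵥ X) ⬝ᵥ Y)

/-- The commutator of evolutionary vector fields. -/
noncomputable def vfBracket {N : ℕ} (X Y : Fin N → Jet N) : Fin N → Jet N :=
  vecEvolD X Y - vecEvolD Y X

/-- An operator, given by its graph `P`, is a symplectic operator: the two-form
`ω(X, Y) = ∫ X · P(Y) dl` is skew and closed. -/
def IsSymplecticOp {N : ℕ} (P : (Fin N → Jet N) → (Fin N → Jet N) → Prop) : Prop :=
  ∀ X Y Z X' Y' Z' : Fin N → Jet N, P X X' → P Y Y' → P Z Z' →
    IsTotalDeriv (X ⬝ᵥ Y' + Y ⬝ᵥ X') ∧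
    IsTotalDeriv
      ((evolD X (Y ⬝ᵥ Z') - vfBracket X Y ⬝ᵥ Z') + (evolD Y (Z ⬝ᵥ X') - vfBracket Y Z ⬝ᵥ X')
        + (evolD Z (X ⬝ᵥ Y') - vfBracket Z X ⬝ᵥ Y'))

/-- `ℋ` is Hamiltonian (cosymplectic), `𝒥` is symplectic, and they are compatible. -/
structure IsBiHamiltonianPair (N : ℕ) : Prop where
  hamiltonian : IsHamiltonianOp (HRel (N := N))
  symplectic : IsSymplecticOp (JRel (N := N))
  compatible : ∀ c₁ c₂ : ℝ, IsHamiltonianOp (pencilRel (N := N) c₁ c₂)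

/-- A geometric map operator `∑_j c_j D_X^j X` whose coefficients `c_j` are polynomials in the
inner products of the vectors `D_X^a X`; the generator `X (a, b)` of the coefficient ring stands
for `⟨D_X^a X, D_X^b X⟩`. -/
abbrev MapOperator := ℕ →₀ MvPolynomial (ℕ × ℕ) ℝ

/-- The data of a hierarchy: evolutionary vector fields `vf k`, covectors `cov k`, antiderivatives
`par k` and `rot k`, Hamiltonians `ham k`, and geometric map operators `map k`. -/
structure FlowHierarchy (N : ℕ) where
  vf : ℕ → Fin N → Jet N
  cov : ℕ → Fin N → Jet N
  par : ℕ → Jet N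
  rot : ℕ → Matrix (Fin N) (Fin N) (Jet N)
  ham : ℕ → Jet N
  map : ℕ → MapOperator

/-- The hierarchy generated from `vf 0 = v_l` by the recursion operator `ℋ ∘ 𝒥` consists of
commuting bi-Hamiltonian vector fields: `vf k = ℋ(δ(ham k)/δv) = 𝒥⁻¹(δ(ham (k+1))/δv)`, with
Hamiltonians in involution. -/
structure FlowHierarchy.IsBiHamiltonian {N : ℕ} (R : FlowHierarchy N) : Prop where
  cov_zero : R.cov 0 = jetV N
  vf_zero : R.vf 0 = vecD (jetV N)
  par_spec : ∀ k, IsAntideriv (jetV N ⬝ᵥ R.vf k) (R.par k)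
  cov_succ : ∀ k, R.cov (k + 1) = vecD (R.vf k) + R.par k • jetV N
  rot_spec : ∀ k i j, IsAntideriv (wedge (jetV N) (R.cov k) i j) (R.rot k i j)
  vf_eq : ∀ k, R.vf k = vecD (R.cov k) + Matrix.vecMul (jetV N) (R.rot k)
  cov_eq : ∀ k, R.cov k = euler (R.ham k)
  commute : ∀ j k, vfBracket (R.vf j) (R.vf k) = 0
  involution : ∀ j k, IsTotalDeriv (R.cov j ⬝ᵥ R.vf k)

/-- The first map operator is `D_X² X + (3/2)|D_X X|² X`; the `k`-th one is of order `2k + 2` with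
leading term `D_X^{2k+2} X`. -/
structure FlowHierarchy.IsMapHierarchy {N : ℕ} (R : FlowHierarchy N) : Prop where
  map_zero : R.map 0 = Finsupp.single 2 1 +
    Finsupp.single 0 (MvPolynomial.C (3 / 2) * MvPolynomial.X (1, 1))
  map_lead : ∀ k, R.map k (2 * k + 2) = 1
  map_order : ∀ k j, 2 * k + 2 < j → R.map k j = 0

/-- The value of a differential polynomial on a function `v` at the point `l`. -/
noncomputable def jetEval {N : ℕ} (P : Jet N) (v : ℝ → Fin N → ℝ) (l : ℝ) : ℝ :=
  MvPolynomial.eval (fun p : Fin N × ℕ => iteratedDeriv p.2 (fun s => v s p.1) l) P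

/-! ## N-connections, d-metrics and d-connections in bundle coordinates -/

/-- Bundle coordinates `u = (xⁱ, yᵃ)`. -/
abbrev Coord (n m : ℕ) := (Fin n → ℝ) × (Fin m → ℝ)

/-- Indices of N-adapted frames: `Sum.inl i` is horizontal, `Sum.inr a` is vertical. -/
abbrev Idx (n m : ℕ) := Fin n ⊕ Fin m

/-- A domain `U` of bundle coordinates in the total space, with an N-connection `N u a i = N_iᵃ(u)`
and a d-metric `g_ij eⁱ ⊗ eʲ + h_ab eᵃ ⊗ eᵇ`. -/
structure NBundle (n m : ℕ) where
  U : Set (Coord n m)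
  isOpen_U : IsOpen U
  N : Coord n m → Matrix (Fin m) (Fin n) ℝ
  smooth_N : ∀ a i, ContDiffOn ℝ ∞ (fun u => N u a i) U
  g : Coord n m → Matrix (Fin n) (Fin n) ℝ
  smooth_g : ∀ i j, ContDiffOn ℝ ∞ (fun u => g u i j) U
  posDef_g : ∀ u ∈ U, (g u).PosDef
  h : Coord n m → Matrix (Fin m) (Fin m) ℝ
  smooth_h : ∀ a b, ContDiffOn ℝ ∞ (fun u => h u a b) U
  posDef_h : ∀ u ∈ U, (h u).PosDef

variable {n m : ℕ}

/-- The N-adapted frame `e_i = ∂_i - N_iᵃ ∂_a`, `e_a = ∂_a`. -/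
def NBundle.frame (B : NBundle n m) (α : Idx n m) (u : Coord n m) : Coord n m :=
  match α with
  | Sum.inl i => (Pi.single i 1, fun a => -B.N u a i)
  | Sum.inr a => (0, Pi.single a 1)

/-- The dual coframe `eⁱ = dxⁱ`, `eᵃ = dyᵃ + N_iᵃ dxⁱ` evaluated on a tangent vector. -/
def NBundle.coframe (B : NBundle n m) (u w : Coord n m) (α : Idx n m) : ℝ :=
  match α with
  | Sum.inl i => w.1 i
  | Sum.inr a => w.2 a + ∑ i, B.N u a i * w.1 i

/-- The derivative `e_α f`. -/
noncomputable def NBundle.eD (B : NBundle n m) (α : Idx n m) (f : Coord n m → ℝ)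
    (u : Coord n m) : ℝ :=
  fderiv ℝ f u (B.frame α u)

/-- The anholonomy coefficients, `[e_α, e_β] = W^γ_{αβ} e_γ`. -/
noncomputable def NBundle.anholonomy (B : NBundle n m) (γ α β : Idx n m) (u : Coord n m) : ℝ :=
  B.coframe u (VectorField.lieBracket ℝ (B.frame α) (B.frame β) u) γ

/-- A d-connection: a linear connection preserving the splitting into horizontal and vertical
subspaces, given by `D_{e_γ} e_j = (hΓ i j γ) e_i` and `D_{e_γ} e_b = (vΓ a b γ) e_a`. Thus
`hΓ i j (inl k) = Lⁱ_jk`, `hΓ i j (inr c) = Cⁱ_jc`, `vΓ a b (inl k) = Lᵃ_bk`,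
`vΓ a b (inr c) = Cᵃ_bc`. -/
structure DConnection (B : NBundle n m) where
  hΓ : Fin n → Fin n → Idx n m → Coord n m → ℝ
  vΓ : Fin m → Fin m → Idx n m → Coord n m → ℝ
  smooth_hΓ : ∀ i j γ, ContDiffOn ℝ ∞ (hΓ i j γ) B.U
  smooth_vΓ : ∀ a b γ, ContDiffOn ℝ ∞ (vΓ a b γ) B.U

namespace DConnection

variable {B : NBundle n m}

/-- All coefficients, `D_{e_γ} e_β = Γ^α_{βγ} e_α`. -/
def coeff (D : DConnection B) (α β γ : Idx n m) (u : Coord n m) : ℝ :=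
  match α, β with
  | Sum.inl i, Sum.inl j => D.hΓ i j γ u
  | Sum.inr a, Sum.inr b => D.vΓ a b γ u
  | _, _ => 0

/-- Metric compatibility `D g = 0`. -/
structure IsMetric (D : DConnection B) : Prop where
  horizontal : ∀ u ∈ B.U, ∀ γ i j, B.eD γ (fun z => B.g z i j) u =
    ∑ r, (D.hΓ r i γ u * B.g u r j + D.hΓ r j γ u * B.g u i r)
  vertical : ∀ u ∈ B.U, ∀ γ a b, B.eD γ (fun z => B.h z a b) u =
    ∑ r, (D.vΓ r a γ u * B.h u r b + D.vΓ r b γ u * B.h u a r)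

/-- The torsion components: the `e_α`-component of
`T(e_β, e_γ) = D_{e_β} e_γ - D_{e_γ} e_β - [e_β, e_γ]`. -/
noncomputable def torsion (D : DConnection B) (α β γ : Idx n m) (u : Coord n m) : ℝ :=
  D.coeff α γ β u - D.coeff α β γ u - B.anholonomy α β γ u

/-- A canonical-type d-connection: metric, with `Tⁱ_jk = 0` and `Tᵃ_bc = 0`. -/
structure IsCanonicalType (D : DConnection B) : Prop where
  metric : D.IsMetric
  torsion_h : ∀ u ∈ B.U, ∀ i j k, D.torsion (Sum.inl i) (Sum.inl j) (Sum.inl k) u = 0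
  torsion_v : ∀ u ∈ B.U, ∀ a b c, D.torsion (Sum.inr a) (Sum.inr b) (Sum.inr c) u = 0

/-- The curvature coefficients of a connection `D_{e_γ} s_j = Γ i j γ s_i` in N-adapted frames: the
`s_i`-component of `D_{e_γ} D_{e_δ} s_j - D_{e_δ} D_{e_γ} s_j - D_{[e_γ, e_δ]} s_j`. -/
noncomputable def curv (B : NBundle n m) {r : ℕ} (Γ : Fin r → Fin r → Idx n m → Coord n m → ℝ)
    (i j : Fin r) (γ δ : Idx n m) (u : Coord n m) : ℝ :=
  B.eD γ (Γ i j δ) u - B.eD δ (Γ i j γ) u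
    + ∑ k, (Γ i k γ u * Γ k j δ u - Γ i k δ u * Γ k j γ u)
    - ∑ ε, B.anholonomy ε γ δ u * Γ i j ε u

/-- Constant d-curvature `χh` of the horizontal part, as for `SO(n+1)/SO(n)`: the only nonzero
components are `R(e_k, e_l) e_j = χh (g_lj e_k - g_kj e_l)`. -/
def HasConstHCurvature (D : DConnection B) (χh : ℝ) : Prop :=
  ∀ u ∈ B.U, ∀ (i j : Fin n) (γ δ : Idx n m), curv B D.hΓ i j γ δ u =
    match γ, δ with
    | Sum.inl k, Sum.inl l =>
        χh * ((if i = k then B.g u l j else 0) - (if i = l then B.g u k j else 0))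
    | _, _ => 0

/-- Constant d-curvature `χv` of the vertical part, as for `SO(m+1)/SO(m)`. -/
def HasConstVCurvature (D : DConnection B) (χv : ℝ) : Prop :=
  ∀ u ∈ B.U, ∀ (a b : Fin m) (γ δ : Idx n m), curv B D.vΓ a b γ δ u =
    match γ, δ with
    | Sum.inr c, Sum.inr d =>
        χv * ((if a = c then B.h u d b else 0) - (if a = d then B.h u c b else 0))
    | _, _ => 0

end DConnection

/-! ## The canonical d-connection of a d-metric -/

namespace NBundle

variable {n m : ℕ} (B : NBundle n m)

theorem smooth_frame (α : Idx n m) : ContDiffOn ℝ ∞ (B.frame α) B.U := by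
  cases α with
  | inl i =>
    exact contDiffOn_const.prodMk (contDiffOn_pi.2 fun a => (B.smooth_N a i).neg)
  | inr a => exact contDiffOn_const

theorem smooth_eD (α : Idx n m) {f : Coord n m → ℝ} (hf : ContDiffOn ℝ ∞ f B.U) :
    ContDiffOn ℝ ∞ (B.eD α f) B.U :=
  (hf.fderiv_of_isOpen B.isOpen_U (by simp)).clm_apply (B.smooth_frame α)

theorem smooth_inv {r : ℕ} {U : Set (Coord n m)} {G : Coord n m → Matrix (Fin r) (Fin r) ℝ}
    (hG : ∀ i j, ContDiffOn ℝ ∞ (fun u => G u i j) U) (hp : ∀ u ∈ U, (G u).PosDef)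
    (i j : Fin r) : ContDiffOn ℝ ∞ (fun u => (G u)⁻¹ i j) U := by
  have hdet : ∀ A : Coord n m → Matrix (Fin r) (Fin r) ℝ,
      (∀ i j, ContDiffOn ℝ ∞ (fun u => A u i j) U) → ContDiffOn ℝ ∞ (fun u => (A u).det) U := by
    intro A hA
    simp only [Matrix.det_apply]
    exact ContDiffOn.sum fun σ _ => (contDiffOn_prod fun k _ => hA _ _).const_smul _
  have hadj : ContDiffOn ℝ ∞ (fun u => (G u).adjugate i j) U := by
    simp only [Matrix.adjugate_apply]
    refine hdet _ fun k l => ?_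
    by_cases h : k = j
    · subst h
      simpa using contDiffOn_const
    · simpa [Matrix.updateRow_ne h] using hG k l
  refine ((hdet G hG).inv fun u hu => (hp u hu).det_pos.ne').mul hadj |>.congr fun u _ => ?_
  simp [Matrix.inv_def, Ring.inverse_eq_inv']

theorem eD_symm {r : ℕ} {G : Coord n m → Matrix (Fin r) (Fin r) ℝ}
    (hp : ∀ u ∈ B.U, (G u).PosDef) (α : Idx n m) (i j : Fin r) {u : Coord n m} (hu : u ∈ B.U) :
    B.eD α (fun z => G z i j) u = B.eD α (fun z => G z j i) u := by
  unfold eD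
  congr 1
  apply Filter.EventuallyEq.fderiv_eq
  filter_upwards [B.isOpen_U.mem_nhds hu] with z hz
  simpa using ((hp z hz).isHermitian.apply i j).symm

theorem sum_inv_mul {r : ℕ} {G : Matrix (Fin r) (Fin r) ℝ} (hG : G.PosDef) (i : Fin r)
    (A : Fin r → ℝ) : ∑ k, (∑ l, G⁻¹ k l * A l) * G k i = A i := by
  have hdet : IsUnit G.det := hG.det_pos.ne'.isUnit
  have hs : ∀ k, G k i = G i k := fun k => by simpa using (hG.isHermitian.apply k i).symm
  have h : G.mulVec (G⁻¹.mulVec A) i = A i := by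
    rw [Matrix.mulVec_mulVec, Matrix.mul_nonsing_inv _ hdet, Matrix.one_mulVec]
  rw [← h]
  simp only [Matrix.mulVec, dotProduct]
  exact Finset.sum_congr rfl fun k _ => by rw [hs, mul_comm]

end NBundle

/-- The canonical d-connection of a d-metric. -/
noncomputable def DConnection.canonical {n m : ℕ} (B : NBundle n m) : DConnection B where
  hΓ i j γ u := ∑ r, (B.g u)⁻¹ i r *
    match γ with
    | Sum.inl k => 1 / 2 * (B.eD (Sum.inl k) (fun z => B.g z j r) u
        + B.eD (Sum.inl j) (fun z => B.g z k r) u - B.eD (Sum.inl r) (fun z => B.g z j k) u)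
    | Sum.inr c => 1 / 2 * B.eD (Sum.inr c) (fun z => B.g z j r) u
  vΓ a b γ u :=
    (match γ with
    | Sum.inl k => B.eD (Sum.inr b) (fun z => B.N z a k) u
    | Sum.inr _ => 0) + ∑ r, (B.h u)⁻¹ a r *
    match γ with
    | Sum.inl k => 1 / 2 * (B.eD (Sum.inl k) (fun z => B.h z b r) u
        - ∑ d, B.h u d r * B.eD (Sum.inr b) (fun z => B.N z d k) u
        - ∑ d, B.h u d b * B.eD (Sum.inr r) (fun z => B.N z d k) u)
    | Sum.inr c => 1 / 2 * (B.eD (Sum.inr c) (fun z => B.h z b r) u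
        + B.eD (Sum.inr b) (fun z => B.h z c r) u - B.eD (Sum.inr r) (fun z => B.h z b c) u)
  smooth_hΓ i j γ := by
    refine ContDiffOn.sum fun r _ => (NBundle.smooth_inv B.smooth_g B.posDef_g i r).mul ?_
    have hg := fun (α : Idx n m) i j => B.smooth_eD α (B.smooth_g i j)
    cases γ with
    | inl k => exact contDiffOn_const.mul (((hg _ _ _).add (hg _ _ _)).sub (hg _ _ _))
    | inr c => exact contDiffOn_const.mul (hg _ _ _)
  smooth_vΓ a b γ := by
    have hh := fun (α : Idx n m) i j => B.smooth_eD α (B.smooth_h i j)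
    have hN := fun (α : Idx n m) i j => B.smooth_eD α (B.smooth_N i j)
    refine ContDiffOn.add ?_
      (ContDiffOn.sum fun r _ => (NBundle.smooth_inv B.smooth_h B.posDef_h a r).mul ?_)
    · cases γ with
      | inl k => exact hN _ _ _
      | inr c => exact contDiffOn_const
    · cases γ with
      | inl k =>
        exact contDiffOn_const.mul (((hh _ _ _).sub
          (ContDiffOn.sum fun d _ => (B.smooth_h _ _).mul (hN _ _ _))).sub
          (ContDiffOn.sum fun d _ => (B.smooth_h _ _).mul (hN _ _ _)))
      | inr c => exact contDiffOn_const.mul (((hh _ _ _).add (hh _ _ _)).sub (hh _ _ _))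

theorem DConnection.canonical_isCanonicalType {n m : ℕ} (B : NBundle n m) :
    (DConnection.canonical B).IsCanonicalType := by
  refine ⟨⟨?_, ?_⟩, ?_, ?_⟩
  · intro u hu γ i j
    have hs : ∀ r, B.g u i r = B.g u r i := fun r => by
      simpa using ((B.posDef_g u hu).isHermitian.apply i r).symm
    simp only [DConnection.canonical, Finset.sum_add_distrib, hs]
    rw [NBundle.sum_inv_mul (B.posDef_g u hu), NBundle.sum_inv_mul (B.posDef_g u hu)]
    cases γ with
    | inl k =>
      simp only
      rw [B.eD_symm B.posDef_g (Sum.inl k) j i hu, B.eD_symm B.posDef_g (Sum.inl i) k j hu,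
        B.eD_symm B.posDef_g (Sum.inl j) k i hu]
      ring
    | inr c =>
      simp only
      rw [B.eD_symm B.posDef_g (Sum.inr c) j i hu]
      ring
  · intro u hu γ a b
    have hs : ∀ r, B.h u a r = B.h u r a := fun r => by
      simpa using ((B.posDef_h u hu).isHermitian.apply a r).symm
    simp only [DConnection.canonical, Finset.sum_add_distrib, hs, add_mul]
    rw [NBundle.sum_inv_mul (B.posDef_h u hu), NBundle.sum_inv_mul (B.posDef_h u hu)]
    cases γ with
    | inl k =>
      simp only
      rw [B.eD_symm B.posDef_h (Sum.inl k) b a hu]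
      simp only [mul_comm (B.eD _ _ _)]
      ring
    | inr c =>
      simp only
      rw [B.eD_symm B.posDef_h (Sum.inr c) b a hu, B.eD_symm B.posDef_h (Sum.inr a) c b hu,
        B.eD_symm B.posDef_h (Sum.inr b) c a hu]
      simp only [zero_mul, Finset.sum_const_zero]
      ring
  · intro u hu i j k
    have hW : B.anholonomy (Sum.inl i) (Sum.inl j) (Sum.inl k) u = 0 := by
      have hd : ∀ α : Idx n m, DifferentiableAt ℝ (B.frame α) u := fun α =>
        ((B.smooth_frame α).contDiffAt (B.isOpen_U.mem_nhds hu)).differentiableAt (by simp)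
      have h0 : ∀ (k : Fin n) (w : Coord n m),
          (fderiv ℝ (B.frame (Sum.inl k)) u w).1 = 0 := by
        intro k w
        have h1 := (hd (Sum.inl k)).hasFDerivAt.fst.unique
          (hasFDerivAt_const (Pi.single k (1 : ℝ) : Fin n → ℝ) u)
        simpa using congrArg (fun A => A w) h1
      simp [NBundle.anholonomy, NBundle.coframe, VectorField.lieBracket, h0]
    simp only [torsion, coeff, hW, canonical, ← Finset.sum_sub_distrib, ← mul_sub, sub_zero]
    refine Finset.sum_eq_zero fun r _ => ?_
    rw [B.eD_symm B.posDef_g (Sum.inl r) k j hu]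
    ring
  · intro u hu a b c
    have hW : B.anholonomy (Sum.inr a) (Sum.inr b) (Sum.inr c) u = 0 := by
      have h0 : ∀ b : Fin m, B.frame (Sum.inr b) = fun _ => (0, Pi.single b 1) := fun b => rfl
      simp [NBundle.anholonomy, NBundle.coframe, VectorField.lieBracket, h0]
    simp only [torsion, coeff, hW, canonical, zero_add, ← Finset.sum_sub_distrib, ← mul_sub,
      sub_zero]
    refine Finset.sum_eq_zero fun r _ => ?_
    rw [B.eD_symm B.posDef_h (Sum.inr r) c b hu]
    ring

/-! ## Flows of curves -/

/-- A smooth flow of curves `γ(τ, l)` in the total space, `τ ∈ T`, `l ∈ L`. -/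
structure IsCurveFlow (B : NBundle n m) (T L : Set ℝ) (γ : ℝ → ℝ → Coord n m) : Prop where
  isOpen_T : IsOpen T
  isOpen_L : IsOpen L
  interval_L : L.OrdConnected
  mapsTo : ∀ τ ∈ T, ∀ l ∈ L, γ τ l ∈ B.U
  smooth : ContDiffOn ℝ ∞ (fun p : ℝ × ℝ => γ p.1 p.2) (T ×ˢ L)

/-- N-adapted components of the tangent d-vector `X = γ_l`. -/
noncomputable def tangentX (B : NBundle n m) (γ : ℝ → ℝ → Coord n m) (τ l : ℝ) : Idx n m → ℝ :=
  B.coframe (γ τ l) (deriv (fun s => γ τ s) l)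

/-- N-adapted components of the flow d-vector `Y = γ_τ`. -/
noncomputable def tangentY (B : NBundle n m) (γ : ℝ → ℝ → Coord n m) (τ l : ℝ) : Idx n m → ℝ :=
  B.coframe (γ τ l) (deriv (fun t => γ t l) τ)

/-- N-adapted components of the torsion `T(γ_τ, γ_l)` along a flow. -/
noncomputable def flowTorsion {B : NBundle n m} (D : DConnection B) (γ : ℝ → ℝ → Coord n m)
    (τ l : ℝ) (α : Idx n m) : ℝ :=
  ∑ β, ∑ δ, D.torsion α β δ (γ τ l) * tangentY B γ τ l β * tangentX B γ τ l δ

/-- The horizontal or the vertical part of the geometry along a flow: the fibre metric, the matrices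
of the connection in the directions of `γ_l` and `γ_τ`, and the corresponding components of `γ_l`
and `γ_τ`. -/
structure FlowPart (r : ℕ) where
  metric : ℝ → ℝ → Matrix (Fin r) (Fin r) ℝ
  ΓX : ℝ → ℝ → Matrix (Fin r) (Fin r) ℝ
  ΓY : ℝ → ℝ → Matrix (Fin r) (Fin r) ℝ
  X : ℝ → ℝ → Fin r → ℝ
  Y : ℝ → ℝ → Fin r → ℝ

/-- The horizontal part `hγ`. -/
noncomputable def hPart {B : NBundle n m} (D : DConnection B) (γ : ℝ → ℝ → Coord n m) :
    FlowPart n where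
  metric τ l := B.g (γ τ l)
  ΓX τ l := Matrix.of fun i j => ∑ δ, D.hΓ i j δ (γ τ l) * tangentX B γ τ l δ
  ΓY τ l := Matrix.of fun i j => ∑ δ, D.hΓ i j δ (γ τ l) * tangentY B γ τ l δ
  X τ l i := tangentX B γ τ l (Sum.inl i)
  Y τ l i := tangentY B γ τ l (Sum.inl i)

/-- The vertical part `vγ`. -/
noncomputable def vPart {B : NBundle n m} (D : DConnection B) (γ : ℝ → ℝ → Coord n m) :
    FlowPart m where
  metric τ l := B.h (γ τ l)
  ΓX τ l := Matrix.of fun a b => ∑ δ, D.vΓ a b δ (γ τ l) * tangentX B γ τ l δ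
  ΓY τ l := Matrix.of fun a b => ∑ δ, D.vΓ a b δ (γ τ l) * tangentY B γ τ l δ
  X τ l a := tangentX B γ τ l (Sum.inr a)
  Y τ l a := tangentY B γ τ l (Sum.inr a)

namespace FlowPart

variable {r : ℕ}

/-- The inner product of two vectors at the point `(τ, l)`. -/
def inner (S : FlowPart r) (τ l : ℝ) (a b : Fin r → ℝ) : ℝ := a ⬝ᵥ (S.metric τ l).mulVec b

/-- The covariant derivative `D_X` along the curve. -/
noncomputable def DX (S : FlowPart r) (ξ : ℝ → ℝ → Fin r → ℝ) : ℝ → ℝ → Fin r → ℝ := fun τ l =>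
  deriv (fun s => ξ τ s) l + (S.ΓX τ l).mulVec (ξ τ l)

/-- The covariant derivative `D_Y` in the direction of the flow. -/
noncomputable def DY (S : FlowPart r) (ξ : ℝ → ℝ → Fin r → ℝ) : ℝ → ℝ → Fin r → ℝ := fun τ l =>
  deriv (fun t => ξ t l) τ + (S.ΓY τ l).mulVec (ξ τ l)

/-- The non-stretching condition. -/
def NonStretching (S : FlowPart r) (T L : Set ℝ) : Prop :=
  ∀ τ ∈ T, ∀ l ∈ L, S.inner τ l (S.X τ l) (S.X τ l) = 1

/-- `0` flow: convective map `γ_τ = γ_l`. -/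
def IsConvectiveMap (S : FlowPart r) (T L : Set ℝ) : Prop :=
  ∀ τ ∈ T, ∀ l ∈ L, S.Y τ l = S.X τ l

/-- `+1` flow: mKdV map `-γ_τ = D_X² γ_l + (3/2)|D_X γ_l|² γ_l`. -/
def IsMKdVMap (S : FlowPart r) (T L : Set ℝ) : Prop :=
  ∀ τ ∈ T, ∀ l ∈ L, -S.Y τ l = S.DX (S.DX S.X) τ l
    + (3 / 2 * S.inner τ l (S.DX S.X τ l) (S.DX S.X τ l)) • S.X τ l

/-- `-1` flow: wave map `D_Y γ_l = 0`. -/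
def IsWaveMap (S : FlowPart r) (T L : Set ℝ) : Prop :=
  ∀ τ ∈ T, ∀ l ∈ L, S.DY S.X τ l = 0

/-- The value of a geometric map operator on a curve. -/
noncomputable def mapEval (S : FlowPart r) (f : MapOperator) (τ l : ℝ) : Fin r → ℝ :=
  f.sum fun j c =>
    (MvPolynomial.eval (fun ab : ℕ × ℕ =>
      S.inner τ l ((S.DX)^[ab.1] S.X τ l) ((S.DX)^[ab.2] S.X τ l)) c) • (S.DX)^[j] S.X τ l

/-- The geometric map equation `-γ_τ = f(γ_l, D_X γ_l, D_X² γ_l, …)`. -/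
def IsMapFlow (S : FlowPart r) (f : MapOperator) (T L : Set ℝ) : Prop :=
  ∀ τ ∈ T, ∀ l ∈ L, -S.Y τ l = S.mapEval f τ l

variable {N : ℕ}

/-- The components of the principal normal `D_X X` in a frame. -/
noncomputable def normal (S : FlowPart (N + 1)) (E : ℝ → ℝ → Fin (N + 1) → Fin (N + 1) → ℝ)
    (τ l : ℝ) (i : Fin N) : ℝ := S.inner τ l (S.DX S.X τ l) (E τ l i.succ)

/-- An orthonormal frame `E τ l 0 = X, E τ l 1, …, E τ l N` along the flow that is parallel along
each curve: the derivatives `D_X E_i`, `i ≥ 1`, are tangent to the curve. -/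
structure IsParallelFrame (S : FlowPart (N + 1)) (T L : Set ℝ)
    (E : ℝ → ℝ → Fin (N + 1) → Fin (N + 1) → ℝ) : Prop where
  smooth : ContDiffOn ℝ ∞ (fun p : ℝ × ℝ => E p.1 p.2) (T ×ˢ L)
  orthonormal : ∀ τ ∈ T, ∀ l ∈ L, ∀ i j,
    S.inner τ l (E τ l i) (E τ l j) = if i = j then 1 else 0
  tangent : ∀ τ ∈ T, ∀ l ∈ L, E τ l 0 = S.X τ l
  parallel : ∀ τ ∈ T, ∀ l ∈ L, ∀ i : Fin N,
    S.DX (fun t s => E t s i.succ) τ l = -S.normal E τ l i • S.X τ l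

/-- The tangential part `e_∥` of the flow. -/
def ePar (S : FlowPart (N + 1)) (τ l : ℝ) : ℝ := S.inner τ l (S.Y τ l) (S.X τ l)

/-- The normal part `e_⊥` of the flow. -/
def ePerp (S : FlowPart (N + 1)) (E : ℝ → ℝ → Fin (N + 1) → Fin (N + 1) → ℝ) (τ l : ℝ)
    (i : Fin N) : ℝ := S.inner τ l (S.Y τ l) (E τ l i.succ)

/-- The principal normal `ϖ` in the flow direction, `D_Y X = ϖⁱ E_i`. -/
noncomputable def flowNormal (S : FlowPart (N + 1)) (E : ℝ → ℝ → Fin (N + 1) → Fin (N + 1) → ℝ)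
    (τ l : ℝ) (i : Fin N) : ℝ := S.inner τ l (S.DY S.X τ l) (E τ l i.succ)

/-- The rotation `Θ_ij = ⟨D_Y E_i, E_j⟩` of the normal frame in the flow direction. -/
noncomputable def flowRot (S : FlowPart (N + 1)) (E : ℝ → ℝ → Fin (N + 1) → Fin (N + 1) → ℝ)
    (τ l : ℝ) : Matrix (Fin N) (Fin N) ℝ :=
  Matrix.of fun i j => S.inner τ l (S.DY (fun t s => E t s i.succ) τ l) (E τ l j.succ)

end FlowPart

/-- `w = 𝒥(e)` along a flow, where `p = D⁻¹(v · e)`. -/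
def JAlong {N : ℕ} (T L : Set ℝ) (v e : ℝ → ℝ → Fin N → ℝ) (p : ℝ → ℝ → ℝ)
    (w : ℝ → ℝ → Fin N → ℝ) : Prop :=
  ∀ τ ∈ T, ∀ l ∈ L, HasDerivAt (p τ) (v τ l ⬝ᵥ e τ l) l ∧
    HasDerivAt (e τ) (w τ l - p τ l • v τ l) l

/-- `u = ℋ(w)` along a flow, where `Θ = D⁻¹(v ∧ w)`. -/
def HAlong {N : ℕ} (T L : Set ℝ) (v w : ℝ → ℝ → Fin N → ℝ)
    (Θ : ℝ → ℝ → Matrix (Fin N) (Fin N) ℝ) (u : ℝ → ℝ → Fin N → ℝ) : Prop :=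
  ∀ τ ∈ T, ∀ l ∈ L,
    (∀ i j, HasDerivAt (fun s => Θ τ s i j) (wedge (v τ l) (w τ l) i j) l) ∧
    HasDerivAt (w τ) (u τ l - Matrix.vecMul (v τ l) (Θ τ l)) l

/-- `e` lies in the kernel of the recursion operator through `𝒥(e) = 0`, with
`p = D⁻¹(v · e)`. -/
def InRecursionKernel {N : ℕ} (T L : Set ℝ) (v e : ℝ → ℝ → Fin N → ℝ) (p : ℝ → ℝ → ℝ) : Prop :=
  JAlong T L v e p 0 ∧ HAlong T L v 0 0 0

/-- The flow equation `v_τ = F + v ⌋ C(τ)`. The skew matrix `C(τ)` is the rotation, constant along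
each curve, that is left undetermined by the parallel frame. -/
def FlowEquation {N : ℕ} (T L : Set ℝ) (v F : ℝ → ℝ → Fin N → ℝ)
    (C : ℝ → Matrix (Fin N) (Fin N) ℝ) : Prop :=
  (∀ τ, (C τ).transpose = -C τ) ∧
  ∀ τ ∈ T, ∀ l ∈ L, HasDerivAt (fun t => v t l) (F τ l + Matrix.vecMul (v τ l) (C τ)) τ

/-- How a hierarchy governs the non-stretching flows of one part of the geometry, of constant
curvature `χ`, in terms of the principal normal `v` in any parallel frame `E`. -/
structure Governs {N : ℕ} (R : FlowHierarchy N) (χ : ℝ) (S : FlowPart (N + 1)) (T L : Set ℝ)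
    (E : ℝ → ℝ → Fin (N + 1) → Fin (N + 1) → ℝ) : Prop where
  /-- every flow has the form `v_τ = ℋ(ϖ) + χ e_⊥`, `ϖ = 𝒥(e_⊥)` -/
  hamiltonian_form : ∃ u : ℝ → ℝ → Fin N → ℝ,
    JAlong T L (S.normal E) (S.ePerp E) S.ePar (S.flowNormal E) ∧
    HAlong T L (S.normal E) (S.flowNormal E) (-S.flowRot E) u ∧
    ∀ τ ∈ T, ∀ l ∈ L, HasDerivAt (fun t => S.normal E t l) (u τ l + χ • S.ePerp E τ l) τ
  /-- `0` flow -/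
  convective : S.IsConvectiveMap T L ↔
    ∀ τ ∈ T, ∀ l ∈ L, S.ePar τ l = 1 ∧ S.ePerp E τ l = 0
  convective_flow : S.IsConvectiveMap T L →
    ∃ C, (∀ τ ∈ T, ∀ l ∈ L, S.flowRot E τ l = -C τ) ∧
      FlowEquation T L (S.normal E) (fun τ l i => jetEval (R.vf 0 i) (S.normal E τ) l) C
  /-- `+1` flow -/
  mkdv : S.IsMKdVMap T L ↔ S.IsMapFlow (R.map 0) T L
  /-- `+(k+1)` flow -/
  map_flow : ∀ k, S.IsMapFlow (R.map k) T L ↔ ∀ τ ∈ T, ∀ l ∈ L,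
    S.ePar τ l = -jetEval (R.par k) (S.normal E τ) l ∧
    ∀ i, S.ePerp E τ l i = -jetEval (R.vf k i) (S.normal E τ) l
  map_flow_eq : ∀ k, S.IsMapFlow (R.map k) T L →
    ∃ C, (∀ τ ∈ T, ∀ l ∈ L, ∀ i j,
        S.flowRot E τ l i j = jetEval (R.rot (k + 1) i j) (S.normal E τ) l - C τ i j) ∧
      FlowEquation T L (S.normal E)
        (fun τ l i => -jetEval (R.vf (k + 1) i + χ • R.vf k i) (S.normal E τ) l) C
  /-- `-1` flow -/
  wave : S.IsWaveMap T L ↔ InRecursionKernel T L (S.normal E) (S.ePerp E) S.ePar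
  wave_flow : S.IsWaveMap T L →
    ∃ C, (∀ τ ∈ T, ∀ l ∈ L, S.flowRot E τ l = -C τ) ∧
      FlowEquation T L (S.normal E) (fun τ l => χ • S.ePerp E τ l) C

end CurveFlow

/-! The algebra and the geometry separate. On the algebraic side `v` is a formal variable and
integrals are differential polynomials modulo total derivatives. Skewness, closedness, the Jacobi
identities and compatibility of `ℋ` and `𝒥` then come from explicit primitives built out of the
antiderivatives `Θ`, `t` carried by the graphs. Passing from functionals to such identities needs
only that the Fréchet derivative of a variational derivative is self-adjoint
(`isTotalDeriv_jacobi`).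

The delicate point is that every `D⁻¹` in `(ℋ𝒥)^k v_l` stays a differential polynomial. In
generating series in a parameter `s`, with `W` for the covectors, `K` for the vector fields, `ρ` for
`D⁻¹(v · K)` and `Θ` for `D⁻¹(v ∧ W)`, the recursion is the linear system `Dρ = v·K`, `s DK = W -
sρv`, `s DW = K + sΘv`, `DΘ = v ∧ W`. It preserves `ρ² + |K|² - |W|² - ½ ∑ Θ_ij²`. The solution is
sought with `Θ` decomposable: `W = ρx`, `K = ρy`, `Θ = ρ x∧y`. This turns the system into the
Riccati system for `(x, y)`, which is solved coefficient by coefficient without integration, and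
setting the invariant equal to `1` gives `ρ` as an inverse square root (`d_rho`, `d_K`, `d_W`,
`d_rot`). So all antiderivatives are read off as coefficients of polynomial series.

The covectors are gradients because the variation of `ρ` along `Z` equals `Z · s d/ds W`, up to a
factor `s` and a total derivative (`variation_rho`). Involution is the Lenard–Magri argument, and
involution implies commutation (`vfBracket_eq_zero_of_involution`). The coefficients of `x` and `y`
are combinations of the normal parts of `D_X^j X` with coefficients polynomial in the inner products
(`riccatiCoeff_mem`), whence the map operators.

On the geometric side, pulling torsion and curvature back along the flow (`structure_eq`,
`curvature_eq`) yields `D_Y X = D_X Y` and a commutator `[D_Y, D_X]` of constant curvature type. In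
a parallel frame these become `ϖ = 𝒥(e_⊥)`, `Θ_l = -v∧ϖ` and the equation for `v_τ`. Each flow
follows by inserting its `e_∥`, `e_⊥`; the constant of integration of `Θ` is the matrix `C(τ)`
(`exists_flowEquation`). -/

namespace CurveFlow

open MvPolynomial Finset

/-! ## Derivations acting on vectors and matrices -/

section Derivations

variable {A : Type*} [CommRing A] [Algebra ℝ A] {N : ℕ}

/-- A derivation applied to the components of a vector. -/
def dvec (d : Derivation ℝ A A) (a : Fin N → A) : Fin N → A := fun i => d (a i)

@[simp] theorem dvec_apply (d : Derivation ℝ A A) (a : Fin N → A) (i : Fin N) :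
    dvec d a i = d (a i) := rfl

theorem dvec_add (d : Derivation ℝ A A) (a b : Fin N → A) :
    dvec d (a + b) = dvec d a + dvec d b := by ext; simp

theorem dvec_sub (d : Derivation ℝ A A) (a b : Fin N → A) :
    dvec d (a - b) = dvec d a - dvec d b := by ext; simp

theorem dvec_smul (d : Derivation ℝ A A) (c : A) (a : Fin N → A) :
    dvec d (c • a) = d c • a + c • dvec d a := by
  ext; simp [mul_comm]; ring

theorem map_dotProduct (d : Derivation ℝ A A) (a b : Fin N → A) :
    d (a ⬝ᵥ b) = dvec d a ⬝ᵥ b + a ⬝ᵥ dvec d b := by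
  simp only [dotProduct, map_sum, Derivation.leibniz, smul_eq_mul, dvec_apply,
    Finset.sum_add_distrib]
  rw [add_comm]
  congr 1
  exact Finset.sum_congr rfl fun i _ => mul_comm _ _

theorem dvec_mulVec (d : Derivation ℝ A A) (Θ : Matrix (Fin N) (Fin N) A) (a : Fin N → A) :
    dvec d (Θ.mulVec a) = (Θ.map d).mulVec a + Θ.mulVec (dvec d a) := by
  ext i
  exact map_dotProduct d (Θ i) a

theorem map_wedge (d : Derivation ℝ A A) (a b : Fin N → A) :
    (wedge a b).map d = wedge (dvec d a) b + wedge a (dvec d b) := by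
  ext i j
  simp [wedge, Matrix.vecMulVec_apply]
  ring

theorem map_mul_matrix (d : Derivation ℝ A A) (M K : Matrix (Fin N) (Fin N) A) :
    (M * K).map d = M.map d * K + M * K.map d := by
  ext i j
  exact map_dotProduct d (M i) fun k => K k j

theorem map_trace (d : Derivation ℝ A A) (M : Matrix (Fin N) (Fin N) A) :
    d M.trace = (M.map d).trace := by
  simp [Matrix.trace]

end Derivations

/-! ### Algebra of wedge products and skew matrices -/

section Wedge

variable {A : Type*} [CommRing A] {N : ℕ}

theorem wedge_mulVec (a b c : Fin N → A) :
    (wedge a b).mulVec c = (b ⬝ᵥ c) • a - (a ⬝ᵥ c) • b := by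
  simp only [wedge, Matrix.sub_mulVec, Matrix.vecMulVec_mulVec]
  ext; simp

theorem wedge_transpose (a b : Fin N → A) : (wedge a b).transpose = -wedge a b := by
  simp [wedge]

theorem wedge_self (a : Fin N → A) : wedge a a = 0 := by
  simp [wedge]

theorem wedge_add_right (a b c : Fin N → A) : wedge a (b + c) = wedge a b + wedge a c := by
  simp only [wedge, Matrix.add_vecMulVec, Matrix.vecMulVec_add]; abel

theorem wedge_smul_right (r : A) (a b : Fin N → A) : wedge a (r • b) = r • wedge a b := by
  simp only [wedge, Matrix.smul_vecMulVec, Matrix.vecMulVec_smul, smul_sub]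

theorem vecMul_of_skew {Θ : Matrix (Fin N) (Fin N) A} (h : Θ.transpose = -Θ) (a : Fin N → A) :
    Matrix.vecMul a Θ = -Θ.mulVec a := by
  rw [← Matrix.mulVec_transpose, h, Matrix.neg_mulVec]

theorem dot_mulVec_of_skew {Θ : Matrix (Fin N) (Fin N) A} (h : Θ.transpose = -Θ)
    (a b : Fin N → A) : a ⬝ᵥ Θ.mulVec b = -(b ⬝ᵥ Θ.mulVec a) := by
  rw [Matrix.dotProduct_mulVec, vecMul_of_skew h, neg_dotProduct, dotProduct_comm]

theorem mulVec_dot_of_skew {Θ : Matrix (Fin N) (Fin N) A} (h : Θ.transpose = -Θ)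
    (a b : Fin N → A) : Θ.mulVec a ⬝ᵥ b = -(a ⬝ᵥ Θ.mulVec b) := by
  rw [dotProduct_comm, dot_mulVec_of_skew h]

/-- The pairing `∑ Θ_ij Ψ_ij` of matrices. -/
def mpair (Θ Ψ : Matrix (Fin N) (Fin N) A) : A := ∑ i, ∑ j, Θ i j * Ψ i j

theorem mpair_comm (Θ Ψ : Matrix (Fin N) (Fin N) A) : mpair Θ Ψ = mpair Ψ Θ := by
  simp only [mpair, mul_comm]

theorem mpair_add (Θ Ψ Φ : Matrix (Fin N) (Fin N) A) :
    mpair Θ (Ψ + Φ) = mpair Θ Ψ + mpair Θ Φ := by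
  simp only [mpair, Matrix.add_apply, mul_add, Finset.sum_add_distrib]

/-- The two halves of the wedge contribute equally. Because of this factor `2`, some identities
below are proved first for twice the expression. -/
theorem mpair_wedge {Θ : Matrix (Fin N) (Fin N) A} (h : Θ.transpose = -Θ) (a b : Fin N → A) :
    mpair Θ (wedge a b) = 2 * (a ⬝ᵥ Θ.mulVec b) := by
  have h1 : ∀ a b : Fin N → A, ∑ i, ∑ j, Θ i j * (a i * b j) = a ⬝ᵥ Θ.mulVec b := by
    intro a b
    simp only [dotProduct, Matrix.mulVec, Finset.mul_sum]
    exact Finset.sum_congr rfl fun i _ => Finset.sum_congr rfl fun j _ => by ring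
  simp only [mpair, wedge, Matrix.sub_apply, Matrix.vecMulVec_apply, mul_sub,
    Finset.sum_sub_distrib, h1]
  rw [dot_mulVec_of_skew h b a]
  ring

theorem map_mpair [Algebra ℝ A] (d : Derivation ℝ A A) (Θ Ψ : Matrix (Fin N) (Fin N) A) :
    d (mpair Θ Ψ) = mpair (Θ.map d) Ψ + mpair Θ (Ψ.map d) := by
  simp only [mpair, map_sum, Derivation.leibniz, smul_eq_mul, ← Finset.sum_add_distrib,
    Matrix.map_apply]
  exact Finset.sum_congr rfl fun i _ => Finset.sum_congr rfl fun j _ => by ring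

end Wedge

/-! ## Differential polynomials -/

variable {N : ℕ}

theorem vecD_eq_dvec (Q : Fin N → Jet N) : vecD Q = dvec (totalD N) Q := rfl

theorem vecEvolD_eq_dvec (P Q : Fin N → Jet N) : vecEvolD P Q = dvec (evolD P) Q := rfl

@[simp] theorem totalD_X (i : Fin N) (j : ℕ) :
    totalD N (X (i, j) : Jet N) = X (i, j + 1) := by
  simp [totalD, mkDerivation_X]

@[simp] theorem evolD_X (Q : Fin N → Jet N) (i : Fin N) (j : ℕ) :
    evolD Q (X (i, j) : Jet N) = (totalD N)^[j] (Q i) := by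
  simp [evolD, mkDerivation_X]

theorem totalD_two : totalD N (2 : Jet N) = 0 := by
  exact_mod_cast (totalD N).map_natCast 2

theorem dvec_evolD_jetV (Q : Fin N → Jet N) : dvec (evolD Q) (jetV N) = Q := by
  ext1 i; simp [jetV]

/-- A commutator of derivations is a derivation, so it suffices to evaluate it on the generators. -/
theorem evolD_totalD (Q : Fin N → Jet N) (f : Jet N) :
    evolD Q (totalD N f) = totalD N (evolD Q f) := by
  have h : ⁅evolD Q, totalD N⁆ = 0 := by
    refine derivation_ext fun p => ?_
    obtain ⟨i, j⟩ := p
    simp [Derivation.commutator_apply, Function.iterate_succ_apply']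
  have := congrArg (fun d : Derivation ℝ (Jet N) (Jet N) => d f) h
  simpa [Derivation.commutator_apply, sub_eq_zero] using this

theorem evolD_iterate (Q : Fin N → Jet N) (j : ℕ) (f : Jet N) :
    evolD Q ((totalD N)^[j] f) = (totalD N)^[j] (evolD Q f) := by
  induction j with
  | zero => rfl
  | succ j ih => simp only [Function.iterate_succ_apply', evolD_totalD, ih]

theorem evolD_vfBracket (P Q : Fin N → Jet N) (f : Jet N) :
    evolD (vfBracket P Q) f = evolD P (evolD Q f) - evolD Q (evolD P f) := by
  have h : ⁅evolD P, evolD Q⁆ = evolD (vfBracket P Q) := by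
    refine derivation_ext fun p => ?_
    obtain ⟨i, j⟩ := p
    simp [Derivation.commutator_apply, evolD_iterate, vfBracket, vecEvolD]
  rw [← h, Derivation.commutator_apply]

theorem dvec_evolD_totalD (Q P : Fin N → Jet N) :
    dvec (evolD Q) (dvec (totalD N) P) = dvec (totalD N) (dvec (evolD Q) P) := by
  ext1 i; exact evolD_totalD Q (P i)

/-- This relation controls the order of a primitive in terms of the order of its total derivative.
-/
theorem pderiv_totalD_succ (i : Fin N) (j : ℕ) (f : Jet N) :
    pderiv (i, j + 1) (totalD N f) = totalD N (pderiv (i, j + 1) f) + pderiv (i, j) f := by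
  classical
  have h : ⁅(pderiv (i, j + 1) : Derivation ℝ (Jet N) (Jet N)), totalD N⁆ =
      (pderiv (i, j) : Derivation ℝ (Jet N) (Jet N)) := by
    refine derivation_ext fun p => ?_
    obtain ⟨k, l⟩ := p
    simp only [Derivation.commutator_apply, totalD_X, pderiv_X, Pi.single_apply, Prod.mk.injEq,
      add_left_inj]
    split_ifs <;> simp
  rw [← h, Derivation.commutator_apply]
  ring

theorem pderiv_pderiv_comm (p q : Fin N × ℕ) (f : Jet N) :
    pderiv p (pderiv q f) = pderiv q (pderiv p f) := by
  classical
  have h : ⁅(pderiv p : Derivation ℝ (Jet N) (Jet N)),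
      (pderiv q : Derivation ℝ (Jet N) (Jet N))⁆ = 0 := by
    refine derivation_ext fun k => ?_
    simp only [Derivation.commutator_apply, pderiv_X, Pi.single_apply]
    split_ifs <;> simp
  have := congrArg (fun d : Derivation ℝ (Jet N) (Jet N) => d f) h
  simpa [Derivation.commutator_apply, sub_eq_zero] using this

/-- The largest order of a derivative on which a differential polynomial depends. -/
noncomputable def jetOrder (F : Jet N) : ℕ := F.vars.sup Prod.snd

theorem pderiv_eq_zero_of_order_lt {F : Jet N} {i : Fin N} {j : ℕ} (h : jetOrder F < j) :
    pderiv (i, j) F = 0 := by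
  refine pderiv_eq_zero_of_notMem_vars fun hm => ?_
  exact absurd (Finset.le_sup (f := Prod.snd) hm) (not_le.2 h)

/-- A primitive has lower order than its total derivative: `∂_{j+1} D G = D ∂_{j+1} G + ∂_j G` lets
the vanishing of partial derivatives descend from above the order of `G` down to `M`. -/
theorem pderiv_eq_zero_of_totalD {G : Jet N} {M : ℕ}
    (h : ∀ i j, M < j → pderiv (i, j) (totalD N G) = 0) :
    ∀ i j, M ≤ j → pderiv (i, j) G = 0 := by
  have key : ∀ k i j, M ≤ j → jetOrder G < j + k → pderiv (i, j) G = 0 := by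
    intro k
    induction k with
    | zero => exact fun i j _ hj => pderiv_eq_zero_of_order_lt hj
    | succ k ih =>
      intro i j hM hj
      have h1 := pderiv_totalD_succ i j G
      rw [h i (j + 1) (by omega), ih i (j + 1) (by omega) (by omega), map_zero, zero_add] at h1
      exact h1.symm
  exact fun i j hM => key (jetOrder G + 1) i j hM (by omega)

/-- The kernel of `D` consists of constants: the preceding lemma with `M = 0` kills all partial
derivatives, and in characteristic zero these determine every nonconstant coefficient. -/
theorem eq_zero_of_totalD_eq_zero {G : Jet N} (h : totalD N G = 0)
    (h0 : constantCoeff G = 0) : G = 0 := by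
  have hp : ∀ i j, pderiv (i, j) G = 0 := fun i j =>
    pderiv_eq_zero_of_totalD (M := 0) (by simp [h]) i j (Nat.zero_le _)
  ext m
  by_cases hm : m = 0
  · subst hm
    simpa [constantCoeff_eq] using h0
  · obtain ⟨p, hp'⟩ : ∃ p, m p ≠ 0 := by
      by_contra hcon
      push Not at hcon
      exact hm (Finsupp.ext hcon)
    have h1 := coeff_pderiv (i := p) G (m - Finsupp.single p 1)
    have h2 : m - Finsupp.single p 1 + Finsupp.single p 1 = m :=
      tsub_add_cancel_of_le (Finsupp.single_le_iff.2 (Nat.one_le_iff_ne_zero.2 hp'))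
    rw [h2, show pderiv p G = 0 from hp p.1 p.2, coeff_zero] at h1
    rw [coeff_zero]
    rcases mul_eq_zero.1 h1.symm with h3 | h3
    · exact h3
    · exact absurd h3 (by positivity)

theorem IsAntideriv.unique {f g g' : Jet N} (h : IsAntideriv f g) (h' : IsAntideriv f g') :
    g = g' := by
  refine sub_eq_zero.1 (eq_zero_of_totalD_eq_zero ?_ ?_)
  · rw [map_sub, h.1, h'.1, sub_self]
  · rw [map_sub, h.2, h'.2, sub_self]

theorem IsTotalDeriv.add {f g : Jet N} (hf : IsTotalDeriv f) (hg : IsTotalDeriv g) :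
    IsTotalDeriv (f + g) := by
  obtain ⟨a, rfl⟩ := hf
  obtain ⟨b, rfl⟩ := hg
  exact ⟨a + b, map_add _ _ _⟩

theorem IsTotalDeriv.neg {f : Jet N} (hf : IsTotalDeriv f) : IsTotalDeriv (-f) := by
  obtain ⟨a, rfl⟩ := hf
  exact ⟨-a, map_neg _ _⟩

theorem IsTotalDeriv.sub {f g : Jet N} (hf : IsTotalDeriv f) (hg : IsTotalDeriv g) :
    IsTotalDeriv (f - g) := by
  rw [sub_eq_add_neg]; exact hf.add hg.neg

theorem IsTotalDeriv.smul {f : Jet N} (c : ℝ) (hf : IsTotalDeriv f) : IsTotalDeriv (c • f) := by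
  obtain ⟨a, rfl⟩ := hf
  exact ⟨c • a, (totalD N).map_smul c a⟩

theorem IsTotalDeriv.zero : IsTotalDeriv (0 : Jet N) := ⟨0, map_zero _⟩

theorem IsTotalDeriv.sum {ι : Type*} {s : Finset ι} {f : ι → Jet N}
    (h : ∀ i ∈ s, IsTotalDeriv (f i)) : IsTotalDeriv (∑ i ∈ s, f i) := by
  classical
  induction s using Finset.induction_on with
  | empty => simpa using IsTotalDeriv.zero
  | insert a s ha ih =>
    rw [Finset.sum_insert ha]
    exact (h a (Finset.mem_insert_self _ _)).add
      (ih fun i hi => h i (Finset.mem_insert_of_mem hi))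

theorem IsTotalDeriv.evolD {f : Jet N} (Q : Fin N → Jet N) (hf : IsTotalDeriv f) :
    IsTotalDeriv (evolD Q f) := by
  obtain ⟨a, rfl⟩ := hf
  exact ⟨CurveFlow.evolD Q a, (evolD_totalD Q a).symm⟩

/-- The fundamental lemma of the calculus of variations. The test polynomial is the square of a jet
variable `X_M` of order above that of `f`. A primitive of `X_M² f` has order below `M`, so its total
derivative is affine in `X_M`, whereas the second `X_M`-derivative of `X_M² f` is `2f`. -/
theorem eq_zero_of_forall_mul_isTotalDeriv {f : Jet N} (i : Fin N)
    (h : ∀ g, IsTotalDeriv (g * f)) : f = 0 := by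
  classical
  set M := jetOrder f + 1 with hM
  obtain ⟨G, hG⟩ := h (X (i, M) ^ 2)
  have hfM : ∀ k j, M ≤ j → pderiv (k, j) f = 0 := fun k j hj =>
    pderiv_eq_zero_of_order_lt (by omega)
  have hG0 := pderiv_eq_zero_of_totalD (M := M) (G := G) (by
    intro k j hj
    rw [hG, pderiv_mul, hfM k j hj.le, pderiv_pow, pderiv_X_of_ne (by simp; omega)]
    simp)
  have h1 : pderiv (i, M) (totalD N G) = pderiv (i, jetOrder f) G := by
    rw [hM, pderiv_totalD_succ, ← hM, hG0 i M le_rfl, map_zero, zero_add]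
  have h2 : pderiv (i, M) (pderiv (i, M) (totalD N G)) = 0 := by
    rw [h1, pderiv_pderiv_comm, hG0 i M le_rfl, map_zero]
  rw [hG] at h2
  simp only [pderiv_mul, pderiv_pow, hfM i M le_rfl, pderiv_X_self, mul_zero, add_zero] at h2
  have h3 : (2 : Jet N) = C 2 := rfl
  have h4 : (2 : Jet N) ≠ 0 := two_ne_zero
  simpa [pderiv_mul, hfM i M le_rfl, h3 ▸ pderiv_C, h4] using h2

theorem eq_zero_of_forall_dot_isTotalDeriv {w : Fin N → Jet N}
    (h : ∀ Z : Fin N → Jet N, IsTotalDeriv (Z ⬝ᵥ w)) : w = 0 := by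
  ext1 i
  refine eq_zero_of_forall_mul_isTotalDeriv i fun g => ?_
  simpa using h (Pi.single i g)

/-! ## The variational derivative -/

theorem derivation_sum_apply {ι : Type*} (s : Finset ι) (d : ι → Derivation ℝ (Jet N) (Jet N))
    (F : Jet N) : (∑ i ∈ s, d i) F = ∑ i ∈ s, d i F := by
  classical
  induction s using Finset.induction_on with
  | empty => simp
  | insert a s ha ih => rw [Finset.sum_insert ha, Finset.sum_insert ha, Derivation.add_apply, ih]

theorem evolD_eq_sum (Q : Fin N → Jet N) (F : Jet N) :
    evolD Q F = ∑ i, ∑ j ∈ range (jetOrder F + 1),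
      pderiv (i, j) F * (totalD N)^[j] (Q i) := by
  classical
  set n := jetOrder F + 1 with hn
  have h : evolD Q F = (∑ i, ∑ j ∈ range n, ((totalD N)^[j] (Q i)) •
      (pderiv (i, j) : Derivation ℝ (Jet N) (Jet N))) F := by
    refine derivation_eq_of_forall_mem_vars fun p hp => ?_
    obtain ⟨k, l⟩ := p
    have hl : l ∈ range n := by
      rw [mem_range, hn]
      exact Nat.lt_succ_of_le (Finset.le_sup (f := Prod.snd) hp)
    simp only [evolD_X, derivation_sum_apply, Derivation.smul_apply, pderiv_X, smul_eq_mul]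
    rw [Finset.sum_eq_single k, Finset.sum_eq_single l]
    · simp
    · intro j _ hj
      simp [Ne.symm hj]
    · exact fun h => absurd hl h
    · intro j _ hj
      refine Finset.sum_eq_zero fun a _ => ?_
      simp [Ne.symm hj]
    · simp
  rw [h]
  simp only [derivation_sum_apply, Derivation.smul_apply, smul_eq_mul, mul_comm]

theorem isTotalDeriv_mul_iterate (j : ℕ) (a b : Jet N) :
    IsTotalDeriv (a * (totalD N)^[j] b - ((-1) ^ j * (totalD N)^[j] a) * b) := by
  induction j generalizing a with
  | zero => simpa using IsTotalDeriv.zero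
  | succ j ih =>
    obtain ⟨G, hG⟩ := ih (totalD N a)
    refine ⟨a * (totalD N)^[j] b - G, ?_⟩
    rw [map_sub, hG, Derivation.leibniz, Function.iterate_succ_apply', Function.iterate_succ_apply,
      smul_eq_mul, smul_eq_mul]
    ring

theorem isTotalDeriv_evolD_sub_euler (Q : Fin N → Jet N) (F : Jet N) :
    IsTotalDeriv (evolD Q F - euler F ⬝ᵥ Q) := by
  rw [evolD_eq_sum]
  have he : ∀ i, euler F i = ∑ j ∈ range (jetOrder F + 1),
      (-1) ^ j * (totalD N)^[j] (pderiv (i, j) F) := fun i => rfl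
  simp only [dotProduct, he, Finset.sum_mul, ← Finset.sum_sub_distrib]
  exact IsTotalDeriv.sum fun i _ => IsTotalDeriv.sum fun j _ => isTotalDeriv_mul_iterate j _ _

/-- The Fréchet derivative of a variational derivative is self-adjoint. -/
theorem isTotalDeriv_selfAdjoint_euler (F : Jet N) (Y Z : Fin N → Jet N) :
    IsTotalDeriv (dvec (evolD Z) (euler F) ⬝ᵥ Y - dvec (evolD Y) (euler F) ⬝ᵥ Z) := by
  -- Differentiate the first variation along `Y` in the direction `Z` and antisymmetrize. The second
  -- variations of `F` combine into its variation along the bracket of `Z` and `Y`, which also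
  -- removes the derivatives of `Y` and `Z`.
  obtain ⟨a, ha⟩ := (isTotalDeriv_evolD_sub_euler Y F).evolD Z
  obtain ⟨b, hb⟩ := (isTotalDeriv_evolD_sub_euler Z F).evolD Y
  obtain ⟨c, hc⟩ := isTotalDeriv_evolD_sub_euler (vfBracket Z Y) F
  refine ⟨b - a + c, ?_⟩
  rw [map_add, map_sub, ha, hb, hc, evolD_vfBracket]
  simp only [map_sub, map_dotProduct, vfBracket, vecEvolD_eq_dvec, dotProduct_sub]
  ring

/-- The first variation formula characterizes `δF/δv`; this is how the covectors of the hierarchy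
are recognized as gradients. -/
theorem euler_eq_of_forall {F : Jet N} {w : Fin N → Jet N}
    (h : ∀ Z : Fin N → Jet N, IsTotalDeriv (evolD Z F - w ⬝ᵥ Z)) : w = euler F := by
  refine sub_eq_zero.1 (eq_zero_of_forall_dot_isTotalDeriv fun Z => ?_)
  have := (isTotalDeriv_evolD_sub_euler Z F).sub (h Z)
  convert this using 1
  rw [dotProduct_sub, dotProduct_comm Z, dotProduct_comm Z]
  ring

end CurveFlow

namespace CurveFlow

open MvPolynomial Finset

/-! ## The operators `ℋ` and `𝒥` -/

section Trace

variable {A : Type*} [CommRing A] {N : ℕ}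

theorem trace_wedge_mul (a b : Fin N → A) (M : Matrix (Fin N) (Fin N) A) :
    (wedge a b * M).trace = b ⬝ᵥ M.mulVec a - a ⬝ᵥ M.mulVec b := by
  have h : ∀ a b : Fin N → A, (Matrix.vecMulVec a b * M).trace = b ⬝ᵥ M.mulVec a := by
    intro a b
    rw [Matrix.vecMulVec_mul, Matrix.trace_vecMulVec, Matrix.dotProduct_mulVec, dotProduct_comm]
  rw [wedge, Matrix.sub_mul, Matrix.trace_sub, h, h]

end Trace

variable {N : ℕ}

theorem isTotalDeriv_of_two_mul {f : Jet N} (h : IsTotalDeriv (2 * f)) : IsTotalDeriv f := by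
  have := h.smul (1 / 2)
  have h2 : (2 : Jet N) * f = (2 : ℝ) • f := by rw [two_smul, two_mul]
  rwa [h2, smul_smul, show (1 / 2 * 2 : ℝ) = 1 by norm_num, one_smul] at this

/-- Skewness of `Θ` is not part of the graph. It follows from uniqueness of antiderivatives with
zero constant term, and it turns `v ⌋ Θ` into `-Θ v`. -/
theorem exists_of_HRel {w u : Fin N → Jet N} (h : HRel w u) :
    ∃ Θ : Matrix (Fin N) (Fin N) (Jet N), Θ.transpose = -Θ ∧
      Θ.map (totalD N) = wedge (jetV N) w ∧ (∀ i j, constantCoeff (Θ i j) = 0) ∧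
      u = dvec (totalD N) w - Θ.mulVec (jetV N) := by
  obtain ⟨Θ, hΘ, hu⟩ := h
  have hs : Θ.transpose = -Θ := by
    ext1 i j
    refine (hΘ j i).unique ⟨?_, ?_⟩
    · rw [Matrix.neg_apply, map_neg, (hΘ i j).1, wedge, Matrix.sub_apply, Matrix.sub_apply]
      simp only [Matrix.vecMulVec_apply]
      ring
    · rw [Matrix.neg_apply, map_neg, (hΘ i j).2, neg_zero]
  refine ⟨Θ, hs, ?_, fun i j => (hΘ i j).2, ?_⟩
  · ext1 i j
    exact (hΘ i j).1
  · rw [hu, vecMul_of_skew hs, vecD_eq_dvec, sub_eq_add_neg]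

theorem map_map_evolD (Z : Fin N → Jet N) (Θ : Matrix (Fin N) (Fin N) (Jet N)) :
    (Θ.map (evolD Z)).map (totalD N) = (Θ.map (totalD N)).map (evolD Z) := by
  ext1 i j
  exact (evolD_totalD Z (Θ i j)).symm

theorem transpose_map_of_skew {A : Type*} [CommRing A] [Algebra ℝ A] (d : Derivation ℝ A A)
    {Θ : Matrix (Fin N) (Fin N) A} (h : Θ.transpose = -Θ) : (Θ.map d).transpose = -Θ.map d := by
  ext1 i j
  have := congrFun (congrFun h i) j
  simp only [Matrix.transpose_apply, Matrix.neg_apply, Matrix.map_apply] at this ⊢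
  rw [this, map_neg]

section HOp

variable {f g k X Y K' : Fin N → Jet N} {Θf Θg Θk : Matrix (Fin N) (Fin N) (Jet N)}

/-- Integration by parts, for the local terms through `f·g` and for the nonlocal ones through the
pairing of `Θf` with `Θg`. -/
theorem isTotalDeriv_H_skew (sf : Θf.transpose = -Θf) (sg : Θg.transpose = -Θg)
    (df : Θf.map (totalD N) = wedge (jetV N) f) (dg : Θg.map (totalD N) = wedge (jetV N) g)
    (hX : X = dvec (totalD N) f - Θf.mulVec (jetV N))
    (hY : Y = dvec (totalD N) g - Θg.mulVec (jetV N)) :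
    IsTotalDeriv (f ⬝ᵥ Y + g ⬝ᵥ X) := by
  refine isTotalDeriv_of_two_mul ⟨2 * (f ⬝ᵥ g) + mpair Θf Θg, ?_⟩
  rw [map_add, map_mpair, Derivation.leibniz, map_dotProduct, df, dg, mpair_comm (wedge _ _),
    mpair_wedge sf, mpair_wedge sg, hX, hY]
  simp only [dotProduct_sub, sub_dotProduct, mulVec_dot_of_skew sf, dot_mulVec_of_skew sg f,
    dotProduct_comm g, smul_eq_mul, totalD_two]
  ring

/-- Varying `Y = ℋ(g)` along `Z` varies both `g` and the `v` inside `ℋ`. Skewness cancels the first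
effect against the pairing of `δ_Z g` with `X`. The second, after the varied `Θg` is integrated by
parts against `Θf`, is algebraic in `Z`. -/
theorem isTotalDeriv_H_evolD (sf : Θf.transpose = -Θf) (sg : Θg.transpose = -Θg)
    (df : Θf.map (totalD N) = wedge (jetV N) f) (dg : Θg.map (totalD N) = wedge (jetV N) g)
    (hX : X = dvec (totalD N) f - Θf.mulVec (jetV N))
    (hY : Y = dvec (totalD N) g - Θg.mulVec (jetV N)) (Z : Fin N → Jet N) :
    IsTotalDeriv (f ⬝ᵥ dvec (evolD Z) Y + dvec (evolD Z) g ⬝ᵥ X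
      - (Z ⬝ᵥ Θg.mulVec f - Z ⬝ᵥ Θf.mulVec g)) := by
  set a := dvec (evolD Z) g with ha
  set Ψ := Θg.map (evolD Z) with hΨ
  have sΨ : Ψ.transpose = -Ψ := transpose_map_of_skew _ sg
  have dΨ : Ψ.map (totalD N) = wedge Z g + wedge (jetV N) a := by
    rw [hΨ, map_map_evolD, dg, map_wedge, dvec_evolD_jetV]
  refine isTotalDeriv_of_two_mul ⟨2 * (f ⬝ᵥ a) + mpair Θf Ψ, ?_⟩
  rw [map_add, map_mpair, Derivation.leibniz, map_dotProduct, df, dΨ, mpair_comm (wedge _ _),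
    mpair_wedge sΨ, mpair_add, mpair_wedge sf, mpair_wedge sf, hX, hY, dvec_sub, dvec_mulVec,
    dvec_evolD_totalD, dvec_evolD_jetV, ← ha, ← hΨ]
  simp only [dotProduct_sub, dotProduct_add, sub_dotProduct, mulVec_dot_of_skew sf,
    dot_mulVec_of_skew sg f, dot_mulVec_of_skew sΨ f, dotProduct_comm a, smul_eq_mul, totalD_two]
  ring

/-- This is the Jacobi identity of `ℋ` once second variations are gone. The terms with `Df`, `Dg`,
`Dk` come from the primitive `k·Θg f + f·Θk g + g·Θf k`, and those with two rotations form the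
derivative of `tr(Θf Θg Θk)`, by cyclicity of the trace. -/
theorem isTotalDeriv_H_cyclic (sf : Θf.transpose = -Θf) (sg : Θg.transpose = -Θg)
    (sk : Θk.transpose = -Θk)
    (df : Θf.map (totalD N) = wedge (jetV N) f) (dg : Θg.map (totalD N) = wedge (jetV N) g)
    (dk : Θk.map (totalD N) = wedge (jetV N) k)
    (hX : X = dvec (totalD N) f - Θf.mulVec (jetV N))
    (hY : Y = dvec (totalD N) g - Θg.mulVec (jetV N))
    (hZ : K' = dvec (totalD N) k - Θk.mulVec (jetV N)) :
    IsTotalDeriv ((K' ⬝ᵥ Θg.mulVec f - K' ⬝ᵥ Θf.mulVec g)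
      + (X ⬝ᵥ Θk.mulVec g - X ⬝ᵥ Θg.mulVec k) + (Y ⬝ᵥ Θf.mulVec k - Y ⬝ᵥ Θk.mulVec f)) := by
  have ht : totalD N (Θf * Θg * Θk).trace =
      (jetV N ⬝ᵥ Θk.mulVec (Θg.mulVec f) - jetV N ⬝ᵥ Θg.mulVec (Θk.mulVec f))
      + (jetV N ⬝ᵥ Θf.mulVec (Θk.mulVec g) - jetV N ⬝ᵥ Θk.mulVec (Θf.mulVec g))
      + (jetV N ⬝ᵥ Θg.mulVec (Θf.mulVec k) - jetV N ⬝ᵥ Θf.mulVec (Θg.mulVec k)) := by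
    have h3 : ∀ {Θ Ψ : Matrix (Fin N) (Fin N) (Jet N)}, Θ.transpose = -Θ → Ψ.transpose = -Ψ →
        ∀ a b : Fin N → Jet N, a ⬝ᵥ Θ.mulVec (Ψ.mulVec b) = b ⬝ᵥ Ψ.mulVec (Θ.mulVec a) := by
      intro Θ Ψ hΘ hΨ a b
      rw [dot_mulVec_of_skew hΘ, mulVec_dot_of_skew hΨ, neg_neg]
    rw [map_trace, map_mul_matrix, map_mul_matrix, df, dg, dk, add_mul, Matrix.trace_add,
      Matrix.trace_add, Matrix.mul_assoc (wedge _ _), Matrix.trace_mul_cycle Θf,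
      Matrix.trace_mul_comm (Θf * Θg), Matrix.trace_mul_comm (Θk * Θf)]
    simp only [trace_wedge_mul, ← Matrix.mulVec_mulVec]
    rw [h3 sg sk f, h3 sk sf g, h3 sf sg k]
  refine ⟨(Θf * Θg * Θk).trace + (k ⬝ᵥ Θg.mulVec f + f ⬝ᵥ Θk.mulVec g + g ⬝ᵥ Θf.mulVec k), ?_⟩
  simp only [map_add, ht, map_dotProduct, dvec_mulVec, df, dg, dk, hX, hY, hZ, wedge_mulVec,
    sub_dotProduct, mulVec_dot_of_skew sf, mulVec_dot_of_skew sg, mulVec_dot_of_skew sk,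
    dotProduct_add, dotProduct_sub, dotProduct_smul, smul_eq_mul, dotProduct_comm _ (jetV N)]
  rw [dot_mulVec_of_skew sg k, dot_mulVec_of_skew sk f, dot_mulVec_of_skew sf g,
    dotProduct_comm g f, dotProduct_comm f k, dotProduct_comm k g]
  ring

end HOp

section JOp

variable {x y z f g k X Y K' : Fin N → Jet N} {tx ty tz : Jet N}

theorem isTotalDeriv_J_skew (dx : totalD N tx = jetV N ⬝ᵥ x) (dy : totalD N ty = jetV N ⬝ᵥ y)
    (hf : f = dvec (totalD N) x + tx • jetV N) (hg : g = dvec (totalD N) y + ty • jetV N) :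
    IsTotalDeriv (x ⬝ᵥ g + y ⬝ᵥ f) := by
  refine ⟨x ⬝ᵥ y + tx * ty, ?_⟩
  simp only [map_add, map_dotProduct, Derivation.leibniz, dx, dy, hf, hg, dotProduct_add, add_dotProduct,
    dotProduct_smul, smul_dotProduct, smul_eq_mul, dotProduct_comm x (jetV N), dotProduct_comm y]
  ring

/-- Arranged as for `ℋ`, with the vector fields `x`, `y` in the places of `X`, `Y`, so that it
serves both the closedness of `ω` and the Jacobi identity of `𝒥⁻¹`. When `Z` is the third vector
field, the cyclic sum of the remainders is identically zero. -/
theorem isTotalDeriv_J_evolD (dx : totalD N tx = jetV N ⬝ᵥ x) (dy : totalD N ty = jetV N ⬝ᵥ y)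
    (hf : f = dvec (totalD N) x + tx • jetV N) (hg : g = dvec (totalD N) y + ty • jetV N)
    (Z : Fin N → Jet N) :
    IsTotalDeriv (f ⬝ᵥ dvec (evolD Z) y + dvec (evolD Z) g ⬝ᵥ x
      - (ty * (x ⬝ᵥ Z) - tx * (Z ⬝ᵥ y))) := by
  refine ⟨x ⬝ᵥ dvec (evolD Z) y + tx * evolD Z ty, ?_⟩
  simp only [map_add, map_dotProduct, Derivation.leibniz, dx, hf, hg, dotProduct_add,
    add_dotProduct, dotProduct_smul, smul_dotProduct, dvec_add, dvec_smul, dvec_evolD_jetV,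
    dvec_evolD_totalD, ← evolD_totalD, dy, smul_eq_mul, dotProduct_comm _ x]
  ring

/-- The mixed part of the Jacobi identity of the pencil: remainders of `ℋ` evaluated on the fields
of `𝒥⁻¹`, and conversely. This is the compatibility of the two operators. -/
theorem isTotalDeriv_HJ_cyclic {Θf Θg Θk : Matrix (Fin N) (Fin N) (Jet N)}
    (sf : Θf.transpose = -Θf) (sg : Θg.transpose = -Θg) (sk : Θk.transpose = -Θk)
    (df : Θf.map (totalD N) = wedge (jetV N) f) (dg : Θg.map (totalD N) = wedge (jetV N) g)
    (dk : Θk.map (totalD N) = wedge (jetV N) k)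
    (hX : X = dvec (totalD N) f - Θf.mulVec (jetV N))
    (hY : Y = dvec (totalD N) g - Θg.mulVec (jetV N))
    (hZ : K' = dvec (totalD N) k - Θk.mulVec (jetV N))
    (dx : totalD N tx = jetV N ⬝ᵥ x) (dy : totalD N ty = jetV N ⬝ᵥ y)
    (dz : totalD N tz = jetV N ⬝ᵥ z)
    (hf : f = dvec (totalD N) x + tx • jetV N) (hg : g = dvec (totalD N) y + ty • jetV N)
    (hk : k = dvec (totalD N) z + tz • jetV N) :
    IsTotalDeriv (((z ⬝ᵥ Θg.mulVec f - z ⬝ᵥ Θf.mulVec g) + (ty * (x ⬝ᵥ K') - tx * (K' ⬝ᵥ y)))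
      + ((x ⬝ᵥ Θk.mulVec g - x ⬝ᵥ Θg.mulVec k) + (tz * (y ⬝ᵥ X) - ty * (X ⬝ᵥ z)))
      + ((y ⬝ᵥ Θf.mulVec k - y ⬝ᵥ Θk.mulVec f) + (tx * (z ⬝ᵥ Y) - tz * (Y ⬝ᵥ x)))) := by
  refine ⟨(z ⬝ᵥ Θg.mulVec x + x ⬝ᵥ Θk.mulVec y + y ⬝ᵥ Θf.mulVec z)
    + (ty * (x ⬝ᵥ k) - tx * (k ⬝ᵥ y)) + (tz * (y ⬝ᵥ f) - ty * (f ⬝ᵥ z))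
    + (tx * (z ⬝ᵥ g) - tz * (g ⬝ᵥ x)), ?_⟩
  rw [hX, hY, hZ]
  simp only [map_add, map_sub, map_dotProduct, dvec_mulVec, df, dg, dk, wedge_mulVec,
    Derivation.leibniz, dx, dy, dz,
    sub_dotProduct, mulVec_dot_of_skew sf, mulVec_dot_of_skew sg, mulVec_dot_of_skew sk,
    dotProduct_add, dotProduct_sub, dotProduct_smul, smul_eq_mul]
  -- The derivatives of `f`, `g`, `k` are made opaque before these covectors are expanded through
  -- `x`, `y`, `z`, so that no second derivatives appear.
  generalize dvec (totalD N) f = f'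
  generalize dvec (totalD N) g = g'
  generalize dvec (totalD N) k = k'
  rw [hf, hg, hk]
  generalize dvec (totalD N) x = x'
  generalize dvec (totalD N) y = y'
  generalize dvec (totalD N) z = z'
  simp only [Matrix.mulVec_add, Matrix.mulVec_smul, dotProduct_add, add_dotProduct,
    dotProduct_smul, smul_dotProduct, smul_eq_mul, dotProduct_comm _ (jetV N)]
  rw [dot_mulVec_of_skew sg z x', dot_mulVec_of_skew sk x y', dot_mulVec_of_skew sf y z',
    dot_mulVec_of_skew sf z y', dot_mulVec_of_skew sg x z', dot_mulVec_of_skew sk y x',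
    dot_mulVec_of_skew sf z (jetV N), dot_mulVec_of_skew sg z (jetV N),
    dot_mulVec_of_skew sk x (jetV N), dot_mulVec_of_skew sg x (jetV N),
    dot_mulVec_of_skew sf y (jetV N), dot_mulVec_of_skew sk y (jetV N)]
  simp only [dotProduct_comm _ x, dotProduct_comm _ y, dotProduct_comm _ z]
  ring

end JOp

end CurveFlow

/-! ### The bi-Hamiltonian pair, and commutation from involution -/

namespace CurveFlow

open MvPolynomial Finset

variable {N : ℕ}

theorem dvec_real_smul {A : Type*} [CommRing A] [Algebra ℝ A] (d : Derivation ℝ A A) (c : ℝ)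
    (a : Fin N → A) : dvec d (c • a) = c • dvec d a := by
  ext i
  exact d.map_smul c (a i)

/-- Modulo total derivatives, the gradient of a bracket paired with `Z` is the variation of that
bracket along `Z`. Self-adjointness regroups the variations of the three gradients into the pairs
occurring in `h₁`, `h₂`, `h₃`, and only the variations `bᵢ` of the operator survive. -/
theorem isTotalDeriv_jacobi {F G K : Jet N} {X Y Z : Fin N → Jet N} {b₁ b₂ b₃ : Jet N}
    (h₁ : IsTotalDeriv (euler F ⬝ᵥ dvec (evolD Z) Y + dvec (evolD Z) (euler G) ⬝ᵥ X - b₁))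
    (h₂ : IsTotalDeriv (euler G ⬝ᵥ dvec (evolD X) Z + dvec (evolD X) (euler K) ⬝ᵥ Y - b₂))
    (h₃ : IsTotalDeriv (euler K ⬝ᵥ dvec (evolD Y) X + dvec (evolD Y) (euler F) ⬝ᵥ Z - b₃))
    (hb : IsTotalDeriv (b₁ + b₂ + b₃)) :
    IsTotalDeriv (euler (euler F ⬝ᵥ Y) ⬝ᵥ Z + euler (euler G ⬝ᵥ Z) ⬝ᵥ X
      + euler (euler K ⬝ᵥ X) ⬝ᵥ Y) := by
  have e₁ := isTotalDeriv_evolD_sub_euler Z (euler F ⬝ᵥ Y)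
  have e₂ := isTotalDeriv_evolD_sub_euler X (euler G ⬝ᵥ Z)
  have e₃ := isTotalDeriv_evolD_sub_euler Y (euler K ⬝ᵥ X)
  have s₁ := isTotalDeriv_selfAdjoint_euler F Y Z
  have s₂ := isTotalDeriv_selfAdjoint_euler G Z X
  have s₃ := isTotalDeriv_selfAdjoint_euler K X Y
  rw [map_dotProduct] at e₁ e₂ e₃
  convert (((((((((h₁.add h₂).add h₃).add hb).sub e₁).sub e₂).sub e₃).add s₁).add s₂).add s₃)
    using 1
  ring

theorem isHamiltonianOp_HRel : IsHamiltonianOp (HRel (N := N)) := by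
  intro F G K X Y Z hX hY hZ
  obtain ⟨Θf, sf, df, -, hX⟩ := exists_of_HRel hX
  obtain ⟨Θg, sg, dg, -, hY⟩ := exists_of_HRel hY
  obtain ⟨Θk, sk, dk, -, hZ⟩ := exists_of_HRel hZ
  exact ⟨isTotalDeriv_H_skew sf sg df dg hX hY,
    isTotalDeriv_jacobi (isTotalDeriv_H_evolD sf sg df dg hX hY Z)
      (isTotalDeriv_H_evolD sg sk dg dk hY hZ X) (isTotalDeriv_H_evolD sk sf dk df hZ hX Y)
      (isTotalDeriv_H_cyclic sf sg sk df dg dk hX hY hZ)⟩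

theorem isSymplecticOp_JRel : IsSymplecticOp (JRel (N := N)) := by
  intro X Y Z X' Y' Z' hX hY hZ
  obtain ⟨tx, dx, hX⟩ := hX
  obtain ⟨ty, dy, hY⟩ := hY
  obtain ⟨tz, dz, hZ⟩ := hZ
  refine ⟨isTotalDeriv_J_skew dx.1 dy.1 hX hY, ?_⟩
  obtain ⟨a, ha⟩ := isTotalDeriv_J_evolD dy.1 dz.1 hY hZ X
  obtain ⟨b, hb⟩ := isTotalDeriv_J_evolD dz.1 dx.1 hZ hX Y
  obtain ⟨c, hc⟩ := isTotalDeriv_J_evolD dx.1 dy.1 hX hY Z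
  -- The terms in `tx`, `ty`, `tz` cancel in the cyclic sum.
  refine ⟨a + b + c, ?_⟩
  simp only [map_add, ha, hb, hc, map_dotProduct, vfBracket, vecEvolD_eq_dvec, sub_dotProduct]
  rw [dotProduct_comm X' (dvec _ _), dotProduct_comm Y' (dvec _ _),
    dotProduct_comm Z' (dvec _ _), dotProduct_comm (dvec _ X') Z, dotProduct_comm (dvec _ Y') X,
    dotProduct_comm (dvec _ Z') Y]
  ring

theorem isHamiltonianOp_pencilRel (c₁ c₂ : ℝ) : IsHamiltonianOp (pencilRel (N := N) c₁ c₂) := by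
  rintro F G K _ _ _ ⟨x₁, x, hX, ⟨tx, dx, hx⟩, rfl⟩ ⟨y₁, y, hY, ⟨ty, dy, hy⟩, rfl⟩
    ⟨z₁, z, hZ, ⟨tz, dz, hz⟩, rfl⟩
  obtain ⟨Θf, sf, df, -, hX⟩ := exists_of_HRel hX
  obtain ⟨Θg, sg, dg, -, hY⟩ := exists_of_HRel hY
  obtain ⟨Θk, sk, dk, -, hZ⟩ := exists_of_HRel hZ
  have key : ∀ {f g x₁ x y₁ y : Fin N → Jet N} {tx ty : Jet N}
      {Θf Θg : Matrix (Fin N) (Fin N) (Jet N)},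
      Θf.transpose = -Θf → Θg.transpose = -Θg → Θf.map (totalD N) = wedge (jetV N) f →
      Θg.map (totalD N) = wedge (jetV N) g →
      x₁ = dvec (totalD N) f - Θf.mulVec (jetV N) →
      y₁ = dvec (totalD N) g - Θg.mulVec (jetV N) →
      totalD N tx = jetV N ⬝ᵥ x → totalD N ty = jetV N ⬝ᵥ y →
      f = dvec (totalD N) x + tx • jetV N → g = dvec (totalD N) y + ty • jetV N →
      ∀ Z : Fin N → Jet N,
      IsTotalDeriv (f ⬝ᵥ dvec (evolD Z) (c₁ • y₁ + c₂ • y)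
        + dvec (evolD Z) g ⬝ᵥ (c₁ • x₁ + c₂ • x)
        - (c₁ • (Z ⬝ᵥ Θg.mulVec f - Z ⬝ᵥ Θf.mulVec g)
          + c₂ • (ty * (x ⬝ᵥ Z) - tx * (Z ⬝ᵥ y)))) := by
    intro f g x₁ x y₁ y tx ty Θf Θg sf sg df dg hX hY dx dy hx hy Z
    convert ((isTotalDeriv_H_evolD sf sg df dg hX hY Z).smul c₁).add
      ((isTotalDeriv_J_evolD dx dy hx hy Z).smul c₂) using 1
    simp only [dvec_add, dvec_real_smul, dotProduct_add, dotProduct_smul]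
    module
  refine ⟨?_, isTotalDeriv_jacobi (key sf sg df dg hX hY dx.1 dy.1 hx hy _)
    (key sg sk dg dk hY hZ dy.1 dz.1 hy hz _) (key sk sf dk df hZ hX dz.1 dx.1 hz hx _) ?_⟩
  · convert ((isTotalDeriv_H_skew sf sg df dg hX hY).smul c₁).add
      ((isTotalDeriv_J_skew dx.1 dy.1 hx hy).smul c₂) using 1
    simp only [dotProduct_add, dotProduct_smul, dotProduct_comm x, dotProduct_comm y]
    module
  -- The remainder is quadratic in `(c₁, c₂)`. Its `c₂²` part vanishes identically, so only the
  -- identity for `ℋ` and the mixed one are needed.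
  · convert ((isTotalDeriv_H_cyclic sf sg sk df dg dk hX hY hZ).smul (c₁ * c₁)).add
      ((isTotalDeriv_HJ_cyclic sf sg sk df dg dk hX hY hZ dx.1 dy.1 dz.1 hx hy hz).smul
        (c₁ * c₂)) using 1
    simp only [dotProduct_add, add_dotProduct, dotProduct_smul, smul_dotProduct,
      dotProduct_comm y x, dotProduct_comm z y, mul_add, mul_smul_comm]
    rw [dotProduct_comm z₁ y, dotProduct_comm x₁ z, dotProduct_comm y₁ x]
    module

theorem isBiHamiltonianPair (N : ℕ) : IsBiHamiltonianPair N :=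
  ⟨isHamiltonianOp_HRel, isSymplecticOp_JRel, isHamiltonianOp_pencilRel⟩

/-- Hamiltonians in involution generate commuting flows. -/
theorem vfBracket_eq_zero_of_involution {F G : Jet N} {X Y : Fin N → Jet N}
    (hX : HRel (euler F) X) (hY : HRel (euler G) Y) (h : IsTotalDeriv (euler F ⬝ᵥ Y))
    (hF0 : ∀ i, constantCoeff (euler F i) = 0)
    (hXY0 : ∀ f : Jet N, constantCoeff (evolD X f) = 0 ∧ constantCoeff (evolD Y f) = 0) :
    vfBracket X Y = 0 := by
  obtain ⟨Θf, sf, df, cf, hX⟩ := exists_of_HRel hX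
  obtain ⟨Θg, sg, dg, cg, hY⟩ := exists_of_HRel hY
  -- Variation of the involution hypothesis along an arbitrary `Z`, with the variations of the
  -- gradients moved off `Z` by self-adjointness.
  have hc : dvec (evolD X) (euler G) - dvec (evolD Y) (euler F) =
      Θg.mulVec (euler F) - Θf.mulVec (euler G) := by
    refine sub_eq_zero.1 (eq_zero_of_forall_dot_isTotalDeriv fun Z => ?_)
    have h1 := h.evolD Z
    rw [map_dotProduct] at h1
    have h2 := isTotalDeriv_H_evolD sf sg df dg hX hY Z
    have h3 := isTotalDeriv_selfAdjoint_euler F Y Z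
    have h4 := isTotalDeriv_selfAdjoint_euler G X Z
    convert ((h2.sub h1).add h3).sub h4 using 1
    simp only [dotProduct_sub, dotProduct_comm Z (dvec _ _)]
    ring
  set f := euler F
  set g := euler G
  set v := jetV N
  set c := Θg.mulVec f - Θf.mulVec g with hcdef
  -- The two sides have equal total derivatives. The vanishing constant coefficients upgrade this to
  -- equality, with no constant of integration.
  have hΨ : Θg.map (evolD X) - Θf.map (evolD Y) = wedge f g - (Θf * Θg - Θg * Θf) := by
    ext1 i j
    refine IsAntideriv.unique (f := totalD N ((Θg.map (evolD X) - Θf.map (evolD Y)) i j))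
      ⟨rfl, ?_⟩ ⟨?_, ?_⟩
    · simp [(hXY0 _).1, (hXY0 _).2]
    · have h1 : (Θg.map (evolD X) - Θf.map (evolD Y)).map (totalD N) =
          wedge X g - wedge Y f + wedge v c := by
        have : (Θg.map (evolD X) - Θf.map (evolD Y)).map (totalD N) =
            (Θg.map (evolD X)).map (totalD N) - (Θf.map (evolD Y)).map (totalD N) := by
          ext1; simp
        rw [this, map_map_evolD, map_map_evolD, df, dg, map_wedge, map_wedge, dvec_evolD_jetV,
          dvec_evolD_jetV, ← hc, sub_eq_add_neg (dvec _ g), wedge_add_right,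
          show -dvec (evolD Y) f = (-1 : Jet N) • dvec (evolD Y) f by simp, wedge_smul_right]
        simp only [neg_smul, one_smul]
        abel
      have h2 : (wedge f g - (Θf * Θg - Θg * Θf)).map (totalD N) =
          wedge X g - wedge Y f + wedge v c := by
        have : (wedge f g - (Θf * Θg - Θg * Θf)).map (totalD N) =
            (wedge f g).map (totalD N) - ((Θf * Θg).map (totalD N)
              - (Θg * Θf).map (totalD N)) := by
          ext1; simp
        have e1 : dvec (totalD N) f = X + Θf.mulVec v := by rw [hX]; abel
        have e2 : dvec (totalD N) g = Y + Θg.mulVec v := by rw [hY]; abel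
        have e3 : ∀ a b : Fin N → Jet N, ∀ Θ : Matrix (Fin N) (Fin N) (Jet N),
            Θ.transpose = -Θ → wedge a b * Θ = Matrix.vecMulVec b (Θ.mulVec a)
              - Matrix.vecMulVec a (Θ.mulVec b) := by
          intro a b Θ hΘ
          rw [wedge, sub_mul, Matrix.vecMulVec_mul, Matrix.vecMulVec_mul, vecMul_of_skew hΘ,
            vecMul_of_skew hΘ]
          simp only [Matrix.vecMulVec_neg]
          abel
        have e4 : ∀ a b : Fin N → Jet N, ∀ Θ : Matrix (Fin N) (Fin N) (Jet N),
            Θ * wedge a b = Matrix.vecMulVec (Θ.mulVec a) b - Matrix.vecMulVec (Θ.mulVec b) a := by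
          intro a b Θ
          rw [wedge, mul_sub, Matrix.mul_vecMulVec, Matrix.mul_vecMulVec]
        rw [this, map_wedge, map_mul_matrix, map_mul_matrix, df, dg, e1, e2, e3 _ _ _ sg,
          e3 _ _ _ sf, e4, e4, hcdef]
        simp only [wedge, Matrix.vecMulVec_add, Matrix.add_vecMulVec, Matrix.vecMulVec_sub,
          Matrix.sub_vecMulVec]
        abel
      have h3 := h2.trans h1.symm
      exact congrFun (congrFun h3 i) j
    · have hp : ∀ Θ Ψ : Matrix (Fin N) (Fin N) (Jet N), (∀ i j, constantCoeff (Θ i j) = 0) →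
          constantCoeff ((Θ * Ψ) i j) = 0 := by
        intro Θ Ψ h0
        simp [Matrix.mul_apply, h0]
      rw [Matrix.sub_apply, Matrix.sub_apply, map_sub, map_sub, hp _ _ cf, hp _ _ cg]
      simp [wedge, Matrix.vecMulVec_apply, hF0, f]
  have key : ∀ {Z g Y : Fin N → Jet N} {Θg : Matrix (Fin N) (Fin N) (Jet N)},
      Y = dvec (totalD N) g - Θg.mulVec v → dvec (evolD Z) Y =
        dvec (totalD N) (dvec (evolD Z) g) - (Θg.map (evolD Z)).mulVec v - Θg.mulVec Z := by
    rintro Z g Y Θg rfl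
    rw [dvec_sub, dvec_evolD_totalD, dvec_mulVec, dvec_evolD_jetV]
    abel
  have hΨ' := congrArg (fun M => Matrix.mulVec M v) hΨ
  have hDc := congrArg (dvec (totalD N)) hc
  simp only [Matrix.sub_mulVec, wedge_mulVec, ← Matrix.mulVec_mulVec] at hΨ'
  rw [hcdef, dvec_sub, dvec_sub, dvec_mulVec, dvec_mulVec, df, dg, wedge_mulVec,
    wedge_mulVec] at hDc
  rw [vfBracket, vecEvolD_eq_dvec, vecEvolD_eq_dvec, key hX, key hY]
  have hX' := congrArg Θg.mulVec hX
  have hY' := congrArg Θf.mulVec hY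
  rw [Matrix.mulVec_sub] at hX' hY'
  rw [dotProduct_comm g f, dotProduct_comm v g, dotProduct_comm v f] at hDc
  rw [hX', hY']
  -- The bracket consists of the total derivative of `hc`, of `hΨ` applied to `v`, and of the terms
  -- `Θg X`, `Θf Y`.
  linear_combination (exp := 1) hDc - hΨ'

end CurveFlow

namespace CurveFlow

open Finset

/-! ## The Riccati system -/

section Riccati

variable {A : Type*} [CommRing A] [Algebra ℝ A] {N : ℕ}

/-- The Riccati system `x = s (v + D y + (v · y) y)`, `y = s (D x + (v · x) y)`, together with the
normalization factor `ρ`. -/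
structure IsRiccati (D : Derivation ℝ A A) (s : A) (v x y : Fin N → A) (ρ : A) : Prop where
  ne_zero : s ≠ 0
  eq_x : x = s • v + s • dvec D y + (s * (v ⬝ᵥ y)) • y
  eq_y : y = s • dvec D x + (s * (v ⬝ᵥ x)) • y
  normal : ρ ^ 2 * ((1 + y ⬝ᵥ y) * (1 - x ⬝ᵥ x) + (x ⬝ᵥ y) ^ 2) = 1

variable {D δ ε : Derivation ℝ A A} {s ρ : A} {v x y Z : Fin N → A}

theorem two_ne_zero_of_algebra [Nontrivial A] : (2 : A) ≠ 0 := by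
  have h : algebraMap ℝ A 2 = 2 := map_ofNat _ 2
  rw [← h, Ne, map_eq_zero_iff _ (algebraMap ℝ A).injective]
  norm_num

namespace IsRiccati

theorem smul_dx (h : IsRiccati D s v x y ρ) : s • dvec D x = (1 - s * (v ⬝ᵥ x)) • y := by
  have := h.eq_y
  linear_combination (norm := module) -this

theorem smul_dy (h : IsRiccati D s v x y ρ) :
    s • dvec D y = x - s • v - (s * (v ⬝ᵥ y)) • y := by
  have := h.eq_x
  linear_combination (norm := module) -this

theorem dx_dot (h : IsRiccati D s v x y ρ) (w : Fin N → A) :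
    s * (dvec D x ⬝ᵥ w) = (1 - s * (v ⬝ᵥ x)) * (y ⬝ᵥ w) := by
  rw [← smul_eq_mul, ← smul_dotProduct, h.smul_dx, smul_dotProduct, smul_eq_mul]

theorem dy_dot (h : IsRiccati D s v x y ρ) (w : Fin N → A) :
    s * (dvec D y ⬝ᵥ w) = x ⬝ᵥ w - s * (v ⬝ᵥ w) - s * (v ⬝ᵥ y) * (y ⬝ᵥ w) := by
  rw [← smul_eq_mul, ← smul_dotProduct, h.smul_dy]
  simp only [sub_dotProduct, smul_dotProduct, smul_eq_mul]

/-- With `Δ` the determinant in `normal`, the Riccati system gives `D Δ = -2 (v·y) Δ`;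
differentiating `ρ² Δ = 1` yields the claim after cancelling `2s` in the domain. -/
theorem d_rho [IsDomain A] (h : IsRiccati D s v x y ρ) : D ρ = ρ * (v ⬝ᵥ y) := by
  have h1 := congrArg D h.normal
  simp only [Derivation.leibniz, Derivation.leibniz_pow, map_add, map_sub, map_dotProduct,
    Derivation.map_one_eq_zero, smul_eq_mul, dotProduct_comm _ (dvec D _), nsmul_eq_mul] at h1
  have hxx := h.dx_dot x
  have hxy := h.dx_dot y
  have hyx := h.dy_dot x
  have hyy := h.dy_dot y
  rw [dotProduct_comm y x] at hxx
  rw [dotProduct_comm y x] at hyx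
  have hn := h.normal
  have h2 : (2 : A) * s ≠ 0 := mul_ne_zero two_ne_zero_of_algebra h.ne_zero
  refine mul_left_cancel₀ h2 ?_
  push_cast at h1
  linear_combination (exp := 1) s * ρ * h1
    - (2 * s * D ρ) * hn
    + (2 * ρ ^ 3 * (1 + y ⬝ᵥ y) - 0) * hxx
    - (2 * ρ ^ 3 * (x ⬝ᵥ y)) * hxy
    - (2 * ρ ^ 3 * (1 - x ⬝ᵥ x)) * hyy
    - (2 * ρ ^ 3 * (x ⬝ᵥ y)) * hyx
    + (2 * s * ρ * (v ⬝ᵥ y)) * hn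

/-- The normalization makes the system linear: with `K = ρy` and `W = ρx` this says `W = s 𝒥(K)`,
where `ρ` serves as primitive of `v·K` by `d_rho`. -/
theorem d_K [IsDomain A] (h : IsRiccati D s v x y ρ) :
    s • dvec D (ρ • y) = ρ • x - (s * ρ) • v := by
  have := h.smul_dy
  rw [dvec_smul, h.d_rho]
  linear_combination (norm := module) ρ • this

/-- This says `K = s ℋ(W)` with rotation `Θ = ρ x∧y`; that `Θ` is a primitive of `v∧W` is `d_rot`.
-/
theorem d_W [IsDomain A] (h : IsRiccati D s v x y ρ) :
    s • dvec D (ρ • x) = ρ • y + s • (ρ • wedge x y).mulVec v := by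
  have := h.smul_dx
  rw [dvec_smul, h.d_rho, Matrix.smul_mulVec, wedge_mulVec, dotProduct_comm y, dotProduct_comm x]
  linear_combination (norm := module) ρ • this

theorem d_rot [IsDomain A] (h : IsRiccati D s v x y ρ) :
    (ρ • wedge x y).map D = wedge v (ρ • x) := by
  have hx : ∀ i, s * D (x i) = (1 - s * (v ⬝ᵥ x)) * y i := fun i => congrFun h.smul_dx i
  have hy : ∀ i, s * D (y i) = x i - s * v i - s * (v ⬝ᵥ y) * y i := fun i =>
    congrFun h.smul_dy i
  ext i j
  refine mul_left_cancel₀ h.ne_zero ?_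
  simp only [Matrix.map_apply, Matrix.smul_apply, wedge, Matrix.sub_apply,
    Matrix.vecMulVec_apply, smul_eq_mul, Derivation.leibniz, map_sub, h.d_rho, Pi.smul_apply]
  linear_combination ρ * (y j * hx i - y i * hx j + x i * hy j - x j * hy i)

end IsRiccati

/-- The bilinear form of the matrix inverse to `1 - x xᵀ + y yᵀ`. -/
def riccatiForm (ρ : A) (x y u w : Fin N → A) : A :=
  u ⬝ᵥ w + ρ ^ 2 * ((1 + y ⬝ᵥ y) * (x ⬝ᵥ u) * (x ⬝ᵥ w) - (1 - x ⬝ᵥ x) * (y ⬝ᵥ u) * (y ⬝ᵥ w)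
    - (x ⬝ᵥ y) * ((x ⬝ᵥ u) * (y ⬝ᵥ w) + (y ⬝ᵥ u) * (x ⬝ᵥ w)))

namespace IsRiccati

/-- For `M = 1 - x xᵀ + y yᵀ` the Riccati system gives `DM = -(Mv) yᵀ - y (Mv)ᵀ`, hence `D M⁻¹ = v
(M⁻¹y)ᵀ + (M⁻¹y) vᵀ`. -/
theorem d_form [IsDomain A] (h : IsRiccati D s v x y ρ) (u w : Fin N → A) :
    s * D (riccatiForm ρ x y u w) = riccatiForm ρ x y (s • dvec D u) w
      + riccatiForm ρ x y u (s • dvec D w) + s * (riccatiForm ρ x y u y * (v ⬝ᵥ w)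
        + (v ⬝ᵥ u) * riccatiForm ρ x y y w) := by
  have hxx := h.dx_dot x
  have hxy := h.dx_dot y
  have hyx := h.dy_dot x
  have hyy := h.dy_dot y
  have hxu := h.dx_dot u
  have hxw := h.dx_dot w
  have hyu := h.dy_dot u
  have hyw := h.dy_dot w
  rw [dotProduct_comm y x] at hxx
  rw [dotProduct_comm y x] at hyx
  have hn := h.normal
  simp only [riccatiForm, Derivation.leibniz, Derivation.leibniz_pow, map_add, map_sub,
    map_dotProduct, Derivation.map_one_eq_zero, smul_eq_mul, nsmul_eq_mul, h.d_rho,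
    dotProduct_comm x (dvec D x), dotProduct_comm y (dvec D y), dotProduct_comm x (dvec D y),
    dotProduct_smul, smul_dotProduct, dotProduct_comm u y]
  push_cast
  linear_combination 2 * ρ ^ 2 * (x ⬝ᵥ u) * (x ⬝ᵥ w) * hyy
    + ρ ^ 2 * ((1 + y ⬝ᵥ y) * (x ⬝ᵥ w) - (x ⬝ᵥ y) * (y ⬝ᵥ w)) * hxu
    + ρ ^ 2 * ((1 + y ⬝ᵥ y) * (x ⬝ᵥ u) - (x ⬝ᵥ y) * (y ⬝ᵥ u)) * hxw
    + 2 * ρ ^ 2 * (y ⬝ᵥ u) * (y ⬝ᵥ w) * hxx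
    - ρ ^ 2 * ((1 - x ⬝ᵥ x) * (y ⬝ᵥ w) + (x ⬝ᵥ y) * (x ⬝ᵥ w)) * hyu
    - ρ ^ 2 * ((1 - x ⬝ᵥ x) * (y ⬝ᵥ u) + (x ⬝ᵥ y) * (x ⬝ᵥ u)) * hyw
    - ρ ^ 2 * ((x ⬝ᵥ u) * (y ⬝ᵥ w) + (y ⬝ᵥ u) * (x ⬝ᵥ w)) * (hxy + hyx)
    + s * ((v ⬝ᵥ w) * (y ⬝ᵥ u) + (v ⬝ᵥ u) * (y ⬝ᵥ w)) * hn

/-- Jacobi's formula for `(det M)^(-1/2)`, where `M = 1 - x xᵀ + y yᵀ`. -/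
theorem map_rho [IsDomain A] (h : IsRiccati D s v x y ρ) (d : Derivation ℝ A A) :
    d ρ = ρ * (riccatiForm ρ x y (dvec d x) x - riccatiForm ρ x y (dvec d y) y) := by
  have h1 := congrArg d h.normal
  have hn := h.normal
  simp only [Derivation.leibniz, Derivation.leibniz_pow, map_add, map_sub, map_dotProduct,
    Derivation.map_one_eq_zero, smul_eq_mul, nsmul_eq_mul, dotProduct_comm _ (dvec d _)] at h1
  push_cast at h1
  refine mul_left_cancel₀ two_ne_zero_of_algebra ?_
  simp only [riccatiForm, dotProduct_comm _ (dvec d _), dotProduct_comm y x]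
  linear_combination ρ * h1 - 2 * d ρ * hn
    + 2 * ρ * (dvec d x ⬝ᵥ x - dvec d y ⬝ᵥ y) * hn

end IsRiccati

section Form

variable {A : Type*} [CommRing A] {ρ : A} {x y : Fin N → A}

theorem riccatiForm_comm (u w : Fin N → A) : riccatiForm ρ x y u w = riccatiForm ρ x y w u := by
  simp only [riccatiForm, dotProduct_comm u w]
  ring

theorem riccatiForm_sub_left (u₁ u₂ w : Fin N → A) : riccatiForm ρ x y (u₁ - u₂) w =
    riccatiForm ρ x y u₁ w - riccatiForm ρ x y u₂ w := by
  simp only [riccatiForm, dotProduct_sub, sub_dotProduct]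
  ring

theorem riccatiForm_smul_left (c : A) (u w : Fin N → A) : riccatiForm ρ x y (c • u) w =
    c * riccatiForm ρ x y u w := by
  simp only [riccatiForm, dotProduct_smul, smul_dotProduct, smul_eq_mul]
  ring

theorem riccatiForm_sub_right (u₁ u₂ w : Fin N → A) : riccatiForm ρ x y w (u₁ - u₂) =
    riccatiForm ρ x y w u₁ - riccatiForm ρ x y w u₂ := by
  simp only [riccatiForm_comm w, riccatiForm_sub_left]

theorem riccatiForm_smul_right (c : A) (u w : Fin N → A) : riccatiForm ρ x y w (c • u) =
    c * riccatiForm ρ x y w u := by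
  simp only [riccatiForm_comm w, riccatiForm_smul_left]

end Form

namespace IsRiccati

/-- This is `uᵀ w = uᵀ M M⁻¹ w`. -/
theorem dot_eq_form (h : IsRiccati D s v x y ρ) (u w : Fin N → A) :
    u ⬝ᵥ w = riccatiForm ρ x y u w - (u ⬝ᵥ x) * riccatiForm ρ x y x w
      + (u ⬝ᵥ y) * riccatiForm ρ x y y w := by
  simp only [riccatiForm]
  rw [dotProduct_comm u x, dotProduct_comm u y, dotProduct_comm y x]
  linear_combination ((y ⬝ᵥ u) * (y ⬝ᵥ w) - (x ⬝ᵥ u) * (x ⬝ᵥ w)) * h.normal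

/-- Here `δ` varies `v` and fixes `s`, while `ε` further on is `s d/ds` and fixes `v`. The four
identities are the Riccati system linearized in these two directions. -/
theorem smul_d_delta_x (h : IsRiccati D s v x y ρ) (hδ : ∀ a, δ (D a) = D (δ a)) (hs : δ s = 0)
    (hv : dvec δ v = Z) : s • dvec D (dvec δ x) = (1 - s * (v ⬝ᵥ x)) • dvec δ y
      - (s * (Z ⬝ᵥ x + v ⬝ᵥ dvec δ x)) • y := by
  have h1 := congrArg (dvec δ) h.eq_y
  have hc : dvec δ (dvec D x) = dvec D (dvec δ x) := funext fun i => hδ (x i)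
  rw [dvec_add, dvec_smul, dvec_smul, hc, Derivation.leibniz, map_dotProduct, hs, hv] at h1
  simp only [smul_eq_mul] at h1
  linear_combination (norm := module) -h1

theorem smul_d_delta_y (h : IsRiccati D s v x y ρ) (hδ : ∀ a, δ (D a) = D (δ a)) (hs : δ s = 0)
    (hv : dvec δ v = Z) : s • dvec D (dvec δ y) = dvec δ x - s • Z
      - (s * (Z ⬝ᵥ y + v ⬝ᵥ dvec δ y)) • y - (s * (v ⬝ᵥ y)) • dvec δ y := by
  have h1 := congrArg (dvec δ) h.eq_x
  have hc : dvec δ (dvec D y) = dvec D (dvec δ y) := funext fun i => hδ (y i)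
  rw [dvec_add, dvec_add, dvec_smul, dvec_smul, dvec_smul, hc, Derivation.leibniz,
    map_dotProduct, hs, hv] at h1
  simp only [smul_eq_mul] at h1
  linear_combination (norm := module) -h1

theorem smul_d_eps_x (h : IsRiccati D s v x y ρ) (hε : ∀ a, ε (D a) = D (ε a)) (hs : ε s = s)
    (hv : dvec ε v = 0) : s • dvec D (dvec ε x) = (1 - s * (v ⬝ᵥ x)) • dvec ε y
      - (s * (v ⬝ᵥ dvec ε x)) • y - y := by
  have h1 := congrArg (dvec ε) h.eq_y
  have h2 := h.eq_y
  have hc : dvec ε (dvec D x) = dvec D (dvec ε x) := funext fun i => hε (x i)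
  rw [dvec_add, dvec_smul, dvec_smul, hc, Derivation.leibniz, map_dotProduct, hs, hv] at h1
  simp only [smul_eq_mul, zero_dotProduct] at h1
  linear_combination (norm := module) h2 - h1

theorem smul_d_eps_y (h : IsRiccati D s v x y ρ) (hε : ∀ a, ε (D a) = D (ε a)) (hs : ε s = s)
    (hv : dvec ε v = 0) : s • dvec D (dvec ε y) = dvec ε x - x
      - (s * (v ⬝ᵥ dvec ε y)) • y - (s * (v ⬝ᵥ y)) • dvec ε y := by
  have h1 := congrArg (dvec ε) h.eq_x
  have h2 := h.eq_x
  have hc : dvec ε (dvec D y) = dvec D (dvec ε y) := funext fun i => hε (y i)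
  rw [dvec_add, dvec_add, dvec_smul, dvec_smul, dvec_smul, hc, Derivation.leibniz,
    map_dotProduct, hs, hv] at h1
  simp only [smul_eq_mul, zero_dotProduct] at h1
  linear_combination (norm := module) h2 - h1

/-- The variation of `ρ` is the variational pairing with `ρ x`, up to a total derivative. -/
theorem variation_rho [IsDomain A] (h : IsRiccati D s v x y ρ) (hδ : ∀ a, δ (D a) = D (δ a))
    (hδs : δ s = 0) (hδv : dvec δ v = Z) (hε : ∀ a, ε (D a) = D (ε a)) (hεs : ε s = s)
    (hεv : dvec ε v = 0) :
    s * D (ρ * (riccatiForm ρ x y (dvec δ x) (dvec ε y)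
      - riccatiForm ρ x y (dvec δ y) (dvec ε x))) = s * (Z ⬝ᵥ dvec ε (ρ • x)) - δ ρ := by
  -- The differentiated expression is an alternating form in two linearized solutions, weighted by
  -- `ρ`. Only the inhomogeneous terms of the linearized systems, those in `Z` for `δ` and in `x`,
  -- `y` for `ε`, survive in its derivative.
  have h1 := h.d_form (dvec δ x) (dvec ε y)
  have h2 := h.d_form (dvec δ y) (dvec ε x)
  rw [h.smul_d_delta_x hδ hδs hδv, h.smul_d_eps_y hε hεs hεv] at h1
  rw [h.smul_d_delta_y hδ hδs hδv, h.smul_d_eps_x hε hεs hεv] at h2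
  rw [Derivation.leibniz, map_sub, h.d_rho, dvec_smul, h.map_rho δ, h.map_rho ε]
  simp only [riccatiForm_sub_left, riccatiForm_smul_left, riccatiForm_sub_right,
    riccatiForm_smul_right] at h1 h2
  have h3 := h.dot_eq_form Z (dvec ε x)
  simp only [dotProduct_add, dotProduct_smul, smul_eq_mul]
  rw [riccatiForm_comm (dvec ε x) x, riccatiForm_comm (dvec ε y) y]
  linear_combination ρ * h1 - ρ * h2 - s * ρ * h3

end IsRiccati

end Riccati

end CurveFlow

namespace CurveFlow

open Finset

/-! ## Power series over a differential ring -/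

section Series

open PowerSeries

variable {A : Type*} [CommRing A] [Algebra ℝ A]

/-- A derivation acting on the coefficients of a power series. -/
noncomputable def coeffD (d : Derivation ℝ A A) : Derivation ℝ A⟦X⟧ A⟦X⟧ :=
  Derivation.mk'
    { toFun := fun f => PowerSeries.mk fun n => d (coeff n f)
      map_add' := fun f g => by ext n; simp
      map_smul' := fun c f => by ext n; simp }
    fun f g => by
      ext n
      simp only [LinearMap.coe_mk, AddHom.coe_mk, coeff_mk, coeff_mul, map_sum, map_add,
        Derivation.leibniz, smul_eq_mul, Finset.sum_add_distrib]
      congr 1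
      rw [← Finset.Nat.sum_antidiagonal_swap]
      simp only [Prod.fst_swap, Prod.snd_swap]

@[simp] theorem coeff_coeffD (d : Derivation ℝ A A) (f : A⟦X⟧) (n : ℕ) :
    coeff n (coeffD d f) = d (coeff n f) := by
  simp [coeffD]

/-- The derivation `s d/ds` of power series in `s`. -/
noncomputable def scaleD : Derivation ℝ A⟦X⟧ A⟦X⟧ :=
  Derivation.mk'
    { toFun := fun f => PowerSeries.mk fun n => (n : A) * coeff n f
      map_add' := fun f g => by ext n; simp [mul_add]
      map_smul' := fun c f => by ext n; simp }
    fun f g => by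
      ext n
      simp only [LinearMap.coe_mk, AddHom.coe_mk, coeff_mk, coeff_mul, map_add, smul_eq_mul,
        Finset.mul_sum]
      rw [← Finset.Nat.sum_antidiagonal_swap (f := fun p => coeff p.1 g * _),
        ← Finset.sum_add_distrib]
      refine Finset.sum_congr rfl fun p hp => ?_
      rw [← mem_antidiagonal.1 hp]
      simp only [Prod.fst_swap, Prod.snd_swap]
      push_cast
      ring

@[simp] theorem coeff_scaleD (f : A⟦X⟧) (n : ℕ) :
    coeff n (scaleD f) = (n : A) * coeff n f := by
  simp [scaleD]

theorem coeffD_X (d : Derivation ℝ A A) : coeffD d (X : A⟦X⟧) = 0 := by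
  ext n
  simp only [coeff_coeffD, coeff_X]
  split_ifs <;> simp

theorem scaleD_X : scaleD (X : A⟦X⟧) = X := by
  ext n
  simp only [coeff_scaleD, coeff_X]
  split_ifs with h <;> simp [h]

theorem scaleD_C (a : A) : scaleD (C a : A⟦X⟧) = 0 := by
  ext n
  simp only [coeff_scaleD, coeff_C]
  split_ifs with h <;> simp [h]

theorem coeffD_C (d : Derivation ℝ A A) (a : A) : coeffD d (C a : A⟦X⟧) = C (d a) := by
  ext n
  simp only [coeff_coeffD, coeff_C]
  split_ifs <;> simp

theorem scaleD_coeffD (d : Derivation ℝ A A) (f : A⟦X⟧) :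
    scaleD (coeffD d f) = coeffD d (scaleD f) := by
  ext n
  simp

/-- The coefficients of the square root of a power series with constant coefficient `1`. -/
noncomputable def sqrtCoeff (c : ℕ → A) : ℕ → A
  | 0 => 1
  | n + 1 => (1 / 2 : ℝ) • (c (n + 1) - ∑ k : Fin n, sqrtCoeff c (k + 1) * sqrtCoeff c (n - k))
  decreasing_by all_goals omega

theorem exists_sqrt (c : A⟦X⟧) (hc : constantCoeff c = 1) :
    ∃ r : A⟦X⟧, constantCoeff r = 1 ∧ r ^ 2 = c := by
  refine ⟨PowerSeries.mk (sqrtCoeff fun n => coeff n c), ?_, ?_⟩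
  · rw [← coeff_zero_eq_constantCoeff_apply, coeff_mk, sqrtCoeff]
  · ext n
    rw [pow_two, coeff_mul]
    cases n with
    | zero => simp [sqrtCoeff, hc]
    | succ n =>
      rw [Finset.Nat.sum_antidiagonal_eq_sum_range_succ_mk, Finset.sum_range_succ,
        Finset.sum_range_succ']
      simp only [coeff_mk, Nat.sub_self, Nat.sub_zero, Nat.add_sub_add_right]
      rw [Finset.sum_range fun k => sqrtCoeff (fun n => coeff n c) (k + 1)
        * sqrtCoeff (fun n => coeff n c) (n - k)]
      have h1 := sqrtCoeff.eq_2 (fun n => coeff n c) n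
      have h0 : sqrtCoeff (fun n => coeff n c) 0 = 1 := sqrtCoeff.eq_1 _
      rw [h0]
      have h2 : sqrtCoeff (fun n => coeff n c) (n + 1) + sqrtCoeff (fun n => coeff n c) (n + 1)
          = coeff (n + 1) c - ∑ k : Fin n, sqrtCoeff (fun n => coeff n c) (k + 1)
            * sqrtCoeff (fun n => coeff n c) (n - k) := by
        nth_rw 1 2 [h1]
        module
      linear_combination h2

theorem exists_inv_sqrt (Δ : A⟦X⟧) (h : constantCoeff Δ = 1) :
    ∃ r : A⟦X⟧, constantCoeff r = 1 ∧ r ^ 2 * Δ = 1 := by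
  obtain ⟨r, hr, hr2⟩ := exists_sqrt (invOfUnit Δ 1) (by simp [constantCoeff_invOfUnit])
  exact ⟨r, hr, by rw [hr2, mul_comm, mul_invOfUnit Δ 1 (by simp [h])]⟩

/-- The root is extracted over `S` itself and then mapped to `A`. This is what keeps the
coefficients of `ρ` inside the algebra of curve invariants. -/
theorem exists_inv_sqrt_of_subalgebra (S : Subalgebra ℝ A) (Δ : A⟦X⟧)
    (h : constantCoeff Δ = 1) (hS : ∀ n, coeff n Δ ∈ S) :
    ∃ r : A⟦X⟧, (∀ n, coeff n r ∈ S) ∧ constantCoeff r = 1 ∧ r ^ 2 * Δ = 1 := by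
  set Δ' : S⟦X⟧ := PowerSeries.mk fun n => ⟨coeff n Δ, hS n⟩ with hΔ'
  have hmap : PowerSeries.map (S.val : S →+* A) Δ' = Δ := by
    ext n; simp [hΔ']
  obtain ⟨r, hr, hr2⟩ := exists_inv_sqrt Δ' (by
    rw [← coeff_zero_eq_constantCoeff_apply, hΔ', coeff_mk]
    ext
    simpa using h)
  refine ⟨PowerSeries.map (S.val : S →+* A) r, fun n => ?_, ?_, ?_⟩
  · rw [coeff_map]
    exact (coeff n r).2
  · rw [← coeff_zero_eq_constantCoeff_apply, coeff_map, coeff_zero_eq_constantCoeff_apply, hr,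
      map_one]
  · rw [← hmap, ← map_pow, ← map_mul, hr2, map_one]

end Series

/-! ## Invariants of the frame -/

section Frame

open MvPolynomial

variable (N : ℕ)

/-- The components of `D_X^j X` in a parallel frame, as differential polynomials in the principal
normal. -/
noncomputable def frameJet : ℕ → Jet N × (Fin N → Jet N)
  | 0 => (1, 0)
  | j + 1 => (totalD N (frameJet j).1 - jetV N ⬝ᵥ (frameJet j).2,
      vecD (frameJet j).2 + (frameJet j).1 • jetV N)

/-- The inner products `⟨D_X^a X, D_X^b X⟩` as differential polynomials in the principal normal. -/
noncomputable def innerJet : MvPolynomial (ℕ × ℕ) ℝ →ₐ[ℝ] Jet N :=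
  aeval fun p => (frameJet N p.1).1 * (frameJet N p.2).1 + (frameJet N p.1).2 ⬝ᵥ (frameJet N p.2).2

/-- The algebra of differential invariants of a curve generated by the inner products. -/
noncomputable def invJet : Subalgebra ℝ (Jet N) := (innerJet N).range

variable {N}

theorem innerJet_X (a b : ℕ) : innerJet N (X (a, b)) =
    (frameJet N a).1 * (frameJet N b).1 + (frameJet N a).2 ⬝ᵥ (frameJet N b).2 := by
  simp [innerJet]

theorem frameJet_one : frameJet N 1 = (0, jetV N) := by
  simp only [frameJet, Derivation.map_one_eq_zero, dotProduct_zero, sub_zero, one_smul]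
  congr 1
  ext1 i
  simp [vecD]

/-- The tangential component is the inner product with `X = D_X^0 X`. -/
theorem frameJet_fst_mem (j : ℕ) : (frameJet N j).1 ∈ invJet N :=
  ⟨X (0, j), by simpa [frameJet] using innerJet_X (N := N) 0 j⟩

theorem inner_mem (a b : ℕ) :
    (frameJet N a).1 * (frameJet N b).1 + (frameJet N a).2 ⬝ᵥ (frameJet N b).2 ∈ invJet N :=
  ⟨X (a, b), innerJet_X a b⟩

theorem frameJet_dot_mem (a b : ℕ) : (frameJet N a).2 ⬝ᵥ (frameJet N b).2 ∈ invJet N := by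
  have := sub_mem (inner_mem (N := N) a b) (mul_mem (frameJet_fst_mem a) (frameJet_fst_mem b))
  simpa using this

theorem vecD_frameJet (j : ℕ) :
    vecD (frameJet N j).2 = (frameJet N (j + 1)).2 - (frameJet N j).1 • jetV N := by
  simp [frameJet]

theorem totalD_frameJet (j : ℕ) :
    totalD N (frameJet N j).1 = (frameJet N (j + 1)).1 + jetV N ⬝ᵥ (frameJet N j).2 := by
  simp [frameJet]

/-- On generators this is metric compatibility, `D⟨D_X^a X, D_X^b X⟩ = ⟨D_X^{a+1} X, D_X^b X⟩ +
⟨D_X^a X, D_X^{b+1} X⟩`: the frame terms in `v` cancel. -/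
theorem totalD_mem_invJet {f : Jet N} (hf : f ∈ invJet N) : totalD N f ∈ invJet N := by
  obtain ⟨q, rfl⟩ := hf
  have key : ∀ q, totalD N (innerJet N q) ∈ invJet N := by
    intro q
    induction q using MvPolynomial.induction_on with
    | C c =>
      rw [← MvPolynomial.algebraMap_eq, AlgHom.commutes, Derivation.map_algebraMap]
      exact zero_mem _
    | add p q hp hq => rw [map_add, map_add]; exact add_mem hp hq
    | mul_X p i hp =>
      obtain ⟨a, b⟩ := i
      rw [map_mul, Derivation.leibniz]
      refine add_mem (mul_mem ⟨p, rfl⟩ ?_) (mul_mem ⟨X (a, b), rfl⟩ hp)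
      have := add_mem (inner_mem (N := N) (a + 1) b) (inner_mem (N := N) a (b + 1))
      rw [innerJet_X, map_add, map_dotProduct, Derivation.leibniz, ← vecD_eq_dvec,
        ← vecD_eq_dvec, vecD_frameJet, vecD_frameJet, totalD_frameJet, totalD_frameJet]
      convert this using 1
      simp only [sub_dotProduct, dotProduct_sub, smul_dotProduct, dotProduct_smul, smul_eq_mul]
      rw [dotProduct_comm _ (jetV N)]
      ring
  exact key q

variable (N) in
/-- The combinations of the normal components of `X, …, D_X^m X` with invariant coefficients. -/
noncomputable def normalSpan (m : ℕ) : Submodule (invJet N) (Fin N → Jet N) :=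
  Submodule.span (invJet N) ((fun j => (frameJet N j).2) '' Set.Iic m)

theorem normalSpan_mono {m m' : ℕ} (h : m ≤ m') : normalSpan N m ≤ normalSpan N m' :=
  Submodule.span_mono (Set.image_mono (Set.Iic_subset_Iic.2 h))

theorem frameJet_mem_normalSpan {j m : ℕ} (h : j ≤ m) : (frameJet N j).2 ∈ normalSpan N m :=
  Submodule.subset_span ⟨j, h, rfl⟩

theorem jetV_mem_normalSpan {m : ℕ} (h : 1 ≤ m) : jetV N ∈ normalSpan N m := by
  have := frameJet_mem_normalSpan (N := N) h
  rwa [frameJet_one] at this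

theorem smul_mem_normalSpan {m : ℕ} {c : Jet N} (hc : c ∈ invJet N) {u : Fin N → Jet N}
    (hu : u ∈ normalSpan N m) : c • u ∈ normalSpan N m :=
  (normalSpan N m).smul_mem (⟨c, hc⟩ : invJet N) hu

theorem dot_mem_of_normalSpan {m m' : ℕ} {u w : Fin N → Jet N} (hu : u ∈ normalSpan N m)
    (hw : w ∈ normalSpan N m') : u ⬝ᵥ w ∈ invJet N := by
  induction hu using Submodule.span_induction with
  | zero => rw [zero_dotProduct]; exact zero_mem _
  | add a b _ _ ha hb => rw [add_dotProduct]; exact add_mem ha hb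
  | smul c a _ ha =>
    have : (c • a) ⬝ᵥ w = (c : Jet N) * (a ⬝ᵥ w) := smul_dotProduct (c : Jet N) a w
    rw [this]
    exact mul_mem c.2 ha
  | mem a ha =>
    obtain ⟨j, -, rfl⟩ := ha
    induction hw using Submodule.span_induction with
    | zero => rw [dotProduct_zero]; exact zero_mem _
    | add a b _ _ ha hb => rw [dotProduct_add]; exact add_mem ha hb
    | smul c a _ ha =>
      have : (frameJet N j).2 ⬝ᵥ (c • a) = (c : Jet N) * ((frameJet N j).2 ⬝ᵥ a) :=
        dotProduct_smul (c : Jet N) _ a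
      simp only [this]
      exact mul_mem c.2 ha
    | mem a ha =>
      obtain ⟨k, -, rfl⟩ := ha
      exact frameJet_dot_mem j k

/-- Differentiating the normal part of `D_X^j X` gives that of `D_X^{j+1} X` minus an invariant
multiple of `v`, and `v` is itself the normal part of `D_X X`. -/
theorem vecD_mem_normalSpan {m : ℕ} {u : Fin N → Jet N} (hu : u ∈ normalSpan N m) :
    vecD u ∈ normalSpan N (m + 1) := by
  induction hu using Submodule.span_induction with
  | zero =>
    have : vecD (0 : Fin N → Jet N) = 0 := by ext1 i; simp [vecD]
    rw [this]; exact zero_mem _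
  | add a b _ _ ha hb => rw [vecD_eq_dvec, dvec_add]; exact add_mem ha hb
  | smul c a ha' ha =>
    have : c • a = (c : Jet N) • a := rfl
    rw [this, vecD_eq_dvec, dvec_smul]
    exact add_mem (smul_mem_normalSpan (totalD_mem_invJet c.2) (normalSpan_mono (by omega) ha'))
      (smul_mem_normalSpan c.2 ha)
  | mem a ha =>
    obtain ⟨j, hj, rfl⟩ := ha
    simp only [vecD_frameJet]
    exact sub_mem (frameJet_mem_normalSpan (Nat.succ_le_succ hj))
      (smul_mem_normalSpan (frameJet_fst_mem j) (jetV_mem_normalSpan (by omega)))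

end Frame

end CurveFlow

namespace CurveFlow

open Finset

/-! ## Solution of the Riccati system by power series -/

/-- The coefficients of the solution `(x, y)` of the Riccati system over differential
polynomials. -/
noncomputable def riccatiCoeff (N : ℕ) : ℕ → (Fin N → Jet N) × (Fin N → Jet N)
  | 0 => 0
  | n + 1 =>
    ((if n = 0 then jetV N else 0) + vecD (riccatiCoeff N n).2
        + ∑ k : Fin (n + 1), (jetV N ⬝ᵥ (riccatiCoeff N k).2) • (riccatiCoeff N (n - k)).2,
      vecD (riccatiCoeff N n).1
        + ∑ k : Fin (n + 1), (jetV N ⬝ᵥ (riccatiCoeff N k).1) • (riccatiCoeff N (n - k)).2)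
  decreasing_by all_goals omega

variable {N : ℕ}

theorem riccatiCoeff_zero : riccatiCoeff N 0 = 0 := by
  rw [riccatiCoeff]

theorem riccatiCoeff_succ_fst (n : ℕ) : (riccatiCoeff N (n + 1)).1 =
    (if n = 0 then jetV N else 0) + vecD (riccatiCoeff N n).2
      + ∑ k ∈ range (n + 1), (jetV N ⬝ᵥ (riccatiCoeff N k).2) • (riccatiCoeff N (n - k)).2 := by
  rw [riccatiCoeff, Finset.sum_range]

theorem riccatiCoeff_succ_snd (n : ℕ) : (riccatiCoeff N (n + 1)).2 =
    vecD (riccatiCoeff N n).1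
      + ∑ k ∈ range (n + 1), (jetV N ⬝ᵥ (riccatiCoeff N k).1) • (riccatiCoeff N (n - k)).2 := by
  rw [riccatiCoeff, Finset.sum_range]

/-- Each of `x_{n+1}`, `y_{n+1}` is the derivative of the other series' previous coefficient plus
quadratic terms of lower order, so the leading normal part of `D_X^n X` alternates between the two.
At `n = 0` the truncated `n - 1` is harmless, since `X` has no normal part. -/
theorem riccatiCoeff_mem (n : ℕ) :
    ((riccatiCoeff N n).1 - (if Odd n then 1 else 0 : Jet N) • (frameJet N n).2
        ∈ normalSpan N (n - 1)) ∧
      ((riccatiCoeff N n).2 - (if Even n then 1 else 0 : Jet N) • (frameJet N n).2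
        ∈ normalSpan N (n - 1)) ∧
      (riccatiCoeff N n).1 ∈ normalSpan N n ∧ (riccatiCoeff N n).2 ∈ normalSpan N n := by
  have hif : ∀ p : Prop, ∀ [Decidable p], (if p then 1 else 0 : Jet N) ∈ invJet N := by
    intro p _
    split_ifs
    exacts [one_mem _, zero_mem _]
  suffices h : ((riccatiCoeff N n).1 - (if Odd n then 1 else 0 : Jet N) • (frameJet N n).2
        ∈ normalSpan N (n - 1)) ∧
      ((riccatiCoeff N n).2 - (if Even n then 1 else 0 : Jet N) • (frameJet N n).2
        ∈ normalSpan N (n - 1)) by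
    refine ⟨h.1, h.2, ?_, ?_⟩
    · have := add_mem (normalSpan_mono (Nat.sub_le n 1) h.1)
        (smul_mem_normalSpan (hif (Odd n)) (frameJet_mem_normalSpan le_rfl))
      rwa [sub_add_cancel] at this
    · have := add_mem (normalSpan_mono (Nat.sub_le n 1) h.2)
        (smul_mem_normalSpan (hif (Even n)) (frameJet_mem_normalSpan le_rfl))
      rwa [sub_add_cancel] at this
  induction n using Nat.strong_induction_on with
  | _ n ih =>
  have ih1 : ∀ k < n, (riccatiCoeff N k).1 ∈ normalSpan N k := fun k hk => by
    have := add_mem (normalSpan_mono (Nat.sub_le k 1) (ih k hk).1)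
      (smul_mem_normalSpan (hif (Odd k)) (frameJet_mem_normalSpan le_rfl))
    rwa [sub_add_cancel] at this
  have ih2 : ∀ k < n, (riccatiCoeff N k).2 ∈ normalSpan N k := fun k hk => by
    have := add_mem (normalSpan_mono (Nat.sub_le k 1) (ih k hk).2)
      (smul_mem_normalSpan (hif (Even k)) (frameJet_mem_normalSpan le_rfl))
    rwa [sub_add_cancel] at this
  cases n with
  | zero => simp [riccatiCoeff_zero, frameJet]
  | succ n =>
    have hv : jetV N ∈ normalSpan N 1 := jetV_mem_normalSpan le_rfl
    have hs1 : ∑ k ∈ range (n + 1),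
        (jetV N ⬝ᵥ (riccatiCoeff N k).2) • (riccatiCoeff N (n - k)).2 ∈ normalSpan N n :=
      sum_mem fun k hk => smul_mem_normalSpan
        (dot_mem_of_normalSpan hv (ih2 k (mem_range.1 hk)))
        (normalSpan_mono (Nat.sub_le n k) (ih2 _ (by omega)))
    have hs2 : ∑ k ∈ range (n + 1),
        (jetV N ⬝ᵥ (riccatiCoeff N k).1) • (riccatiCoeff N (n - k)).2 ∈ normalSpan N n :=
      sum_mem fun k hk => smul_mem_normalSpan
        (dot_mem_of_normalSpan hv (ih1 k (mem_range.1 hk)))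
        (normalSpan_mono (Nat.sub_le n k) (ih2 _ (by omega)))
    rw [riccatiCoeff_succ_fst, riccatiCoeff_succ_snd, Nat.add_sub_cancel]
    -- The leading term of `x₁` comes from the inhomogeneous `v`; from then on it is produced by
    -- differentiation.
    rcases Nat.eq_zero_or_pos n with rfl | hn
    · have h0 : vecD (0 : Fin N → Jet N) = 0 := by ext1 i; simp [vecD]
      simp [riccatiCoeff_zero, frameJet_one, h0]
    · have hstep : ∀ (e : Jet N) (u : Fin N → Jet N), e = 0 ∨ e = 1 →
          u - e • (frameJet N n).2 ∈ normalSpan N (n - 1) →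
          vecD u - e • (frameJet N (n + 1)).2 ∈ normalSpan N n := by
        intro e u he hu
        have h1 := vecD_mem_normalSpan hu
        rw [Nat.sub_add_cancel hn] at h1
        have h2 : totalD N e = 0 := by rcases he with rfl | rfl <;> simp
        have h3 : e ∈ invJet N := by
          rcases he with rfl | rfl
          exacts [zero_mem _, one_mem _]
        have h4 := smul_mem_normalSpan (mul_mem h3 (frameJet_fst_mem (N := N) n))
          (jetV_mem_normalSpan (N := N) hn)
        have h5 := sub_mem h1 h4
        rw [vecD_eq_dvec, dvec_sub, dvec_smul, h2, ← vecD_eq_dvec, ← vecD_eq_dvec,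
          vecD_frameJet] at h5
        convert h5 using 1
        module
      have hn0 : n ≠ 0 := hn.ne'
      obtain ⟨i1, i2⟩ := ih n (Nat.lt_succ_self n)
      constructor
      · have := add_mem (hstep _ _ (by split_ifs <;> simp) i2) hs1
        simp only [Nat.odd_add_one, Nat.not_odd_iff_even, if_neg hn0, zero_add]
        convert this using 1
        module
      · have := add_mem (hstep _ _ (by split_ifs <;> simp) i1) hs2
        simp only [Nat.even_add_one, Nat.not_even_iff_odd]
        convert this using 1
        module

section Series

open PowerSeries

theorem constantCoeff_totalD (f : Jet N) : MvPolynomial.constantCoeff (totalD N f) = 0 := by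
  induction f using MvPolynomial.induction_on with
  | C c => rw [← MvPolynomial.algebraMap_eq, Derivation.map_algebraMap, map_zero]
  | add p q hp hq => rw [map_add, map_add, hp, hq, add_zero]
  | mul_X p i hp =>
    obtain ⟨i, j⟩ := i
    simp [hp]

theorem constantCoeff_evolD {Q : Fin N → Jet N}
    (hQ : ∀ i, MvPolynomial.constantCoeff (Q i) = 0) (f : Jet N) :
    MvPolynomial.constantCoeff (evolD Q f) = 0 := by
  have h : ∀ i j, MvPolynomial.constantCoeff ((totalD N)^[j] (Q i)) = 0 := by
    intro i j
    cases j with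
    | zero => exact hQ i
    | succ j => rw [Function.iterate_succ_apply']; exact constantCoeff_totalD _
  induction f using MvPolynomial.induction_on with
  | C c => rw [← MvPolynomial.algebraMap_eq, Derivation.map_algebraMap, map_zero]
  | add p q hp hq => rw [map_add, map_add, hp, hq, add_zero]
  | mul_X p i hp =>
    obtain ⟨i, j⟩ := i
    simp [hp, h]

theorem constantCoeff_riccatiCoeff (n : ℕ) (i : Fin N) :
    MvPolynomial.constantCoeff ((riccatiCoeff N n).1 i) = 0 ∧
      MvPolynomial.constantCoeff ((riccatiCoeff N n).2 i) = 0 := by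
  have hv : ∀ w : Fin N → Jet N, MvPolynomial.constantCoeff (jetV N ⬝ᵥ w) = 0 := by
    intro w
    simp [dotProduct, jetV]
  cases n with
  | zero => simp [riccatiCoeff_zero]
  | succ n =>
    rw [riccatiCoeff_succ_fst, riccatiCoeff_succ_snd]
    constructor
    · have : MvPolynomial.constantCoeff ((if n = 0 then jetV N else 0) i) = 0 := by
        split_ifs <;> simp [jetV]
      simp [vecD, constantCoeff_totalD, hv, this]
    · simp [vecD, constantCoeff_totalD, hv]

variable (N)

/-- The solution `x` of the Riccati system. -/
noncomputable def riccatiX : Fin N → (Jet N)⟦X⟧ := fun i =>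
  PowerSeries.mk fun n => (riccatiCoeff N n).1 i

/-- The solution `y` of the Riccati system. -/
noncomputable def riccatiY : Fin N → (Jet N)⟦X⟧ := fun i =>
  PowerSeries.mk fun n => (riccatiCoeff N n).2 i

/-- The flow variable as a constant power series. -/
noncomputable def seriesV : Fin N → (Jet N)⟦X⟧ := fun i => C (jetV N i)

/-- The determinant of `1 - x xᵀ + y yᵀ`. -/
noncomputable def riccatiDet : (Jet N)⟦X⟧ :=
  (1 + riccatiY N ⬝ᵥ riccatiY N) * (1 - riccatiX N ⬝ᵥ riccatiX N)
    + (riccatiX N ⬝ᵥ riccatiY N) ^ 2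

variable {N}

theorem coeff_dot (a b : Fin N → (Jet N)⟦X⟧) (n : ℕ) : coeff n (a ⬝ᵥ b) =
    ∑ p ∈ antidiagonal n, (fun i => coeff p.1 (a i)) ⬝ᵥ fun i => coeff p.2 (b i) := by
  simp only [dotProduct, map_sum, coeff_mul]
  rw [Finset.sum_comm]

theorem coeff_seriesV_dot (b : Fin N → (Jet N)⟦X⟧) (n : ℕ) : coeff n (seriesV N ⬝ᵥ b) =
    jetV N ⬝ᵥ fun i => coeff n (b i) := by
  simp [dotProduct, map_sum, seriesV]

theorem riccatiX_eq : riccatiX N = (X : (Jet N)⟦X⟧) • seriesV N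
    + (X : (Jet N)⟦X⟧) • dvec (coeffD (totalD N)) (riccatiY N)
    + (X * (seriesV N ⬝ᵥ riccatiY N)) • riccatiY N := by
  have h : ∀ i, riccatiX N i = X * (seriesV N i + coeffD (totalD N) (riccatiY N i)
      + (seriesV N ⬝ᵥ riccatiY N) * riccatiY N i) := by
    intro i
    ext1 n
    cases n with
    | zero => simp [riccatiX, riccatiCoeff_zero]
    | succ n =>
      rw [coeff_succ_X_mul, map_add, map_add, coeff_mul,
        Finset.Nat.sum_antidiagonal_eq_sum_range_succ_mk, riccatiX, coeff_mk,
        riccatiCoeff_succ_fst]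
      simp only [coeff_seriesV_dot, Pi.add_apply, Finset.sum_apply, Pi.smul_apply, smul_eq_mul,
        riccatiY, coeff_mk, coeff_coeffD, seriesV, coeff_C, vecD]
      congr 2
      split_ifs <;> rfl
  ext1 i
  rw [h i]
  simp only [Pi.add_apply, Pi.smul_apply, smul_eq_mul, dvec_apply]
  ring

theorem riccatiY_eq : riccatiY N =
    (X : (Jet N)⟦X⟧) • dvec (coeffD (totalD N)) (riccatiX N)
    + (X * (seriesV N ⬝ᵥ riccatiX N)) • riccatiY N := by
  have h : ∀ i, riccatiY N i = X * (coeffD (totalD N) (riccatiX N i)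
      + (seriesV N ⬝ᵥ riccatiX N) * riccatiY N i) := by
    intro i
    ext1 n
    cases n with
    | zero => simp [riccatiY, riccatiCoeff_zero]
    | succ n =>
      rw [coeff_succ_X_mul, map_add, coeff_mul,
        Finset.Nat.sum_antidiagonal_eq_sum_range_succ_mk, riccatiY, coeff_mk,
        riccatiCoeff_succ_snd]
      simp only [coeff_seriesV_dot, Pi.add_apply, Finset.sum_apply, Pi.smul_apply, smul_eq_mul,
        riccatiX, coeff_mk, coeff_coeffD, vecD]
  ext1 i
  rw [h i]
  simp only [Pi.add_apply, Pi.smul_apply, smul_eq_mul, dvec_apply]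
  ring

/-- Power series with coefficients in a subalgebra. -/
def IsSeriesOver {A : Type*} [CommRing A] [Algebra ℝ A] (S : Subalgebra ℝ A) (f : A⟦X⟧) : Prop :=
  ∀ n, coeff n f ∈ S

theorem IsSeriesOver.add {A : Type*} [CommRing A] [Algebra ℝ A] {S : Subalgebra ℝ A}
    {f g : A⟦X⟧} (hf : IsSeriesOver S f) (hg : IsSeriesOver S g) : IsSeriesOver S (f + g) :=
  fun n => by rw [map_add]; exact add_mem (hf n) (hg n)

theorem IsSeriesOver.sub {A : Type*} [CommRing A] [Algebra ℝ A] {S : Subalgebra ℝ A}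
    {f g : A⟦X⟧} (hf : IsSeriesOver S f) (hg : IsSeriesOver S g) : IsSeriesOver S (f - g) :=
  fun n => by rw [map_sub]; exact sub_mem (hf n) (hg n)

theorem IsSeriesOver.mul {A : Type*} [CommRing A] [Algebra ℝ A] {S : Subalgebra ℝ A}
    {f g : A⟦X⟧} (hf : IsSeriesOver S f) (hg : IsSeriesOver S g) : IsSeriesOver S (f * g) :=
  fun n => by rw [coeff_mul]; exact sum_mem fun p _ => mul_mem (hf p.1) (hg p.2)

theorem IsSeriesOver.one {A : Type*} [CommRing A] [Algebra ℝ A] {S : Subalgebra ℝ A} :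
    IsSeriesOver S (1 : A⟦X⟧) := fun n => by
  rw [coeff_one]
  split_ifs
  exacts [one_mem _, zero_mem _]

theorem isSeriesOver_riccatiDet : IsSeriesOver (invJet N) (riccatiDet N) := by
  have hx : ∀ n, (fun i => coeff n (riccatiX N i)) ∈ normalSpan N n := fun n => by
    simpa [riccatiX] using (riccatiCoeff_mem (N := N) n).2.2.1
  have hy : ∀ n, (fun i => coeff n (riccatiY N i)) ∈ normalSpan N n := fun n => by
    simpa [riccatiY] using (riccatiCoeff_mem (N := N) n).2.2.2
  have h : ∀ a b : Fin N → (Jet N)⟦X⟧, (∀ n, (fun i => coeff n (a i)) ∈ normalSpan N n) →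
      (∀ n, (fun i => coeff n (b i)) ∈ normalSpan N n) →
      IsSeriesOver (invJet N) (a ⬝ᵥ b) := by
    intro a b ha hb n
    rw [coeff_dot]
    exact sum_mem fun p _ => dot_mem_of_normalSpan (ha p.1) (hb p.2)
  rw [riccatiDet, pow_two]
  exact ((IsSeriesOver.one.add (h _ _ hy hy)).mul (IsSeriesOver.one.sub (h _ _ hx hx))).add
    ((h _ _ hx hy).mul (h _ _ hx hy))

theorem constantCoeff_riccatiDet : constantCoeff (riccatiDet N) = 1 := by
  have hx : ∀ i, constantCoeff (riccatiX N i) = 0 := fun i => by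
    rw [← coeff_zero_eq_constantCoeff_apply]; simp [riccatiX, riccatiCoeff_zero]
  have hy : ∀ i, constantCoeff (riccatiY N i) = 0 := fun i => by
    rw [← coeff_zero_eq_constantCoeff_apply]; simp [riccatiY, riccatiCoeff_zero]
  simp [riccatiDet, dotProduct, hx, hy]

variable (N) in
/-- The normalization factor `(det (1 - x xᵀ + y yᵀ))^(-1/2)`. -/
noncomputable def riccatiRho : (Jet N)⟦X⟧ :=
  (exists_inv_sqrt_of_subalgebra (invJet N) (riccatiDet N) constantCoeff_riccatiDet
    isSeriesOver_riccatiDet).choose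

theorem riccatiRho_spec : IsSeriesOver (invJet N) (riccatiRho N) ∧
    constantCoeff (riccatiRho N) = 1 ∧ riccatiRho N ^ 2 * riccatiDet N = 1 :=
  (exists_inv_sqrt_of_subalgebra (invJet N) (riccatiDet N) constantCoeff_riccatiDet
    isSeriesOver_riccatiDet).choose_spec

theorem isRiccati (N : ℕ) : IsRiccati (coeffD (totalD N)) X (seriesV N) (riccatiX N) (riccatiY N)
    (riccatiRho N) :=
  ⟨X_ne_zero, riccatiX_eq, riccatiY_eq, riccatiRho_spec.2.2⟩

/-- Setting all jet variables to zero kills `x` and `y`, so `ρ² = 1` there. The sign is fixed by the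
coefficient of `s⁰`, and `ρ` reduces to `1`. -/
theorem constantCoeff_riccatiRho {n : ℕ} (hn : n ≠ 0) :
    MvPolynomial.constantCoeff (coeff n (riccatiRho N)) = 0 := by
  set φ := PowerSeries.map (MvPolynomial.constantCoeff : Jet N →+* ℝ) with hφ
  have hx : ∀ i, φ (riccatiX N i) = 0 := fun i => by
    ext n; simp [hφ, riccatiX, (constantCoeff_riccatiCoeff n i).1]
  have hy : ∀ i, φ (riccatiY N i) = 0 := fun i => by
    ext n; simp [hφ, riccatiY, (constantCoeff_riccatiCoeff n i).2]
  have h := congrArg φ (riccatiRho_spec (N := N)).2.2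
  have hdet : φ (riccatiDet N) = 1 := by
    simp [riccatiDet, dotProduct, hx, hy]
  rw [map_mul, map_pow, hdet, mul_one, map_one] at h
  rcases mul_self_eq_one_iff.1 ((pow_two _).symm.trans h) with h1 | h1
  · have := congrArg (coeff n) h1
    rw [coeff_one, if_neg hn, hφ, coeff_map] at this
    exact this
  · have h2 := congrArg (coeff 0) h1
    rw [hφ, coeff_map, coeff_zero_eq_constantCoeff_apply, riccatiRho_spec.2.1, map_one, map_neg,
      coeff_zero_eq_constantCoeff_apply, map_one] at h2
    norm_num at h2

end Series

end CurveFlow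

namespace CurveFlow

open Finset

/-! ## The hierarchy -/

section Series

open PowerSeries

variable (N : ℕ)

/-- The covectors of the hierarchy. -/
noncomputable def hierCov (k : ℕ) : Fin N → Jet N := fun i =>
  coeff (2 * k + 1) ((riccatiRho N • riccatiX N) i)

/-- The vector fields of the hierarchy. -/
noncomputable def hierVf (k : ℕ) : Fin N → Jet N := fun i =>
  coeff (2 * k + 2) ((riccatiRho N • riccatiY N) i)

/-- The antiderivatives of `v · K_k`. -/
noncomputable def hierPar (k : ℕ) : Jet N := coeff (2 * k + 2) (riccatiRho N)

/-- The antiderivatives of `v ∧ δH_k/δv`. -/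
noncomputable def hierRot (k : ℕ) : Matrix (Fin N) (Fin N) (Jet N) := fun i j =>
  coeff (2 * k + 1) ((riccatiRho N • wedge (riccatiX N) (riccatiY N)) i j)

/-- The Hamiltonians of the hierarchy. -/
noncomputable def hierHam (k : ℕ) : Jet N := (2 * k + 1 : ℝ)⁻¹ • hierPar N k

variable {N}

theorem coeff_zero_riccati (i : Fin N) :
    coeff 0 ((riccatiRho N • riccatiY N) i) = 0 := by
  rw [Pi.smul_apply, smul_eq_mul, coeff_zero_eq_constantCoeff_apply, map_mul,
    ← coeff_zero_eq_constantCoeff_apply (riccatiY N i)]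
  simp [riccatiY, riccatiCoeff_zero]

theorem coeff_succ_d_K (n : ℕ) (i : Fin N) :
    totalD N (coeff n ((riccatiRho N • riccatiY N) i)) =
      coeff (n + 1) ((riccatiRho N • riccatiX N) i) - coeff n (riccatiRho N) * jetV N i := by
  have h := congrArg (coeff (n + 1)) (congrFun (isRiccati N).d_K i)
  rw [Pi.smul_apply, smul_eq_mul, coeff_succ_X_mul, dvec_apply, coeff_coeffD, Pi.sub_apply,
    map_sub, Pi.smul_apply (X * riccatiRho N), smul_eq_mul, mul_assoc, coeff_succ_X_mul, seriesV,
    coeff_mul_C] at h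
  exact h

/-- The coefficient of `s¹` in `W = s (DK + ρv)`: `K` has no constant term and `ρ` starts with `1`.
This constant term of `ρ` is the seed of the recursion. -/
theorem hierCov_zero : hierCov N 0 = jetV N := by
  ext1 i
  have := coeff_succ_d_K (N := N) 0 i
  rw [coeff_zero_riccati, map_zero, coeff_zero_eq_constantCoeff_apply, riccatiRho_spec.2.1,
    one_mul] at this
  exact sub_eq_zero.1 this.symm

theorem hierCov_succ (k : ℕ) :
    hierCov N (k + 1) = vecD (hierVf N k) + hierPar N k • jetV N := by
  ext1 i
  have := coeff_succ_d_K (N := N) (2 * k + 2) i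
  change hierCov N (k + 1) i = totalD N (coeff (2 * k + 2) ((riccatiRho N • riccatiY N) i))
    + coeff (2 * k + 2) (riccatiRho N) * jetV N i
  rw [this, sub_add_cancel]
  rfl

theorem hierRot_skew (k : ℕ) : (hierRot N k).transpose = -hierRot N k := by
  ext1 i j
  simp only [hierRot, Matrix.transpose_apply, Matrix.neg_apply, Matrix.smul_apply, ← map_neg]
  congr 1
  rw [← smul_neg]
  congr 1
  exact congrFun (congrFun (wedge_transpose (riccatiX N) (riccatiY N)) i) j

theorem hierVf_eq (k : ℕ) :
    hierVf N k = vecD (hierCov N k) + Matrix.vecMul (jetV N) (hierRot N k) := by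
  rw [vecMul_of_skew (hierRot_skew k)]
  ext1 i
  have h := congrArg (coeff (2 * k + 2)) (congrFun (isRiccati N).d_W i)
  rw [Pi.smul_apply, smul_eq_mul, coeff_succ_X_mul, dvec_apply, coeff_coeffD, Pi.add_apply,
    map_add, Pi.smul_apply (X : (Jet N)⟦X⟧), smul_eq_mul, coeff_succ_X_mul, Matrix.mulVec,
    dotProduct, map_sum] at h
  simp only [seriesV, coeff_mul_C] at h
  simp only [Pi.add_apply, Pi.neg_apply, vecD, Matrix.mulVec, dotProduct, hierRot]
  rw [hierCov, h, hierVf]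
  ring

theorem isAntideriv_hierPar (k : ℕ) : IsAntideriv (jetV N ⬝ᵥ hierVf N k) (hierPar N k) := by
  refine ⟨?_, constantCoeff_riccatiRho (by omega)⟩
  have h := congrArg (coeff (2 * k + 2)) (isRiccati N).d_rho
  rw [coeff_coeffD, ← smul_eq_mul (riccatiRho N), ← dotProduct_smul, coeff_seriesV_dot] at h
  exact h

theorem constantCoeff_coeff_rho_mul (n : ℕ) {f : (Jet N)⟦X⟧}
    (hf : ∀ n, MvPolynomial.constantCoeff (coeff n f) = 0) :
    MvPolynomial.constantCoeff (coeff n (riccatiRho N * f)) = 0 := by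
  simp [coeff_mul, hf]

theorem constantCoeff_hierVf (k : ℕ) (i : Fin N) :
    MvPolynomial.constantCoeff (hierVf N k i) = 0 :=
  constantCoeff_coeff_rho_mul _ fun n => by
    simp [riccatiY, (constantCoeff_riccatiCoeff n i).2]

theorem constantCoeff_hierCov (k : ℕ) (i : Fin N) :
    MvPolynomial.constantCoeff (hierCov N k i) = 0 :=
  constantCoeff_coeff_rho_mul _ fun n => by
    simp [riccatiX, (constantCoeff_riccatiCoeff n i).1]

theorem isAntideriv_hierRot (k : ℕ) (i j : Fin N) :
    IsAntideriv (wedge (jetV N) (hierCov N k) i j) (hierRot N k i j) := by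
  refine ⟨?_, constantCoeff_coeff_rho_mul _ fun n => ?_⟩
  · have h := congrArg (coeff (2 * k + 1)) (congrFun (congrFun (isRiccati N).d_rot i) j)
    rw [Matrix.map_apply, coeff_coeffD] at h
    rw [hierRot, h]
    simp only [wedge, Matrix.sub_apply, Matrix.vecMulVec_apply, map_sub, seriesV, coeff_mul_C,
      coeff_C_mul, hierCov]
  · simp [wedge, Matrix.vecMulVec_apply, coeff_mul, riccatiX, riccatiY,
      (constantCoeff_riccatiCoeff _ _).1]

theorem hierVf_zero : hierVf N 0 = vecD (jetV N) := by
  have h : hierRot N 0 = 0 := by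
    ext1 i j
    refine (isAntideriv_hierRot 0 i j).unique ⟨?_, map_zero _⟩
    rw [hierCov_zero, wedge_self, Matrix.zero_apply, map_zero]
  rw [hierVf_eq, h, Matrix.vecMul_zero, add_zero, hierCov_zero]

/-- Coefficient of `s^(2k+2)` in `variation_rho`. The operator `s d/ds` multiplies the coefficient
of `s^(2k+1)` in `ρx` by `2k+1`, which accounts for the factor in `hierHam`. -/
theorem hierCov_eq_euler (k : ℕ) : hierCov N k = euler (hierHam N k) := by
  refine euler_eq_of_forall fun Z => ?_
  set F := riccatiRho N * (riccatiForm (riccatiRho N) (riccatiX N) (riccatiY N)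
      (dvec (coeffD (evolD Z)) (riccatiX N)) (dvec scaleD (riccatiY N))
    - riccatiForm (riccatiRho N) (riccatiX N) (riccatiY N)
      (dvec (coeffD (evolD Z)) (riccatiY N)) (dvec scaleD (riccatiX N))) with hF
  have h := (isRiccati N).variation_rho (δ := coeffD (evolD Z)) (ε := scaleD)
    (Z := fun i => C (Z i)) (fun a => by ext1 n; simp [evolD_totalD]) (coeffD_X _)
    (by ext1 i; simp [seriesV, coeffD_C, jetV]) (fun a => scaleD_coeffD _ a) scaleD_X
    (by ext1 i; simp [seriesV, scaleD_C])
  rw [← hF] at h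
  have h1 := congrArg (coeff (2 * k + 2)) h
  rw [coeff_succ_X_mul, map_sub, coeff_succ_X_mul, coeff_coeffD, coeff_coeffD] at h1
  have h2 : coeff (2 * k + 1) ((fun i => C (Z i)) ⬝ᵥ
      dvec scaleD (riccatiRho N • riccatiX N)) = (2 * k + 1 : ℝ) • (hierCov N k ⬝ᵥ Z) := by
    simp only [dotProduct, map_sum, coeff_C_mul, dvec_apply, coeff_scaleD, Finset.smul_sum,
      hierCov, MvPolynomial.smul_eq_C_mul]
    refine Finset.sum_congr rfl fun i _ => ?_
    push_cast [map_add, map_mul, map_natCast, map_ofNat]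
    simp
    ring
  rw [h2] at h1
  have h3 : (2 * k + 1 : ℝ) ≠ 0 := by positivity
  refine ⟨-(2 * k + 1 : ℝ)⁻¹ • coeff (2 * k + 1) F, ?_⟩
  rw [Derivation.map_smul, h1, hierHam, Derivation.map_smul, smul_sub, smul_smul, neg_mul,
    inv_mul_cancel₀ h3, hierPar]
  module

end Series

/-! ### Involution and commutation of the hierarchy -/

variable {N : ℕ}

theorem hRel_hierCov (k : ℕ) : HRel (hierCov N k) (hierVf N k) :=
  ⟨hierRot N k, isAntideriv_hierRot k, hierVf_eq k⟩

/-- The Lenard–Magri scheme. Skewness of `ℋ` followed by skewness of `𝒥` moves one index from the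
vector field to the covector, so modulo total derivatives the pairing depends only on `j + k`. It is
thus symmetric in `j`, `k`, and being also skew by `ℋ`, it vanishes. -/
theorem isTotalDeriv_hierCov_hierVf (j k : ℕ) :
    IsTotalDeriv (hierCov N j ⬝ᵥ hierVf N k) := by
  have hskew : ∀ j k, IsTotalDeriv
      (hierCov N j ⬝ᵥ hierVf N k + hierCov N k ⬝ᵥ hierVf N j) := by
    intro j k
    obtain ⟨Θ, s, d, -, h⟩ := exists_of_HRel (hRel_hierCov (N := N) j)
    obtain ⟨Θ', s', d', -, h'⟩ := exists_of_HRel (hRel_hierCov (N := N) k)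
    exact isTotalDeriv_H_skew s s' d d' h h'
  have hshift : ∀ j k, IsTotalDeriv
      (hierVf N j ⬝ᵥ hierCov N (k + 1) + hierVf N k ⬝ᵥ hierCov N (j + 1)) := fun j k =>
    isTotalDeriv_J_skew (isAntideriv_hierPar j).1 (isAntideriv_hierPar k).1
      (hierCov_succ j) (hierCov_succ k)
  have hstep : ∀ j k, IsTotalDeriv
      (hierCov N j ⬝ᵥ hierVf N (k + 1) - hierCov N (j + 1) ⬝ᵥ hierVf N k) := by
    intro j k
    convert (hskew j (k + 1)).sub (hshift j k) using 1
    rw [dotProduct_comm (hierVf N j), dotProduct_comm (hierVf N k)]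
    ring
  have hsym : ∀ k j, IsTotalDeriv
      (hierCov N j ⬝ᵥ hierVf N k - hierCov N (j + k) ⬝ᵥ hierVf N 0) := by
    intro k
    induction k with
    | zero => intro j; simpa using IsTotalDeriv.zero
    | succ k ih =>
      intro j
      convert (hstep j k).add (ih (j + 1)) using 1
      rw [show j + 1 + k = j + (k + 1) by ring]
      ring
  refine isTotalDeriv_of_two_mul ?_
  convert ((hskew j k).add (hsym k j)).sub (hsym j k) using 1
  rw [add_comm k j]
  ring

theorem vfBracket_hierVf (j k : ℕ) : vfBracket (hierVf N j) (hierVf N k) = 0 := by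
  have hj := hRel_hierCov (N := N) j
  have hk := hRel_hierCov (N := N) k
  have h := isTotalDeriv_hierCov_hierVf (N := N) j k
  rw [hierCov_eq_euler] at hj hk h
  refine vfBracket_eq_zero_of_involution hj hk h (fun i => ?_) fun f => ⟨?_, ?_⟩
  · rw [← hierCov_eq_euler]; exact constantCoeff_hierCov j i
  · exact constantCoeff_evolD (constantCoeff_hierVf j) f
  · exact constantCoeff_evolD (constantCoeff_hierVf k) f

/-- The hierarchy with given map operators. -/
noncomputable def flowHierarchy (N : ℕ) (f : ℕ → MapOperator) : FlowHierarchy N where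
  vf := hierVf N
  cov := hierCov N
  par := hierPar N
  rot := hierRot N
  ham := hierHam N
  map := f

theorem isBiHamiltonian_flowHierarchy (f : ℕ → MapOperator) :
    (flowHierarchy N f).IsBiHamiltonian where
  cov_zero := hierCov_zero
  vf_zero := hierVf_zero
  par_spec := isAntideriv_hierPar
  cov_succ := hierCov_succ
  rot_spec := isAntideriv_hierRot
  vf_eq := hierVf_eq
  cov_eq := hierCov_eq_euler
  commute := vfBracket_hierVf
  involution := isTotalDeriv_hierCov_hierVf

end CurveFlow

namespace CurveFlow

open Finset

/-! ## Geometric map operators -/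

variable {N : ℕ}

/-- The tangential component of a map operator, as a differential polynomial. -/
noncomputable def opPar (N : ℕ) (f : MapOperator) : Jet N :=
  f.sum fun j c => innerJet N c * (frameJet N j).1

/-- The normal components of a map operator, as differential polynomials. -/
noncomputable def opNormal (N : ℕ) (f : MapOperator) : Fin N → Jet N :=
  f.sum fun j c => innerJet N c • (frameJet N j).2

theorem opPar_add (f g : MapOperator) : opPar N (f + g) = opPar N f + opPar N g :=
  Finsupp.sum_add_index' (by simp) fun j b c => by rw [map_add, add_mul]

theorem opNormal_add (f g : MapOperator) : opNormal N (f + g) = opNormal N f + opNormal N g :=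
  Finsupp.sum_add_index' (by simp) fun j b c => by rw [map_add, add_smul]

theorem opPar_single (j : ℕ) (c : MvPolynomial (ℕ × ℕ) ℝ) :
    opPar N (Finsupp.single j c) = innerJet N c * (frameJet N j).1 :=
  Finsupp.sum_single_index (by simp)

theorem opNormal_single (j : ℕ) (c : MvPolynomial (ℕ × ℕ) ℝ) :
    opNormal N (Finsupp.single j c) = innerJet N c • (frameJet N j).2 :=
  Finsupp.sum_single_index (by simp)

theorem opPar_mem (f : MapOperator) : opPar N f ∈ invJet N :=
  sum_mem fun j _ => mul_mem ⟨_, rfl⟩ (frameJet_fst_mem j)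

theorem opNormal_mapRange (c : MvPolynomial (ℕ × ℕ) ℝ) (f : MapOperator) :
    opNormal N (c • f) = innerJet N c • opNormal N f := by
  rw [opNormal, Finsupp.sum_smul_index (by simp), opNormal, Finsupp.smul_sum]
  simp only [map_mul, mul_smul]

/-- Invariant coefficients are lifted from differential polynomials to polynomials in abstract inner
products. -/
theorem exists_of_mem_normalSpan {m : ℕ} {w : Fin N → Jet N} (hw : w ∈ normalSpan N m) :
    ∃ f : MapOperator, (∀ j, m < j → f j = 0) ∧ opNormal N f = w := by
  induction hw using Submodule.span_induction with
  | mem a ha =>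
    obtain ⟨j, hj, rfl⟩ := ha
    refine ⟨Finsupp.single j 1, fun i hi => ?_, by simp [opNormal_single]⟩
    rw [Finsupp.single_apply, if_neg (by simp only [Set.mem_Iic] at hj; omega)]
  | zero => exact ⟨0, fun _ _ => rfl, by simp [opNormal]⟩
  | add a b _ _ ha hb =>
    obtain ⟨f, hf, rfl⟩ := ha
    obtain ⟨g, hg, rfl⟩ := hb
    exact ⟨f + g, fun j hj => by simp [hf j hj, hg j hj], opNormal_add f g⟩
  | smul c a _ ha =>
    obtain ⟨f, hf, rfl⟩ := ha
    obtain ⟨q, hq⟩ := c.2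
    refine ⟨q • f, fun j hj => by simp [hf j hj], ?_⟩
    rw [opNormal_mapRange]
    exact congrArg (fun c : Jet N => c • opNormal N f) hq

/-- In the Cauchy product `ρy`, top order arises only from the constant coefficient `1` of `ρ` times
`y_{2k+2}`, whose leading term is known. -/
theorem hierVf_sub_mem (k : ℕ) :
    hierVf N k - (frameJet N (2 * k + 2)).2 ∈ normalSpan N (2 * k + 1) := by
  have h := (riccatiCoeff_mem (N := N) (2 * k + 2)).2.1
  rw [if_pos (by exact ⟨k + 1, by ring⟩), one_smul] at h
  have h1 : hierVf N k = (riccatiCoeff N (2 * k + 2)).2 + ∑ j ∈ range (2 * k + 2),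
      PowerSeries.coeff (2 * k + 2 - j) (riccatiRho N) • (riccatiCoeff N j).2 := by
    ext1 i
    simp only [hierVf, Pi.smul_apply, smul_eq_mul, Pi.add_apply, Finset.sum_apply]
    rw [PowerSeries.coeff_mul, ← Finset.Nat.sum_antidiagonal_swap,
      Finset.Nat.sum_antidiagonal_eq_sum_range_succ_mk, Finset.sum_range_succ]
    simp only [Prod.swap_prod_mk, riccatiY, PowerSeries.coeff_mk, Nat.sub_self,
      PowerSeries.coeff_zero_eq_constantCoeff_apply, riccatiRho_spec.2.1, one_mul]
    ring
  rw [h1, add_sub_right_comm]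
  exact add_mem h (sum_mem fun j hj => smul_mem_normalSpan (riccatiRho_spec.1 _)
    (normalSpan_mono (by rw [mem_range] at hj; omega) (riccatiCoeff_mem j).2.2.2))

/-- The mKdV map operator `D_X² X + (3/2) |D_X X|² X`. -/
noncomputable def mkdvOperator : MapOperator :=
  Finsupp.single 2 1 + Finsupp.single 0 (MvPolynomial.C (3 / 2) * MvPolynomial.X (1, 1))

theorem hierPar_zero : hierPar N 0 = (1 / 2 : ℝ) • (jetV N ⬝ᵥ jetV N) := by
  refine (isAntideriv_hierPar 0).unique ⟨?_, ?_⟩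
  · rw [Derivation.map_smul, map_dotProduct, hierVf_zero, ← vecD_eq_dvec,
      dotProduct_comm (vecD _)]
    module
  · simp [dotProduct, jetV, MvPolynomial.smul_eq_C_mul]

/-- This fixes the constant `3/2`: the tangential part of `D_X² X` is `-|v|²`, while `D⁻¹(v·v_l) =
½|v|²`. -/
theorem opPar_mkdvOperator : opPar N mkdvOperator = hierPar N 0 := by
  have h2 : (frameJet N 2).1 = -(jetV N ⬝ᵥ jetV N) := by
    rw [show 2 = 1 + 1 from rfl, frameJet, frameJet_one]
    simp
  rw [mkdvOperator, opPar_add, opPar_single, opPar_single, map_mul, innerJet_X, frameJet_one, h2,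
    hierPar_zero, innerJet, MvPolynomial.algHom_C]
  simp only [map_one, frameJet, MvPolynomial.algebraMap_eq, MvPolynomial.smul_eq_C_mul]
  have : (MvPolynomial.C (3 / 2 : ℝ) : Jet N) = 1 + MvPolynomial.C (1 / 2) := by
    rw [← map_one MvPolynomial.C, ← map_add]
    norm_num
  rw [this]
  ring

theorem opNormal_mkdvOperator : opNormal N mkdvOperator = hierVf N 0 := by
  have h2 : (frameJet N 2).2 = vecD (jetV N) := by
    rw [show 2 = 1 + 1 from rfl, frameJet, frameJet_one]
    simp
  rw [mkdvOperator, opNormal_add, opNormal_single, opNormal_single, h2, hierVf_zero]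
  simp [frameJet]

/-- The normal part dictates all terms but the multiple of `X`, which has no normal part and is free
to adjust the tangential one. The case `k = 0` is separate because the first operator is prescribed
exactly, not merely through its components. -/
theorem exists_mapOperator (N k : ℕ) : ∃ f : MapOperator, f (2 * k + 2) = 1 ∧
    (∀ j, 2 * k + 2 < j → f j = 0) ∧ (k = 0 → f = mkdvOperator) ∧
    opPar N f = hierPar N k ∧ opNormal N f = hierVf N k := by
  rcases Nat.eq_zero_or_pos k with rfl | hk
  · refine ⟨mkdvOperator, ?_, fun j hj => ?_, fun _ => rfl, opPar_mkdvOperator,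
      opNormal_mkdvOperator⟩
    · simp [mkdvOperator]
    · simp only [mkdvOperator, Finsupp.add_apply, Finsupp.single_apply]
      rw [if_neg (by omega), if_neg (by omega), add_zero]
  · obtain ⟨q, hq, hq'⟩ := exists_of_mem_normalSpan (hierVf_sub_mem (N := N) k)
    -- The tangential defect is an invariant because the coefficients of `ρ` are, so it can serve as
    -- the coefficient of `X`.
    obtain ⟨c, hc⟩ : hierPar N k - opPar N (q + Finsupp.single (2 * k + 2) 1) ∈ invJet N :=
      sub_mem (riccatiRho_spec.1 _) (opPar_mem _)
    refine ⟨q + Finsupp.single (2 * k + 2) 1 + Finsupp.single 0 c, ?_, fun j hj => ?_,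
      fun h => absurd h hk.ne', ?_, ?_⟩
    · simp [hq (2 * k + 2) (by omega)]
    · simp only [Finsupp.add_apply, Finsupp.single_apply, hq j (by omega)]
      rw [if_neg (by omega), if_neg (by omega), add_zero, add_zero]
    · rw [opPar_add, opPar_single, show innerJet N c = _ from hc]
      simp [frameJet]
    · rw [opNormal_add, opNormal_add, opNormal_single, opNormal_single, hq']
      simp [frameJet]

/-- The map operators of the hierarchy. -/
noncomputable def hierMap (N k : ℕ) : MapOperator := (exists_mapOperator N k).choose

theorem isMapHierarchy_flowHierarchy (N : ℕ) :
    (flowHierarchy N (hierMap N)).IsMapHierarchy where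
  map_zero := (exists_mapOperator N 0).choose_spec.2.2.1 rfl
  map_lead k := (exists_mapOperator N k).choose_spec.1
  map_order k := (exists_mapOperator N k).choose_spec.2.1

theorem opPar_hierMap (k : ℕ) : opPar N (hierMap N k) = hierPar N k :=
  (exists_mapOperator N k).choose_spec.2.2.2.1

theorem opNormal_hierMap (k : ℕ) : opNormal N (hierMap N k) = hierVf N k :=
  (exists_mapOperator N k).choose_spec.2.2.2.2

end CurveFlow

open scoped ContDiff

namespace CurveFlow

open Finset

/-! ## Smooth functions of two variables -/

/-- Joint smoothness in `τ ∈ T` and `l ∈ L`. -/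
def Smooth₂ {F : Type*} [NormedAddCommGroup F] [NormedSpace ℝ F] (T L : Set ℝ) (f : ℝ → ℝ → F) :
    Prop :=
  ContDiffOn ℝ ∞ (fun p : ℝ × ℝ => f p.1 p.2) (T ×ˢ L)

section Calculus

variable {F : Type*} [NormedAddCommGroup F] [NormedSpace ℝ F] {T L : Set ℝ} {τ l : ℝ}

namespace Smooth₂

variable {f : ℝ → ℝ → F}

theorem differentiableAt (hT : IsOpen T) (hL : IsOpen L) (hf : Smooth₂ T L f) (hτ : τ ∈ T)
    (hl : l ∈ L) : DifferentiableAt ℝ (fun p : ℝ × ℝ => f p.1 p.2) (τ, l) :=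
  (hf.contDiffAt ((hT.prod hL).mem_nhds ⟨hτ, hl⟩)).differentiableAt (by simp)

theorem hasDerivAt_right' (hT : IsOpen T) (hL : IsOpen L) (hf : Smooth₂ T L f) (hτ : τ ∈ T)
    (hl : l ∈ L) : HasDerivAt (fun s => f τ s)
      (fderiv ℝ (fun p : ℝ × ℝ => f p.1 p.2) (τ, l) (0, 1)) l :=
  (hf.differentiableAt hT hL hτ hl).hasFDerivAt.comp_hasDerivAt l
    ((hasDerivAt_const l τ).prodMk (hasDerivAt_id l))

theorem hasDerivAt_left' (hT : IsOpen T) (hL : IsOpen L) (hf : Smooth₂ T L f) (hτ : τ ∈ T)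
    (hl : l ∈ L) : HasDerivAt (fun t => f t l)
      (fderiv ℝ (fun p : ℝ × ℝ => f p.1 p.2) (τ, l) (1, 0)) τ :=
  HasFDerivAt.comp_hasDerivAt (l := fun p : ℝ × ℝ => f p.1 p.2) (f := fun t : ℝ => (t, l)) τ
    (hf.differentiableAt hT hL hτ hl).hasFDerivAt
    ((hasDerivAt_id' τ).prodMk (hasDerivAt_const τ l))

theorem hasDerivAt_right (hT : IsOpen T) (hL : IsOpen L) (hf : Smooth₂ T L f) (hτ : τ ∈ T)
    (hl : l ∈ L) : HasDerivAt (fun s => f τ s) (deriv (fun s => f τ s) l) l :=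
  (hf.hasDerivAt_right' hT hL hτ hl).differentiableAt.hasDerivAt

theorem hasDerivAt_left (hT : IsOpen T) (hL : IsOpen L) (hf : Smooth₂ T L f) (hτ : τ ∈ T)
    (hl : l ∈ L) : HasDerivAt (fun t => f t l) (deriv (fun t => f t l) τ) τ :=
  (hf.hasDerivAt_left' hT hL hτ hl).differentiableAt.hasDerivAt

theorem congr {g : ℝ → ℝ → F} (hf : Smooth₂ T L f) (h : ∀ τ ∈ T, ∀ l ∈ L, g τ l = f τ l) :
    Smooth₂ T L g :=
  ContDiffOn.congr hf fun p hp => h p.1 hp.1 p.2 hp.2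

theorem fderiv_apply (hT : IsOpen T) (hL : IsOpen L) (hf : Smooth₂ T L f) (w : ℝ × ℝ) :
    Smooth₂ T L (fun τ l => fderiv ℝ (fun p : ℝ × ℝ => f p.1 p.2) (τ, l) w) :=
  (ContDiffOn.fderiv_of_isOpen hf (hT.prod hL) (m := ∞) (by simp)).clm_apply contDiffOn_const

theorem deriv_right (hT : IsOpen T) (hL : IsOpen L) (hf : Smooth₂ T L f) :
    Smooth₂ T L (fun τ l => deriv (fun s => f τ s) l) :=
  (hf.fderiv_apply hT hL (0, 1)).congr fun _ hτ _ hl => (hf.hasDerivAt_right' hT hL hτ hl).deriv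

theorem deriv_left (hT : IsOpen T) (hL : IsOpen L) (hf : Smooth₂ T L f) :
    Smooth₂ T L (fun τ l => deriv (fun t => f t l) τ) :=
  (hf.fderiv_apply hT hL (1, 0)).congr fun _ hτ _ hl => (hf.hasDerivAt_left' hT hL hτ hl).deriv

theorem deriv_comm (hT : IsOpen T) (hL : IsOpen L) (hf : Smooth₂ T L f) (hτ : τ ∈ T)
    (hl : l ∈ L) : deriv (fun t => deriv (fun s => f t s) l) τ =
      deriv (fun s => deriv (fun t => f t s) τ) l := by
  have hsym := (hf.contDiffAt ((hT.prod hL).mem_nhds (Set.mk_mem_prod hτ hl))).isSymmSndFDerivAt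
    (by rw [minSmoothness_of_isRCLikeNormedField]; exact WithTop.coe_le_coe.2 le_top)
  have hd : DifferentiableAt ℝ (fderiv ℝ (fun p : ℝ × ℝ => f p.1 p.2)) (τ, l) :=
    ((ContDiffOn.fderiv_of_isOpen hf (hT.prod hL) (m := ∞) (by simp)).contDiffAt
      ((hT.prod hL).mem_nhds ⟨hτ, hl⟩)).differentiableAt (by simp)
  have hw : ∀ w w' : ℝ × ℝ, fderiv ℝ (fun p : ℝ × ℝ => fderiv ℝ (fun p : ℝ × ℝ => f p.1 p.2)
      (p.1, p.2) w) (τ, l) w' = fderiv ℝ (fderiv ℝ (fun p : ℝ × ℝ => f p.1 p.2)) (τ, l) w' w := by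
    intro w w'
    rw [(hd.hasFDerivAt.clm_apply (hasFDerivAt_const w (τ, l))).fderiv]
    simp
  have h1 : deriv (fun t => deriv (fun s => f t s) l) τ =
      deriv (fun t => fderiv ℝ (fun p : ℝ × ℝ => f p.1 p.2) (t, l) (0, 1)) τ := by
    apply Filter.EventuallyEq.deriv_eq
    filter_upwards [hT.mem_nhds hτ] with t ht
    exact (hf.hasDerivAt_right' hT hL ht hl).deriv
  have h2 : deriv (fun s => deriv (fun t => f t s) τ) l =
      deriv (fun s => fderiv ℝ (fun p : ℝ × ℝ => f p.1 p.2) (τ, s) (1, 0)) l := by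
    apply Filter.EventuallyEq.deriv_eq
    filter_upwards [hL.mem_nhds hl] with s hs
    exact (hf.hasDerivAt_left' hT hL hτ hs).deriv
  rw [h1, h2, ((hf.fderiv_apply hT hL (0, 1)).hasDerivAt_left' hT hL hτ hl).deriv,
    ((hf.fderiv_apply hT hL (1, 0)).hasDerivAt_right' hT hL hτ hl).deriv, hw, hw]
  exact hsym _ _

theorem right (hf : Smooth₂ T L f) (hτ : τ ∈ T) : ContDiffOn ℝ ∞ (f τ) L :=
  ContDiffOn.comp (g := fun p : ℝ × ℝ => f p.1 p.2) (f := fun l => (τ, l)) hf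
    (contDiffOn_const.prodMk contDiffOn_id) fun _ hl => ⟨hτ, hl⟩

end Smooth₂

theorem Smooth₂.apply {ι : Type*} [Fintype ι] {f : ℝ → ℝ → ι → ℝ} (hf : Smooth₂ T L f) (i : ι) :
    Smooth₂ T L fun τ l => f τ l i :=
  contDiffOn_pi.1 hf i

theorem Smooth₂.pi {ι : Type*} [Fintype ι] {f : ℝ → ℝ → ι → ℝ}
    (hf : ∀ i, Smooth₂ T L fun τ l => f τ l i) : Smooth₂ T L f :=
  contDiffOn_pi.2 hf

/-! ## Evaluation of differential polynomials -/

variable {N : ℕ}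

/-- Evaluation of differential polynomials as a ring homomorphism. -/
noncomputable def jetEvalHom (v : ℝ → Fin N → ℝ) (l : ℝ) : Jet N →+* ℝ :=
  MvPolynomial.eval (fun p : Fin N × ℕ => iteratedDeriv p.2 (fun s => v s p.1) l)

theorem jetEval_eq_hom (P : Jet N) (v : ℝ → Fin N → ℝ) (l : ℝ) :
    jetEval P v l = jetEvalHom v l P := rfl

theorem jetEvalHom_real_smul (v : ℝ → Fin N → ℝ) (l : ℝ) (c : ℝ) (P : Jet N) :
    jetEvalHom v l (c • P) = c * jetEvalHom v l P := by
  simp [jetEvalHom, MvPolynomial.smul_eval]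

theorem jetEvalHom_jetV (v : ℝ → Fin N → ℝ) (l : ℝ) (i : Fin N) :
    jetEvalHom v l (jetV N i) = v l i := by
  simp [jetEvalHom, jetV]

theorem jetEvalHom_dot (v : ℝ → Fin N → ℝ) (l : ℝ) (a b : Fin N → Jet N) :
    jetEvalHom v l (a ⬝ᵥ b) = (fun i => jetEvalHom v l (a i)) ⬝ᵥ fun i => jetEvalHom v l (b i) := by
  simp [dotProduct]

theorem contDiffOn_iteratedDeriv {f : ℝ → ℝ} (hL : IsOpen L) (hf : ContDiffOn ℝ ∞ f L) (j : ℕ) :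
    ContDiffOn ℝ ∞ (iteratedDeriv j f) L := by
  induction j with
  | zero => simpa using hf
  | succ j ih => rw [iteratedDeriv_succ]; exact ih.deriv_of_isOpen hL (by simp)

/-- The bridge from formal to actual calculus: every identity between antiderivatives becomes a
derivative along the curve. -/
theorem hasDerivAt_jetEvalHom {v : ℝ → Fin N → ℝ} (hL : IsOpen L)
    (hv : ∀ i, ContDiffOn ℝ ∞ (fun s => v s i) L) (hl : l ∈ L) (P : Jet N) :
    HasDerivAt (fun s => jetEvalHom v s P) (jetEvalHom v l (totalD N P)) l := by
  induction P using MvPolynomial.induction_on with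
  | C c =>
    rw [← MvPolynomial.algebraMap_eq, Derivation.map_algebraMap, map_zero]
    simpa [jetEvalHom, MvPolynomial.algebraMap_eq] using hasDerivAt_const l c
  | add p q hp hq => simp only [map_add]; exact hp.add hq
  | mul_X p i hp =>
    obtain ⟨i, j⟩ := i
    have h1 : HasDerivAt (iteratedDeriv j fun s => v s i)
        (iteratedDeriv (j + 1) (fun s => v s i) l) l := by
      rw [iteratedDeriv_succ]
      exact (((contDiffOn_iteratedDeriv hL (hv i) j).contDiffAt
        (hL.mem_nhds hl)).differentiableAt (by simp)).hasDerivAt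
    have h2 : ∀ s k, jetEvalHom v s (MvPolynomial.X (i, k)) =
        iteratedDeriv k (fun s => v s i) s := fun s k => by simp [jetEvalHom]
    simp only [map_mul, Derivation.leibniz, totalD_X, map_add, smul_eq_mul, h2]
    exact (hp.mul h1).congr_deriv (by ring)

end Calculus

end CurveFlow

open scoped ContDiff

namespace CurveFlow

open Finset Matrix

/-! ## Regular parts of the geometry along a flow -/

section OneVariable

variable {r : ℕ} {t : ℝ}

theorem hasDerivAt_dotProduct {ξ η : ℝ → Fin r → ℝ} {ξ' η' : Fin r → ℝ} (hξ : HasDerivAt ξ ξ' t)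
    (hη : HasDerivAt η η' t) :
    HasDerivAt (fun s => ξ s ⬝ᵥ η s) (ξ' ⬝ᵥ η t + ξ t ⬝ᵥ η') t := by
  simp only [dotProduct, ← Finset.sum_add_distrib]
  exact HasDerivAt.fun_sum fun i _ => (hasDerivAt_pi.1 hξ i).mul (hasDerivAt_pi.1 hη i)

theorem hasDerivAt_mulVec {A : ℝ → Matrix (Fin r) (Fin r) ℝ} {A' : Matrix (Fin r) (Fin r) ℝ}
    {ξ : ℝ → Fin r → ℝ} {ξ' : Fin r → ℝ} (hA : ∀ i j, HasDerivAt (fun s => A s i j) (A' i j) t)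
    (hξ : HasDerivAt ξ ξ' t) :
    HasDerivAt (fun s => A s *ᵥ ξ s) (A' *ᵥ ξ t + A t *ᵥ ξ') t :=
  hasDerivAt_pi.2 fun i => hasDerivAt_dotProduct (hasDerivAt_pi.2 (hA i)) hξ

theorem hasDerivAt_inner {G : ℝ → Matrix (Fin r) (Fin r) ℝ} {A : Matrix (Fin r) (Fin r) ℝ}
    {ξ η : ℝ → Fin r → ℝ} {ξ' η' : Fin r → ℝ}
    (hG : ∀ i j, HasDerivAt (fun s => G s i j) ((Aᵀ * G t + G t * A) i j) t)
    (hξ : HasDerivAt ξ ξ' t) (hη : HasDerivAt η η' t) :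
    HasDerivAt (fun s => ξ s ⬝ᵥ G s *ᵥ η s)
      ((ξ' + A *ᵥ ξ t) ⬝ᵥ G t *ᵥ η t + ξ t ⬝ᵥ G t *ᵥ (η' + A *ᵥ η t)) t := by
  refine (hasDerivAt_dotProduct hξ (hasDerivAt_mulVec hG hη)).congr_deriv ?_
  have h : (A *ᵥ ξ t) ⬝ᵥ G t *ᵥ η t = ξ t ⬝ᵥ Aᵀ *ᵥ G t *ᵥ η t := by
    rw [dotProduct_mulVec (ξ t), vecMul_transpose]
  simp only [add_dotProduct, dotProduct_add, add_mulVec, mulVec_add, h, ← mulVec_mulVec]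
  ring

end OneVariable

theorem Smooth₂.dotProduct {r : ℕ} {T L : Set ℝ} {ξ η : ℝ → ℝ → Fin r → ℝ} (hξ : Smooth₂ T L ξ)
    (hη : Smooth₂ T L η) : Smooth₂ T L fun τ l => ξ τ l ⬝ᵥ η τ l :=
  ContDiffOn.sum fun j _ => ContDiffOn.mul (hξ.apply j) (hη.apply j)

theorem Smooth₂.mulVec {r : ℕ} {T L : Set ℝ} {A : ℝ → ℝ → Matrix (Fin r) (Fin r) ℝ}
    {ξ : ℝ → ℝ → Fin r → ℝ} (hA : ∀ i j, Smooth₂ T L fun τ l => A τ l i j)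
    (hξ : Smooth₂ T L ξ) : Smooth₂ T L fun τ l => A τ l *ᵥ ξ τ l :=
  Smooth₂.pi fun i => (Smooth₂.pi (hA i)).dotProduct hξ

namespace FlowPart

variable {r : ℕ} {S : FlowPart r} {T L : Set ℝ}

/-- The connection along a flow is smooth, metric, torsion-free in the directions of the flow, and
of constant curvature `χ`. -/
structure IsRegular (S : FlowPart r) (χ : ℝ) (T L : Set ℝ) : Prop where
  isOpen_T : IsOpen T
  isOpen_L : IsOpen L
  interval_L : L.OrdConnected
  smooth_metric : ∀ i j, Smooth₂ T L fun τ l => S.metric τ l i j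
  smooth_ΓX : ∀ i j, Smooth₂ T L fun τ l => S.ΓX τ l i j
  smooth_ΓY : ∀ i j, Smooth₂ T L fun τ l => S.ΓY τ l i j
  smooth_X : Smooth₂ T L S.X
  smooth_Y : Smooth₂ T L S.Y
  symm_metric : ∀ τ ∈ T, ∀ l ∈ L, (S.metric τ l)ᵀ = S.metric τ l
  metric_X : ∀ τ ∈ T, ∀ l ∈ L, ∀ i j, deriv (fun s => S.metric τ s i j) l =
    ((S.ΓX τ l)ᵀ * S.metric τ l + S.metric τ l * S.ΓX τ l) i j
  metric_Y : ∀ τ ∈ T, ∀ l ∈ L, ∀ i j, deriv (fun t => S.metric t l i j) τ =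
    ((S.ΓY τ l)ᵀ * S.metric τ l + S.metric τ l * S.ΓY τ l) i j
  torsion : ∀ τ ∈ T, ∀ l ∈ L, S.DY S.X τ l = S.DX S.Y τ l
  curvature : ∀ τ ∈ T, ∀ l ∈ L, ∀ i j,
    deriv (fun t => S.ΓX t l i j) τ - deriv (fun s => S.ΓY τ s i j) l
      + (S.ΓY τ l * S.ΓX τ l - S.ΓX τ l * S.ΓY τ l) i j
    = χ * (S.Y τ l i * (S.metric τ l *ᵥ S.X τ l) j - S.X τ l i * (S.metric τ l *ᵥ S.Y τ l) j)

section Bilinear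

variable (τ l : ℝ) (a b c : Fin r → ℝ)

theorem inner_add_left : S.inner τ l (a + b) c = S.inner τ l a c + S.inner τ l b c :=
  add_dotProduct _ _ _

theorem inner_sub_left : S.inner τ l (a - b) c = S.inner τ l a c - S.inner τ l b c :=
  sub_dotProduct _ _ _

theorem inner_smul_left (k : ℝ) : S.inner τ l (k • a) b = k * S.inner τ l a b :=
  smul_dotProduct _ _ _

theorem inner_neg_left : S.inner τ l (-a) b = -S.inner τ l a b := neg_dotProduct _ _

theorem inner_zero_left : S.inner τ l 0 b = 0 := zero_dotProduct _

theorem inner_sum_left {ι : Type*} (s : Finset ι) (f : ι → Fin r → ℝ) :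
    S.inner τ l (∑ i ∈ s, f i) b = ∑ i ∈ s, S.inner τ l (f i) b := sum_dotProduct _ _ _

end Bilinear

namespace IsRegular

variable {χ : ℝ} {ξ η : ℝ → ℝ → Fin r → ℝ} {τ l : ℝ}

theorem inner_comm (h : S.IsRegular χ T L) (hτ : τ ∈ T) (hl : l ∈ L) (a b : Fin r → ℝ) :
    S.inner τ l a b = S.inner τ l b a := by
  rw [inner, inner, dotProduct_mulVec, ← mulVec_transpose, h.symm_metric τ hτ l hl,
    dotProduct_comm]

theorem smooth_inner (h : S.IsRegular χ T L) (hξ : Smooth₂ T L ξ) (hη : Smooth₂ T L η) :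
    Smooth₂ T L fun τ l => S.inner τ l (ξ τ l) (η τ l) :=
  hξ.dotProduct (Smooth₂.mulVec h.smooth_metric hη)

theorem smooth_DX (h : S.IsRegular χ T L) (hξ : Smooth₂ T L ξ) : Smooth₂ T L (S.DX ξ) :=
  ContDiffOn.add (hξ.deriv_right h.isOpen_T h.isOpen_L) (Smooth₂.mulVec h.smooth_ΓX hξ)

theorem smooth_DY (h : S.IsRegular χ T L) (hξ : Smooth₂ T L ξ) : Smooth₂ T L (S.DY ξ) :=
  ContDiffOn.add (hξ.deriv_left h.isOpen_T h.isOpen_L) (Smooth₂.mulVec h.smooth_ΓY hξ)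

theorem hasDerivAt_inner_DX (h : S.IsRegular χ T L) (hξ : Smooth₂ T L ξ) (hη : Smooth₂ T L η)
    (hτ : τ ∈ T) (hl : l ∈ L) : HasDerivAt (fun s => S.inner τ s (ξ τ s) (η τ s))
      (S.inner τ l (S.DX ξ τ l) (η τ l) + S.inner τ l (ξ τ l) (S.DX η τ l)) l := by
  refine hasDerivAt_inner (fun i j => ?_) (hξ.hasDerivAt_right h.isOpen_T h.isOpen_L hτ hl)
    (hη.hasDerivAt_right h.isOpen_T h.isOpen_L hτ hl)
  rw [← h.metric_X τ hτ l hl]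
  exact (h.smooth_metric i j).hasDerivAt_right h.isOpen_T h.isOpen_L hτ hl

theorem hasDerivAt_inner_DY (h : S.IsRegular χ T L) (hξ : Smooth₂ T L ξ) (hη : Smooth₂ T L η)
    (hτ : τ ∈ T) (hl : l ∈ L) : HasDerivAt (fun t => S.inner t l (ξ t l) (η t l))
      (S.inner τ l (S.DY ξ τ l) (η τ l) + S.inner τ l (ξ τ l) (S.DY η τ l)) τ := by
  refine hasDerivAt_inner (G := fun t => S.metric t l) (ξ := fun t => ξ t l)
    (η := fun t => η t l) (fun i j => ?_) (hξ.hasDerivAt_left h.isOpen_T h.isOpen_L hτ hl)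
    (hη.hasDerivAt_left h.isOpen_T h.isOpen_L hτ hl)
  rw [← h.metric_Y τ hτ l hl]
  exact (h.smooth_metric i j).hasDerivAt_left h.isOpen_T h.isOpen_L hτ hl

theorem inner_DX_of_const (h : S.IsRegular χ T L) (hξ : Smooth₂ T L ξ) (hη : Smooth₂ T L η)
    {c : ℝ} (hc : ∀ τ ∈ T, ∀ l ∈ L, S.inner τ l (ξ τ l) (η τ l) = c) (hτ : τ ∈ T) (hl : l ∈ L) :
    S.inner τ l (S.DX ξ τ l) (η τ l) + S.inner τ l (ξ τ l) (S.DX η τ l) = 0 := by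
  refine (h.hasDerivAt_inner_DX hξ hη hτ hl).unique ((hasDerivAt_const l c).congr_of_eventuallyEq ?_)
  filter_upwards [h.isOpen_L.mem_nhds hl] with s hs using hc τ hτ s hs

theorem inner_DY_of_const (h : S.IsRegular χ T L) (hξ : Smooth₂ T L ξ) (hη : Smooth₂ T L η)
    {c : ℝ} (hc : ∀ τ ∈ T, ∀ l ∈ L, S.inner τ l (ξ τ l) (η τ l) = c) (hτ : τ ∈ T) (hl : l ∈ L) :
    S.inner τ l (S.DY ξ τ l) (η τ l) + S.inner τ l (ξ τ l) (S.DY η τ l) = 0 := by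
  refine (h.hasDerivAt_inner_DY hξ hη hτ hl).unique ((hasDerivAt_const τ c).congr_of_eventuallyEq ?_)
  filter_upwards [h.isOpen_T.mem_nhds hτ] with t ht using hc t ht l hl

/-- Mixed partials of `ξ` and first-order terms cancel, leaving the curvature matrix applied to `ξ`.
Curvature enters the flow equations through this identity alone. -/
theorem commutator (h : S.IsRegular χ T L) (hξ : Smooth₂ T L ξ) (hτ : τ ∈ T) (hl : l ∈ L) :
    S.DY (S.DX ξ) τ l = S.DX (S.DY ξ) τ l + χ • (S.inner τ l (S.X τ l) (ξ τ l) • S.Y τ l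
      - S.inner τ l (S.Y τ l) (ξ τ l) • S.X τ l) := by
  have hT := h.isOpen_T
  have hL := h.isOpen_L
  have h1 : deriv (fun t => S.DX ξ t l) τ = _ :=
    (((hξ.deriv_right hT hL).hasDerivAt_left hT hL hτ hl).add
      (hasDerivAt_mulVec (A := fun t => S.ΓX t l) (ξ := fun t => ξ t l)
        (A' := Matrix.of fun i j => deriv (fun t => S.ΓX t l i j) τ)
        (fun i j => (h.smooth_ΓX i j).hasDerivAt_left hT hL hτ hl)
        (hξ.hasDerivAt_left hT hL hτ hl))).deriv
  have h2 : deriv (fun s => S.DY ξ τ s) l = _ :=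
    (((hξ.deriv_left hT hL).hasDerivAt_right hT hL hτ hl).add
      (hasDerivAt_mulVec (A := fun s => S.ΓY τ s) (ξ := fun s => ξ τ s)
        (A' := Matrix.of fun i j => deriv (fun s => S.ΓY τ s i j) l)
        (fun i j => (h.smooth_ΓY i j).hasDerivAt_right hT hL hτ hl)
        (hξ.hasDerivAt_right hT hL hτ hl))).deriv
  have h3 : (Matrix.of fun i j => deriv (fun t => S.ΓX t l i j) τ)
      = (Matrix.of fun i j => deriv (fun s => S.ΓY τ s i j) l)
        - S.ΓY τ l * S.ΓX τ l + S.ΓX τ l * S.ΓY τ l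
        + χ • (vecMulVec (S.Y τ l) (S.metric τ l *ᵥ S.X τ l)
          - vecMulVec (S.X τ l) (S.metric τ l *ᵥ S.Y τ l)) := by
    ext i j
    have := h.curvature τ hτ l hl i j
    simp only [Matrix.sub_apply, of_apply, Matrix.add_apply, Matrix.smul_apply, vecMulVec_apply,
      smul_eq_mul] at this ⊢
    linarith
  have h4 : ∀ a b : Fin r → ℝ, vecMulVec a (S.metric τ l *ᵥ b) *ᵥ ξ τ l
      = S.inner τ l b (ξ τ l) • a := by
    intro a b
    rw [vecMulVec_mulVec, h.inner_comm hτ hl, inner, dotProduct_comm]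
    simp
  have e1 : S.DY (S.DX ξ) τ l = deriv (fun t => S.DX ξ t l) τ + S.ΓY τ l *ᵥ S.DX ξ τ l := rfl
  have e2 : S.DX (S.DY ξ) τ l = deriv (fun s => S.DY ξ τ s) l + S.ΓX τ l *ᵥ S.DY ξ τ l := rfl
  rw [e1, e2, h1, h2, hξ.deriv_comm hT hL hτ hl, h3]
  simp only [DX, DY, add_mulVec, sub_mulVec, smul_mulVec, mulVec_add, h4, ← mulVec_mulVec]
  module

end IsRegular

end FlowPart

end CurveFlow

open scoped ContDiff

namespace CurveFlow

open Finset Matrix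

theorem exists_rotation {N : ℕ} {T L : Set ℝ} (hL : IsOpen L) (hL' : L.OrdConnected)
    {A : ℝ → ℝ → Matrix (Fin N) (Fin N) ℝ} (hA : ∀ τ ∈ T, ∀ l ∈ L, (A τ l)ᵀ = -A τ l)
    (hd : ∀ τ ∈ T, ∀ l ∈ L, ∀ i j, HasDerivAt (fun s => A τ s i j) 0 l) :
    ∃ C : ℝ → Matrix (Fin N) (Fin N) ℝ, (∀ τ, (C τ)ᵀ = -C τ) ∧ ∀ τ ∈ T, ∀ l ∈ L, A τ l = C τ := by
  classical
  rcases L.eq_empty_or_nonempty with rfl | ⟨l₀, hl₀⟩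
  · exact ⟨0, by simp, by simp⟩
  -- The value `0` outside `T` keeps `C` skew for every `τ`.
  refine ⟨fun τ => if τ ∈ T then A τ l₀ else 0, fun τ => ?_, fun τ hτ l hl => ?_⟩
  · by_cases hτ : τ ∈ T
    · simpa [hτ] using hA τ hτ l₀ hl₀
    · simp [hτ]
  · ext i j
    simp only [if_pos hτ]
    refine hL.is_const_of_deriv_eq_zero hL'.isPreconnected (f := fun s => A τ s i j)
      (fun s hs => (hd τ hτ s hs i j).differentiableAt.differentiableWithinAt)
      (fun s hs => (hd τ hτ s hs i j).deriv) hl hl₀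

namespace FlowPart

/-! ## Parallel frames -/

section Frame

variable {N : ℕ} {S : FlowPart (N + 1)} {T L : Set ℝ} {χ : ℝ}
  {E : ℝ → ℝ → Fin (N + 1) → Fin (N + 1) → ℝ} {τ l : ℝ}

/-- The `i`-th normal vector of a frame. -/
def normalVec (E : ℝ → ℝ → Fin (N + 1) → Fin (N + 1) → ℝ) (i : Fin N) : ℝ → ℝ → Fin (N + 1) → ℝ :=
  fun τ l => E τ l i.succ

namespace IsParallelFrame

theorem smooth_normalVec (hE : S.IsParallelFrame T L E) (i : Fin N) :
    Smooth₂ T L (normalVec E i) :=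
  contDiffOn_pi.1 hE.smooth i.succ

theorem inner_X_X (hE : S.IsParallelFrame T L E) (hτ : τ ∈ T) (hl : l ∈ L) :
    S.inner τ l (S.X τ l) (S.X τ l) = 1 := by
  simpa [hE.tangent τ hτ l hl] using hE.orthonormal τ hτ l hl 0 0

theorem inner_normalVec_X (hE : S.IsParallelFrame T L E) (hτ : τ ∈ T) (hl : l ∈ L) (i : Fin N) :
    S.inner τ l (normalVec E i τ l) (S.X τ l) = 0 := by
  simpa [hE.tangent τ hτ l hl, normalVec] using hE.orthonormal τ hτ l hl i.succ 0

theorem inner_X_normalVec (hE : S.IsParallelFrame T L E) (hτ : τ ∈ T) (hl : l ∈ L) (i : Fin N) :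
    S.inner τ l (S.X τ l) (normalVec E i τ l) = 0 := by
  have := hE.orthonormal τ hτ l hl 0 i.succ
  rwa [hE.tangent τ hτ l hl, if_neg (Fin.succ_ne_zero i).symm] at this

theorem inner_normalVec (hE : S.IsParallelFrame T L E) (hτ : τ ∈ T) (hl : l ∈ L) (i j : Fin N) :
    S.inner τ l (normalVec E i τ l) (normalVec E j τ l) = if i = j then 1 else 0 := by
  simpa [normalVec] using hE.orthonormal τ hτ l hl i.succ j.succ

theorem DX_normalVec (hE : S.IsParallelFrame T L E) (hτ : τ ∈ T) (hl : l ∈ L) (i : Fin N) :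
    S.DX (normalVec E i) τ l = -S.normal E τ l i • S.X τ l :=
  hE.parallel τ hτ l hl i

/-- Expansion of a vector in an orthonormal frame. -/
theorem expansion (hE : S.IsParallelFrame T L E) (hτ : τ ∈ T) (hl : l ∈ L) (w : Fin (N + 1) → ℝ) :
    w = S.inner τ l w (S.X τ l) • S.X τ l
      + ∑ i, S.inner τ l w (normalVec E i τ l) • normalVec E i τ l := by
  have h1 : Matrix.of (E τ l) * (S.metric τ l * (Matrix.of (E τ l))ᵀ) = 1 := by
    ext i j
    rw [Matrix.one_apply, ← hE.orthonormal τ hτ l hl i j]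
    rfl
  -- Orthonormality reads `E (G Eᵀ) = 1`; for square matrices this gives `(G Eᵀ) E = 1` as well.
  have h2 : w = (w ᵥ* (S.metric τ l * (Matrix.of (E τ l))ᵀ)) ᵥ* Matrix.of (E τ l) := by
    rw [vecMul_vecMul, _root_.mul_eq_one_comm.1 h1, vecMul_one]
  have h4 : w = ∑ i, S.inner τ l w (E τ l i) • E τ l i := by
    conv_lhs => rw [h2]
    ext k
    rw [Finset.sum_apply]
    rfl
  rw [Fin.sum_univ_succ, hE.tangent τ hτ l hl] at h4
  exact h4

theorem parseval (hE : S.IsParallelFrame T L E) (hτ : τ ∈ T) (hl : l ∈ L)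
    (a w : Fin (N + 1) → ℝ) :
    S.inner τ l a w = S.inner τ l a (S.X τ l) * S.inner τ l (S.X τ l) w
      + ∑ i, S.inner τ l a (normalVec E i τ l) * S.inner τ l (normalVec E i τ l) w := by
  conv_lhs => rw [hE.expansion hτ hl a]
  simp only [inner_add_left, inner_sum_left, inner_smul_left]

theorem ext_iff (hE : S.IsParallelFrame T L E) (hτ : τ ∈ T) (hl : l ∈ L)
    {a w : Fin (N + 1) → ℝ} : a = w ↔ S.inner τ l a (S.X τ l) = S.inner τ l w (S.X τ l) ∧
      ∀ i, S.inner τ l a (normalVec E i τ l) = S.inner τ l w (normalVec E i τ l) := by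
  refine ⟨fun h => h ▸ ⟨rfl, fun _ => rfl⟩, fun ⟨h0, hi⟩ => ?_⟩
  rw [hE.expansion hτ hl a, hE.expansion hτ hl w, h0]
  simp only [hi]

end IsParallelFrame

namespace IsRegular

theorem inner_DX_X (h : S.IsRegular χ T L) (hE : S.IsParallelFrame T L E) (hτ : τ ∈ T)
    (hl : l ∈ L) : S.inner τ l (S.DX S.X τ l) (S.X τ l) = 0 := by
  have := h.inner_DX_of_const h.smooth_X h.smooth_X (fun τ hτ l hl => hE.inner_X_X hτ hl) hτ hl
  rw [h.inner_comm hτ hl (S.X τ l)] at this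
  linarith

theorem inner_DY_X (h : S.IsRegular χ T L) (hE : S.IsParallelFrame T L E) (hτ : τ ∈ T)
    (hl : l ∈ L) : S.inner τ l (S.DY S.X τ l) (S.X τ l) = 0 := by
  have := h.inner_DY_of_const h.smooth_X h.smooth_X (fun τ hτ l hl => hE.inner_X_X hτ hl) hτ hl
  rw [h.inner_comm hτ hl (S.X τ l)] at this
  linarith

theorem inner_DY_normalVec_X (h : S.IsRegular χ T L) (hE : S.IsParallelFrame T L E) (hτ : τ ∈ T)
    (hl : l ∈ L) (i : Fin N) :
    S.inner τ l (S.DY (normalVec E i) τ l) (S.X τ l) = -S.flowNormal E τ l i := by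
  have := h.inner_DY_of_const (hE.smooth_normalVec i) h.smooth_X
    (fun τ hτ l hl => hE.inner_normalVec_X hτ hl i) hτ hl
  rw [h.inner_comm hτ hl (normalVec E i τ l)] at this
  exact eq_neg_of_add_eq_zero_left this

theorem flowRot_skew (h : S.IsRegular χ T L) (hE : S.IsParallelFrame T L E) (hτ : τ ∈ T)
    (hl : l ∈ L) : (S.flowRot E τ l)ᵀ = -S.flowRot E τ l := by
  ext i j
  have := h.inner_DY_of_const (hE.smooth_normalVec j) (hE.smooth_normalVec i)
    (fun τ hτ l hl => hE.inner_normalVec hτ hl j i) hτ hl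
  rw [h.inner_comm hτ hl (normalVec E j τ l)] at this
  exact eq_neg_of_add_eq_zero_left this

/-- Vanishing torsion gives `D_X Y = D_Y X`, which is orthogonal to the unit vector `X`; only `⟨Y,
D_X X⟩` remains. -/
theorem hasDerivAt_ePar (h : S.IsRegular χ T L) (hE : S.IsParallelFrame T L E) (hτ : τ ∈ T)
    (hl : l ∈ L) : HasDerivAt (S.ePar τ) (S.normal E τ l ⬝ᵥ S.ePerp E τ l) l := by
  refine (h.hasDerivAt_inner_DX h.smooth_Y h.smooth_X hτ hl).congr_deriv ?_
  rw [← h.torsion τ hτ l hl, h.inner_DY_X hE hτ hl, zero_add, h.inner_comm hτ hl,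
    hE.parseval hτ hl, h.inner_DX_X hE hτ hl, zero_mul, zero_add]
  exact Finset.sum_congr rfl fun i _ => by rw [h.inner_comm hτ hl (normalVec E i τ l)]; rfl

theorem hasDerivAt_ePerp (h : S.IsRegular χ T L) (hE : S.IsParallelFrame T L E) (hτ : τ ∈ T)
    (hl : l ∈ L) :
    HasDerivAt (S.ePerp E τ) (S.flowNormal E τ l - S.ePar τ l • S.normal E τ l) l := by
  refine hasDerivAt_pi.2 fun i => ?_
  refine (h.hasDerivAt_inner_DX h.smooth_Y (hE.smooth_normalVec i) hτ hl).congr_deriv ?_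
  rw [← h.torsion τ hτ l hl, hE.DX_normalVec hτ hl, h.inner_comm hτ hl (S.Y τ l), inner_smul_left,
    h.inner_comm hτ hl (S.X τ l)]
  change S.flowNormal E τ l i + _ * S.ePar τ l = S.flowNormal E τ l i - S.ePar τ l * _
  ring

theorem jAlong (h : S.IsRegular χ T L) (hE : S.IsParallelFrame T L E) :
    JAlong T L (S.normal E) (S.ePerp E) S.ePar (S.flowNormal E) :=
  fun _ hτ _ hl => ⟨h.hasDerivAt_ePar hE hτ hl, h.hasDerivAt_ePerp hE hτ hl⟩

/-- Differentiate `⟨D_X E_i, E_j⟩ = 0` in the flow direction and commute the derivatives. On `E_i`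
the curvature term is a multiple of `X`, hence orthogonal to `E_j`, so `χ` drops out. -/
theorem hasDerivAt_flowRot (h : S.IsRegular χ T L) (hE : S.IsParallelFrame T L E) (hτ : τ ∈ T)
    (hl : l ∈ L) (i j : Fin N) : HasDerivAt (fun s => S.flowRot E τ s i j)
      (-wedge (S.normal E τ l) (S.flowNormal E τ l) i j) l := by
  refine (h.hasDerivAt_inner_DX (h.smooth_DY (hE.smooth_normalVec i)) (hE.smooth_normalVec j)
    hτ hl).congr_deriv ?_
  have h0 : ∀ τ ∈ T, ∀ l ∈ L, S.inner τ l (S.DX (normalVec E i) τ l) (normalVec E j τ l) = 0 :=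
    fun τ hτ l hl => by
      rw [hE.DX_normalVec hτ hl, inner_smul_left, hE.inner_X_normalVec hτ hl, mul_zero]
  have h1 := h.inner_DY_of_const (h.smooth_DX (hE.smooth_normalVec i)) (hE.smooth_normalVec j) h0
    hτ hl
  rw [h.commutator (hE.smooth_normalVec i) hτ hl, hE.inner_X_normalVec hτ hl,
    hE.DX_normalVec hτ hl] at h1
  simp only [inner_add_left, inner_smul_left, inner_sub_left, hE.inner_X_normalVec hτ hl,
    h.inner_comm hτ hl (S.X τ l) (S.DY _ _ _), h.inner_DY_normalVec_X hE hτ hl] at h1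
  rw [hE.DX_normalVec hτ hl, h.inner_comm hτ hl (S.DY _ _ _), inner_smul_left,
    h.inner_comm hτ hl (S.X τ l) (S.DY _ _ _), h.inner_DY_normalVec_X hE hτ hl]
  simp only [wedge, Matrix.sub_apply, vecMulVec_apply]
  linarith

theorem smooth_normal (h : S.IsRegular χ T L) (hE : S.IsParallelFrame T L E) (i : Fin N) :
    Smooth₂ T L fun τ l => S.normal E τ l i :=
  h.smooth_inner (h.smooth_DX h.smooth_X) (hE.smooth_normalVec i)

theorem smooth_flowNormal (h : S.IsRegular χ T L) (hE : S.IsParallelFrame T L E) :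
    Smooth₂ T L (S.flowNormal E) :=
  Smooth₂.pi fun i => h.smooth_inner (h.smooth_DY h.smooth_X) (hE.smooth_normalVec i)

/-- Differentiate `⟨D_X X, E_i⟩` along the flow: commuting derivatives on `X` produces `ϖ_l` and the
curvature term `χ e_⊥`, while the motion of `E_i` contributes the rotation `Θ`. -/
theorem hasDerivAt_normal (h : S.IsRegular χ T L) (hE : S.IsParallelFrame T L E) (hτ : τ ∈ T)
    (hl : l ∈ L) : HasDerivAt (fun t => S.normal E t l)
      (deriv (S.flowNormal E τ) l - S.normal E τ l ᵥ* S.flowRot E τ l + χ • S.ePerp E τ l) τ := by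
  have hs : ∀ i j, S.flowRot E τ l i j = -S.flowRot E τ l j i := fun i j =>
    congrFun (congrFun (h.flowRot_skew hE hτ hl) j) i
  refine hasDerivAt_pi.2 fun i => ?_
  refine (h.hasDerivAt_inner_DY (h.smooth_DX h.smooth_X) (hE.smooth_normalVec i)
    hτ hl).congr_deriv ?_
  have h1 := (h.hasDerivAt_inner_DX (h.smooth_DY h.smooth_X) (hE.smooth_normalVec i) hτ hl).unique
    (hasDerivAt_pi.1 ((h.smooth_flowNormal hE).hasDerivAt_right h.isOpen_T h.isOpen_L hτ hl) i)
  rw [hE.DX_normalVec hτ hl, h.inner_comm hτ hl _ (_ • _), inner_smul_left,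
    h.inner_comm hτ hl (S.X τ l), h.inner_DY_X hE hτ hl, mul_zero, add_zero] at h1
  rw [h.commutator h.smooth_X hτ hl, hE.parseval hτ hl (S.DX S.X τ l), h.inner_DX_X hE hτ hl,
    inner_add_left, h1, inner_smul_left, inner_sub_left, inner_smul_left, inner_smul_left,
    hE.inner_X_X hτ hl, hE.inner_X_normalVec hτ hl]
  have h2 : ∑ j, S.inner τ l (S.DX S.X τ l) (normalVec E j τ l)
      * S.inner τ l (normalVec E j τ l) (S.DY (normalVec E i) τ l)
      = -(S.normal E τ l ᵥ* S.flowRot E τ l) i := by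
    rw [vecMul, dotProduct, ← Finset.sum_neg_distrib]
    refine Finset.sum_congr rfl fun j _ => ?_
    rw [hs j i, h.inner_comm hτ hl (normalVec E j τ l), mul_neg, neg_neg]
    rfl
  rw [h2]
  simp only [Pi.add_apply, Pi.sub_apply, Pi.smul_apply, smul_eq_mul]
  change _ + χ * (1 * S.ePerp E τ l i - _) + _ = _
  ring

/-- If `ϖ = w` and `Θ` has the skew antiderivative `A` of `-v ∧ w` as its nonconstant part, then
`v_τ` is determined up to the rotation of the frame. -/
theorem exists_flowEquation (h : S.IsRegular χ T L) (hE : S.IsParallelFrame T L E)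
    {w : ℝ → ℝ → Fin N → ℝ} (hw : ∀ τ ∈ T, ∀ l ∈ L, S.flowNormal E τ l = w τ l)
    {A : ℝ → ℝ → Matrix (Fin N) (Fin N) ℝ} (hA : ∀ τ ∈ T, ∀ l ∈ L, (A τ l)ᵀ = -A τ l)
    (hA' : ∀ τ ∈ T, ∀ l ∈ L, ∀ i j,
      HasDerivAt (fun s => A τ s i j) (-wedge (S.normal E τ l) (w τ l) i j) l)
    {u : ℝ → ℝ → Fin N → ℝ} (hu : ∀ τ ∈ T, ∀ l ∈ L, HasDerivAt (w τ)
      (u τ l - χ • S.ePerp E τ l + S.normal E τ l ᵥ* A τ l) l) :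
    ∃ C, (∀ τ ∈ T, ∀ l ∈ L, S.flowRot E τ l = A τ l - C τ) ∧
      FlowEquation T L (S.normal E) u C := by
  -- Both `A` and `Θ` are skew with derivative `-v∧ϖ`, so their difference is constant along each
  -- curve.
  obtain ⟨C, hC, hC'⟩ := exists_rotation (T := T) h.isOpen_L h.interval_L
    (A := fun τ l => A τ l - S.flowRot E τ l)
    (fun τ hτ l hl => by
      rw [transpose_sub, hA τ hτ l hl, h.flowRot_skew hE hτ hl, neg_sub_neg, neg_sub])
    (fun τ hτ l hl i j => ((hA' τ hτ l hl i j).sub (h.hasDerivAt_flowRot hE hτ hl i j)).congr_deriv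
      (by rw [hw τ hτ l hl, sub_self]))
  have hC'' : ∀ τ ∈ T, ∀ l ∈ L, S.flowRot E τ l = A τ l - C τ := fun τ hτ l hl => by
    rw [← hC' τ hτ l hl, sub_sub_cancel]
  refine ⟨C, hC'', hC, fun τ hτ l hl => (h.hasDerivAt_normal hE hτ hl).congr_deriv ?_⟩
  have hd : deriv (S.flowNormal E τ) l = deriv (w τ) l := by
    apply Filter.EventuallyEq.deriv_eq
    filter_upwards [h.isOpen_L.mem_nhds hl] with s hs using hw τ hτ s hs
  rw [hd, (hu τ hτ l hl).deriv, hC'' τ hτ l hl, vecMul_sub]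
  module

end IsRegular

end Frame

end FlowPart

end CurveFlow

open scoped ContDiff

namespace CurveFlow

open Finset Matrix

namespace FlowPart

/-! ## Map operators and the flow equations -/

variable {N : ℕ} {S : FlowPart (N + 1)} {T L : Set ℝ} {χ : ℝ}
  {E : ℝ → ℝ → Fin (N + 1) → Fin (N + 1) → ℝ} {τ l : ℝ}

namespace IsRegular

theorem smooth_iterate_DX (h : S.IsRegular χ T L) (j : ℕ) : Smooth₂ T L ((S.DX)^[j] S.X) := by
  induction j with
  | zero => exact h.smooth_X
  | succ j ih => rw [Function.iterate_succ_apply']; exact h.smooth_DX ih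

theorem hasDerivAt_eval_normal (h : S.IsRegular χ T L) (hE : S.IsParallelFrame T L E)
    (hτ : τ ∈ T) (hl : l ∈ L) (P : Jet N) : HasDerivAt (fun s => jetEvalHom (S.normal E τ) s P)
      (jetEvalHom (S.normal E τ) l (totalD N P)) l :=
  hasDerivAt_jetEvalHom h.isOpen_L (fun i => (h.smooth_normal hE i).right hτ) hl P

/-- In a parallel frame, `D_X` acts on components by the recursion defining `frameJet`. The claim is
made at all points at once because the induction hypothesis is differentiated along the curve. -/
theorem inner_iterate_DX (h : S.IsRegular χ T L) (hE : S.IsParallelFrame T L E) (j : ℕ) :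
    ∀ τ ∈ T, ∀ l ∈ L,
      S.inner τ l ((S.DX)^[j] S.X τ l) (S.X τ l) = jetEvalHom (S.normal E τ) l (frameJet N j).1 ∧
      ∀ i, S.inner τ l ((S.DX)^[j] S.X τ l) (normalVec E i τ l)
        = jetEvalHom (S.normal E τ) l ((frameJet N j).2 i) := by
  induction j with
  | zero =>
    intro τ hτ l hl
    simp [frameJet, hE.inner_X_X hτ hl, hE.inner_X_normalVec hτ hl]
  | succ j ih =>
    intro τ hτ l hl
    have hs := h.smooth_iterate_DX j
    obtain ⟨h0, hi⟩ := ih τ hτ l hl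
    have e0 := (h.hasDerivAt_inner_DX hs h.smooth_X hτ hl).unique
      ((h.hasDerivAt_eval_normal hE hτ hl (frameJet N j).1).congr_of_eventuallyEq
        (by filter_upwards [h.isOpen_L.mem_nhds hl] with s hs using (ih τ hτ s hs).1))
    have e1 : ∀ i, _ := fun i =>
      (h.hasDerivAt_inner_DX hs (hE.smooth_normalVec i) hτ hl).unique
      ((h.hasDerivAt_eval_normal hE hτ hl ((frameJet N j).2 i)).congr_of_eventuallyEq
        (by filter_upwards [h.isOpen_L.mem_nhds hl] with s hs using (ih τ hτ s hs).2 i))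
    have e2 : S.inner τ l ((S.DX)^[j] S.X τ l) (S.DX S.X τ l)
        = jetEvalHom (S.normal E τ) l (jetV N ⬝ᵥ (frameJet N j).2) := by
      rw [hE.parseval hτ hl, h.inner_comm hτ hl (S.X τ l), h.inner_DX_X hE hτ hl, mul_zero,
        zero_add, jetEvalHom_dot]
      refine Finset.sum_congr rfl fun i _ => ?_
      simp only [hi, h.inner_comm hτ hl (normalVec E i τ l), jetEvalHom_jetV]
      exact mul_comm _ _
    simp only [Function.iterate_succ_apply']
    refine ⟨?_, fun i => ?_⟩
    · rw [frameJet, map_sub, ← e0, ← e2]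
      ring
    · have := e1 i
      rw [hE.DX_normalVec hτ hl, h.inner_comm hτ hl ((S.DX)^[j] S.X τ l) (_ • _), inner_smul_left,
        h.inner_comm hτ hl (S.X τ l), h0] at this
      simp only [frameJet, Pi.add_apply, Pi.smul_apply, smul_eq_mul, map_add, map_mul,
        jetEvalHom_jetV, vecD]
      rw [← this]
      ring

theorem eval_inner (h : S.IsRegular χ T L) (hE : S.IsParallelFrame T L E) (hτ : τ ∈ T)
    (hl : l ∈ L) (c : MvPolynomial (ℕ × ℕ) ℝ) :
    MvPolynomial.eval (fun ab : ℕ × ℕ =>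
      S.inner τ l ((S.DX)^[ab.1] S.X τ l) ((S.DX)^[ab.2] S.X τ l)) c
      = jetEvalHom (S.normal E τ) l (innerJet N c) := by
  induction c using MvPolynomial.induction_on with
  | C a =>
    rw [innerJet, MvPolynomial.algHom_C, MvPolynomial.eval_C, MvPolynomial.algebraMap_eq]
    exact (MvPolynomial.eval_C a).symm
  | add p q hp hq => simp only [map_add, hp, hq]
  | mul_X p ab hp =>
    obtain ⟨a, b⟩ := ab
    rw [map_mul, map_mul, map_mul, hp, MvPolynomial.eval_X, innerJet_X, hE.parseval hτ hl,
      map_add, map_mul, jetEvalHom_dot, h.inner_comm hτ hl (S.X τ l)]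
    obtain ⟨ha, ha'⟩ := h.inner_iterate_DX hE a τ hτ l hl
    obtain ⟨hb, hb'⟩ := h.inner_iterate_DX hE b τ hτ l hl
    simp only [ha, ha', hb, h.inner_comm hτ hl (normalVec E _ τ l), hb']
    rfl

theorem inner_mapEval_X (h : S.IsRegular χ T L) (hE : S.IsParallelFrame T L E) (hτ : τ ∈ T)
    (hl : l ∈ L) (f : MapOperator) : S.inner τ l (S.mapEval f τ l) (S.X τ l)
      = jetEvalHom (S.normal E τ) l (opPar N f) := by
  rw [mapEval, Finsupp.sum, inner_sum_left, opPar, Finsupp.sum, map_sum]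
  refine Finset.sum_congr rfl fun j _ => ?_
  rw [inner_smul_left, h.eval_inner hE hτ hl, (h.inner_iterate_DX hE j τ hτ l hl).1, map_mul]

theorem inner_mapEval_normalVec (h : S.IsRegular χ T L) (hE : S.IsParallelFrame T L E)
    (hτ : τ ∈ T) (hl : l ∈ L) (f : MapOperator) (i : Fin N) :
    S.inner τ l (S.mapEval f τ l) (normalVec E i τ l)
      = jetEvalHom (S.normal E τ) l (opNormal N f i) := by
  rw [mapEval, Finsupp.sum, inner_sum_left, opNormal, Finsupp.sum, Finset.sum_apply, map_sum]
  refine Finset.sum_congr rfl fun j _ => ?_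
  rw [inner_smul_left, h.eval_inner hE hτ hl, (h.inner_iterate_DX hE j τ hτ l hl).2, Pi.smul_apply,
    smul_eq_mul, map_mul]

theorem isMapFlow_iff (h : S.IsRegular χ T L) (hE : S.IsParallelFrame T L E) (f : MapOperator) :
    S.IsMapFlow f T L ↔ ∀ τ ∈ T, ∀ l ∈ L,
      S.ePar τ l = -jetEval (opPar N f) (S.normal E τ) l ∧
      ∀ i, S.ePerp E τ l i = -jetEval (opNormal N f i) (S.normal E τ) l := by
  refine forall₂_congr fun τ hτ => forall₂_congr fun l hl => ?_
  rw [hE.ext_iff hτ hl, h.inner_mapEval_X hE hτ hl]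
  simp only [h.inner_mapEval_normalVec hE hτ hl, inner_neg_left, neg_eq_iff_eq_neg]
  rfl

theorem isConvectiveMap_iff (hE : S.IsParallelFrame T L E) :
    S.IsConvectiveMap T L ↔ ∀ τ ∈ T, ∀ l ∈ L, S.ePar τ l = 1 ∧ S.ePerp E τ l = 0 := by
  refine forall₂_congr fun τ hτ => forall₂_congr fun l hl => ?_
  rw [hE.ext_iff hτ hl, hE.inner_X_X hτ hl, funext_iff]
  simp only [hE.inner_X_normalVec hτ hl]
  rfl

theorem isWaveMap_iff_flowNormal (h : S.IsRegular χ T L) (hE : S.IsParallelFrame T L E) :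
    S.IsWaveMap T L ↔ ∀ τ ∈ T, ∀ l ∈ L, S.flowNormal E τ l = 0 := by
  refine forall₂_congr fun τ hτ => forall₂_congr fun l hl => ?_
  rw [hE.ext_iff hτ hl, h.inner_DY_X hE hτ hl, funext_iff]
  simp only [inner_zero_left, true_and]
  rfl

/-- The wave equation is `ϖ = 0`. The `ℋ` half of the kernel condition is trivial, and conversely
the two values of the derivative of `e_⊥` are compared. -/
theorem isWaveMap_iff (h : S.IsRegular χ T L) (hE : S.IsParallelFrame T L E) :
    S.IsWaveMap T L ↔ InRecursionKernel T L (S.normal E) (S.ePerp E) S.ePar := by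
  rw [h.isWaveMap_iff_flowNormal hE]
  constructor
  · refine fun hw => ⟨fun τ hτ l hl => ?_, fun τ hτ l hl => ⟨fun i j => ?_, ?_⟩⟩
    · have := h.jAlong hE τ hτ l hl
      rwa [hw τ hτ l hl] at this
    · simpa [wedge] using hasDerivAt_const l (0 : ℝ)
    · simp
  · intro hw τ hτ l hl
    have := (h.jAlong hE τ hτ l hl).2.unique (hw.1 τ hτ l hl).2
    simpa using this

theorem exists_flowEquation_convective (h : S.IsRegular χ T L) (hE : S.IsParallelFrame T L E)
    (hY : S.IsConvectiveMap T L) :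
    ∃ C, (∀ τ ∈ T, ∀ l ∈ L, S.flowRot E τ l = -C τ) ∧
      FlowEquation T L (S.normal E)
        (fun τ l i => jetEval (vecD (jetV N) i) (S.normal E τ) l) C := by
  rw [isConvectiveMap_iff hE] at hY
  have hw : ∀ τ ∈ T, ∀ l ∈ L, S.flowNormal E τ l = S.normal E τ l := by
    intro τ hτ l hl
    have h0 : HasDerivAt (S.ePerp E τ) 0 l := by
      refine (hasDerivAt_const l (0 : Fin N → ℝ)).congr_of_eventuallyEq ?_
      filter_upwards [h.isOpen_L.mem_nhds hl] with s hs using (hY τ hτ s hs).2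
    have := (h.jAlong hE τ hτ l hl).2.unique h0
    rwa [(hY τ hτ l hl).1, one_smul, sub_eq_zero] at this
  -- Here `ϖ = v`, so `v∧ϖ = 0` and zero is an admissible antiderivative.
  obtain ⟨C, hC, hC'⟩ := h.exists_flowEquation hE hw (A := 0) (by simp)
    (fun τ _ l _ i j => by simpa [wedge] using hasDerivAt_const l (0 : ℝ))
    (u := fun τ l i => jetEval (vecD (jetV N) i) (S.normal E τ) l) fun τ hτ l hl => by
      refine hasDerivAt_pi.2 fun i => ?_
      have := h.hasDerivAt_eval_normal hE hτ hl (jetV N i)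
      simp only [jetEvalHom_jetV] at this
      refine this.congr_deriv ?_
      simp [(hY τ hτ l hl).2, vecD, jetEval_eq_hom]
  exact ⟨C, fun τ hτ l hl => by simpa using hC τ hτ l hl, hC'⟩

theorem exists_flowEquation_wave (h : S.IsRegular χ T L) (hE : S.IsParallelFrame T L E)
    (hY : S.IsWaveMap T L) :
    ∃ C, (∀ τ ∈ T, ∀ l ∈ L, S.flowRot E τ l = -C τ) ∧
      FlowEquation T L (S.normal E) (fun τ l => χ • S.ePerp E τ l) C := by
  obtain ⟨C, hC, hC'⟩ := h.exists_flowEquation hE (w := 0)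
    ((h.isWaveMap_iff_flowNormal hE).1 hY) (A := 0) (by simp)
    (fun τ _ l _ i j => by simpa [wedge] using hasDerivAt_const l (0 : ℝ))
    (u := fun τ l => χ • S.ePerp E τ l) fun τ _ l _ => by
      simp
  exact ⟨C, fun τ hτ l hl => by simpa using hC τ hτ l hl, hC'⟩

/-- With `e_⊥ = -K_k` and `e_∥ = -D⁻¹(v·K_k)`, the relation `ϖ = 𝒥(e_⊥)` gives minus the next
covector. Then `Θ` is its rotation potential up to `C(τ)`, and `ℋ` gives `-K_{k+1}`. -/
theorem exists_flowEquation_map (h : S.IsRegular χ T L) (hE : S.IsParallelFrame T L E) (k : ℕ)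
    (hY : S.IsMapFlow (hierMap N k) T L) :
    ∃ C, (∀ τ ∈ T, ∀ l ∈ L, ∀ i j,
        S.flowRot E τ l i j = jetEval (hierRot N (k + 1) i j) (S.normal E τ) l - C τ i j) ∧
      FlowEquation T L (S.normal E)
        (fun τ l i => -jetEval (hierVf N (k + 1) i + χ • hierVf N k i) (S.normal E τ) l) C := by
  rw [h.isMapFlow_iff hE, opPar_hierMap, opNormal_hierMap] at hY
  have hd := fun τ (hτ : τ ∈ T) l (hl : l ∈ L) => h.hasDerivAt_eval_normal hE hτ hl
  have hw : ∀ τ ∈ T, ∀ l ∈ L, S.flowNormal E τ l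
      = fun i => -jetEvalHom (S.normal E τ) l (hierCov N (k + 1) i) := by
    intro τ hτ l hl
    have h0 : HasDerivAt (S.ePerp E τ)
        (fun i => -jetEvalHom (S.normal E τ) l (totalD N (hierVf N k i))) l := by
      refine hasDerivAt_pi.2 fun i => (hd τ hτ l hl (hierVf N k i)).neg.congr_of_eventuallyEq ?_
      filter_upwards [h.isOpen_L.mem_nhds hl] with s hs using (hY τ hτ s hs).2 i
    have h1 := (h.jAlong hE τ hτ l hl).2.unique h0
    ext i
    have h2 := congrFun h1 i
    simp only [Pi.sub_apply, Pi.smul_apply, smul_eq_mul, (hY τ hτ l hl).1, jetEval_eq_hom] at h2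
    simp only [hierCov_succ, Pi.add_apply, Pi.smul_apply, smul_eq_mul, map_add, map_mul,
      jetEvalHom_jetV, vecD]
    linarith
  obtain ⟨C, hC, hC'⟩ := h.exists_flowEquation hE hw
    (A := fun τ l => Matrix.of fun i j => jetEvalHom (S.normal E τ) l (hierRot N (k + 1) i j))
    (fun τ _ l _ => by
      ext i j
      have := congrArg (jetEvalHom (S.normal E τ) l)
        (congrFun (congrFun (hierRot_skew (N := N) (k + 1)) i) j)
      simpa using this)
    (fun τ hτ l hl i j => by
      refine (hd τ hτ l hl (hierRot N (k + 1) i j)).congr_deriv ?_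
      rw [(isAntideriv_hierRot (k + 1) i j).1]
      simp [wedge, vecMulVec_apply, jetEvalHom_jetV]
      ring)
    (u := fun τ l i => -jetEval (hierVf N (k + 1) i + χ • hierVf N k i) (S.normal E τ) l)
    (fun τ hτ l hl => by
      refine hasDerivAt_pi.2 fun i => (hd τ hτ l hl (hierCov N (k + 1) i)).neg.congr_deriv ?_
      have h1 : ∀ i, S.ePerp E τ l i = _ := (hY τ hτ l hl).2
      simp only [Pi.add_apply, Pi.sub_apply, Pi.smul_apply, smul_eq_mul, h1, jetEval_eq_hom,
        map_add, jetEvalHom_real_smul]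
      rw [hierVf_eq]
      simp only [Pi.add_apply, map_add, vecD, vecMul, jetEvalHom_dot, jetEvalHom_jetV, of_apply]
      ring)
  exact ⟨C, fun τ hτ l hl i j => congrFun (congrFun (hC τ hτ l hl) i) j, hC'⟩

theorem isMKdVMap_iff (S : FlowPart (N + 1)) :
    S.IsMKdVMap T L ↔ S.IsMapFlow (hierMap N 0) T L := by
  have h0 : hierMap N 0 = mkdvOperator := (isMapHierarchy_flowHierarchy N).map_zero
  have h1 : ∀ τ l, S.mapEval mkdvOperator τ l = S.DX (S.DX S.X) τ l
      + (3 / 2 * S.inner τ l (S.DX S.X τ l) (S.DX S.X τ l)) • S.X τ l := by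
    intro τ l
    rw [mkdvOperator, mapEval, Finsupp.sum_add_index' (by simp)
      (fun j b c => by rw [map_add, add_smul]), Finsupp.sum_single_index (by simp),
      Finsupp.sum_single_index (by simp)]
    simp
  rw [h0]
  simp only [IsMKdVMap, IsMapFlow, h1]

/-- The hierarchy governs every regular flow of constant curvature. -/
theorem governs (h : S.IsRegular χ T L) (hE : S.IsParallelFrame T L E) :
    Governs (flowHierarchy N (hierMap N)) χ S T L E where
  hamiltonian_form := ⟨fun τ l => deriv (S.flowNormal E τ) l - S.normal E τ l ᵥ* S.flowRot E τ l,
    h.jAlong hE, fun τ hτ l hl => ⟨fun i j => by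
      simpa using (h.hasDerivAt_flowRot hE hτ hl i j).fun_neg, by
      simpa [vecMul_neg] using
        (h.smooth_flowNormal hE).hasDerivAt_right h.isOpen_T h.isOpen_L hτ hl⟩,
    fun τ hτ l hl => h.hasDerivAt_normal hE hτ hl⟩
  convective := isConvectiveMap_iff hE
  convective_flow hY := by
    change ∃ C, _ ∧ FlowEquation T L (S.normal E)
      (fun τ l i => jetEval (hierVf N 0 i) (S.normal E τ) l) C
    rw [hierVf_zero]
    exact h.exists_flowEquation_convective hE hY
  mkdv := isMKdVMap_iff S
  map_flow k := by
    have := h.isMapFlow_iff hE (hierMap N k)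
    rwa [opPar_hierMap, opNormal_hierMap] at this
  map_flow_eq k := h.exists_flowEquation_map hE k
  wave := h.isWaveMap_iff hE
  wave_flow := h.exists_flowEquation_wave hE

end IsRegular

end FlowPart

end CurveFlow

open scoped ContDiff

namespace CurveFlow

open Finset Matrix

/-! ## Adapted frames along a flow -/

namespace NBundle

variable {n m : ℕ} (B : NBundle n m)

theorem sum_coframe_smul_frame (u w : Coord n m) :
    ∑ δ, B.coframe u w δ • B.frame δ u = w := by
  rw [Fintype.sum_sum_type]
  ext i
  · simp [coframe, frame, Prod.fst_sum, Pi.single_apply]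
  · simp [coframe, frame, Prod.snd_sum, Pi.single_apply, Finset.sum_apply, mul_comm]

theorem fderiv_eq_sum_eD (f : Coord n m → ℝ) (u w : Coord n m) :
    fderiv ℝ f u w = ∑ δ, B.eD δ f u * B.coframe u w δ := by
  conv_lhs => rw [← B.sum_coframe_smul_frame u w]
  simp [eD, mul_comm]

theorem hasDerivAt_comp {f : Coord n m → ℝ} (hf : ContDiffOn ℝ ∞ f B.U) {c : ℝ → Coord n m}
    {c' : Coord n m} {t : ℝ} (hc : HasDerivAt c c' t) (ht : c t ∈ B.U) :
    HasDerivAt (fun s => f (c s)) (∑ δ, B.eD δ f (c t) * B.coframe (c t) c' δ) t := by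
  rw [← fderiv_eq_sum_eD]
  exact ((hf.contDiffAt (B.isOpen_U.mem_nhds ht)).differentiableAt
    (by simp)).hasFDerivAt.comp_hasDerivAt t hc

/-- The derivative `e_δ N_β^a`, extended by zero to vertical `β`. -/
noncomputable def frameD (a : Fin m) (β δ : Idx n m) (u : Coord n m) : ℝ :=
  match β with
  | Sum.inl i => B.eD δ (fun z => B.N z a i) u
  | Sum.inr _ => 0

variable {B} {u : Coord n m}

theorem differentiableAt_frame (hu : u ∈ B.U) (α : Idx n m) : DifferentiableAt ℝ (B.frame α) u :=
  ((B.smooth_frame α).contDiffAt (B.isOpen_U.mem_nhds hu)).differentiableAt (by simp)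

theorem fderiv_frame_fst (hu : u ∈ B.U) (α : Idx n m) (w : Coord n m) :
    (fderiv ℝ (B.frame α) u w).1 = 0 := by
  have h := (differentiableAt_frame hu α).hasFDerivAt.fst
  cases α with
  | inl i =>
    have h1 := h.unique (hasFDerivAt_const (Pi.single i (1 : ℝ) : Fin n → ℝ) u)
    simpa using congrArg (fun A => A w) h1
  | inr a =>
    have h1 := h.unique (hasFDerivAt_const (0 : Fin n → ℝ) u)
    simpa using congrArg (fun A => A w) h1

theorem fderiv_frame_snd (hu : u ∈ B.U) (α δ : Idx n m) (a : Fin m) :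
    (fderiv ℝ (B.frame α) u (B.frame δ u)).2 a = -B.frameD a α δ u := by
  have h := hasFDerivAt_pi'.1 (differentiableAt_frame hu α).hasFDerivAt.snd a
  cases α with
  | inl i =>
    have h1 := h.unique (((B.smooth_N a i).contDiffAt
      (B.isOpen_U.mem_nhds hu)).differentiableAt (by simp)).hasFDerivAt.fun_neg
    simpa [frameD, eD] using congrArg (fun A => A (B.frame δ u)) h1
  | inr b =>
    have h1 := h.unique (hasFDerivAt_const ((Pi.single b (1 : ℝ) : Fin m → ℝ) a) u)
    simpa [frameD] using congrArg (fun A => A (B.frame δ u)) h1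

theorem anholonomy_inl (hu : u ∈ B.U) (i : Fin n) (β δ : Idx n m) :
    B.anholonomy (Sum.inl i) β δ u = 0 := by
  simp [anholonomy, coframe, VectorField.lieBracket, fderiv_frame_fst hu]

/-- The dual of `deᵃ = dN_iᵃ ∧ dxⁱ`; the horizontal coframe is closed, whence the vanishing in the
preceding lemma. -/
theorem anholonomy_inr (hu : u ∈ B.U) (a : Fin m) (β δ : Idx n m) :
    B.anholonomy (Sum.inr a) β δ u = B.frameD a β δ u - B.frameD a δ β u := by
  simp [anholonomy, coframe, VectorField.lieBracket, fderiv_frame_fst hu, fderiv_frame_snd hu]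
  ring

end NBundle

namespace IsCurveFlow

variable {n m : ℕ} {B : NBundle n m} {T L : Set ℝ} {γ : ℝ → ℝ → Coord n m} {τ l : ℝ}

theorem smooth₂ (hγ : IsCurveFlow B T L γ) : Smooth₂ T L γ := hγ.smooth

theorem smooth_comp (hγ : IsCurveFlow B T L γ) {f : Coord n m → ℝ} (hf : ContDiffOn ℝ ∞ f B.U) :
    Smooth₂ T L fun τ l => f (γ τ l) :=
  ContDiffOn.comp hf hγ.smooth fun p hp => hγ.mapsTo p.1 hp.1 p.2 hp.2

theorem smooth_coframe (hγ : IsCurveFlow B T L γ) {w : ℝ → ℝ → Coord n m} (hw : Smooth₂ T L w)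
    (α : Idx n m) : Smooth₂ T L fun τ l => B.coframe (γ τ l) (w τ l) α := by
  have h1 : ∀ i, Smooth₂ T L fun τ l => (w τ l).1 i := fun i =>
    contDiffOn_pi.1 (contDiff_fst.comp_contDiffOn hw) i
  cases α with
  | inl i => exact h1 i
  | inr a =>
    exact ContDiffOn.add (contDiffOn_pi.1 (contDiff_snd.comp_contDiffOn hw) a)
      (ContDiffOn.sum fun i _ => ContDiffOn.mul (hγ.smooth_comp (B.smooth_N a i)) (h1 i))

theorem smooth_tangentX (hγ : IsCurveFlow B T L γ) (α : Idx n m) :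
    Smooth₂ T L fun τ l => tangentX B γ τ l α :=
  hγ.smooth_coframe (hγ.smooth₂.deriv_right hγ.isOpen_T hγ.isOpen_L) α

theorem smooth_tangentY (hγ : IsCurveFlow B T L γ) (α : Idx n m) :
    Smooth₂ T L fun τ l => tangentY B γ τ l α :=
  hγ.smooth_coframe (hγ.smooth₂.deriv_left hγ.isOpen_T hγ.isOpen_L) α

theorem hasDerivAt_comp_right (hγ : IsCurveFlow B T L γ) {f : Coord n m → ℝ}
    (hf : ContDiffOn ℝ ∞ f B.U) (hτ : τ ∈ T) (hl : l ∈ L) : HasDerivAt (fun s => f (γ τ s))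
      (∑ δ, B.eD δ f (γ τ l) * tangentX B γ τ l δ) l :=
  B.hasDerivAt_comp hf (hγ.smooth₂.hasDerivAt_right hγ.isOpen_T hγ.isOpen_L hτ hl)
    (hγ.mapsTo τ hτ l hl)

theorem hasDerivAt_comp_left (hγ : IsCurveFlow B T L γ) {f : Coord n m → ℝ}
    (hf : ContDiffOn ℝ ∞ f B.U) (hτ : τ ∈ T) (hl : l ∈ L) : HasDerivAt (fun t => f (γ t l))
      (∑ δ, B.eD δ f (γ τ l) * tangentY B γ τ l δ) τ :=
  B.hasDerivAt_comp (c := fun t => γ t l) hf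
    (hγ.smooth₂.hasDerivAt_left hγ.isOpen_T hγ.isOpen_L hτ hl) (hγ.mapsTo τ hτ l hl)

theorem structure_inl (hγ : IsCurveFlow B T L γ) (hτ : τ ∈ T) (hl : l ∈ L) (i : Fin n) :
    deriv (fun t => tangentX B γ t l (Sum.inl i)) τ
      = deriv (fun s => tangentY B γ τ s (Sum.inl i)) l := by
  have hT := hγ.isOpen_T
  have hL := hγ.isOpen_L
  have h1 := ((hγ.smooth₂.deriv_right hT hL).hasDerivAt_left hT hL hτ hl).fst
  have h2 := ((hγ.smooth₂.deriv_left hT hL).hasDerivAt_right hT hL hτ hl).fst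
  rw [hγ.smooth₂.deriv_comm hT hL hτ hl] at h1
  exact (hasDerivAt_pi.1 h1 i).deriv.trans (hasDerivAt_pi.1 h2 i).deriv.symm

/-- The pullback of `deᵃ = dN_iᵃ ∧ dxⁱ`. Second derivatives of the fibre coordinates cancel by
symmetry, those of the base coordinates by `structure_inl`. -/
theorem structure_inr (hγ : IsCurveFlow B T L γ) (hτ : τ ∈ T) (hl : l ∈ L) (a : Fin m) :
    deriv (fun t => tangentX B γ t l (Sum.inr a)) τ
      - deriv (fun s => tangentY B γ τ s (Sum.inr a)) l
      = ∑ i, ((∑ δ, B.eD δ (fun z => B.N z a i) (γ τ l) * tangentY B γ τ l δ)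
          * tangentX B γ τ l (Sum.inl i)
        - (∑ δ, B.eD δ (fun z => B.N z a i) (γ τ l) * tangentX B γ τ l δ)
          * tangentY B γ τ l (Sum.inl i)) := by
  have hT := hγ.isOpen_T
  have hL := hγ.isOpen_L
  have h1 := ((hγ.smooth₂.deriv_right hT hL).hasDerivAt_left hT hL hτ hl).snd
  have h2 := ((hγ.smooth₂.deriv_left hT hL).hasDerivAt_right hT hL hτ hl).snd
  rw [hγ.smooth₂.deriv_comm hT hL hτ hl] at h1
  have hX : deriv (fun t => tangentX B γ t l (Sum.inr a)) τ = _ :=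
    ((hasDerivAt_pi.1 h1 a).add (HasDerivAt.fun_sum fun i (_ : i ∈ univ) =>
      (hγ.hasDerivAt_comp_left (B.smooth_N a i) hτ hl).mul
        ((hγ.smooth_tangentX (Sum.inl i)).hasDerivAt_left hT hL hτ hl))).deriv
  have hY : deriv (fun s => tangentY B γ τ s (Sum.inr a)) l = _ :=
    ((hasDerivAt_pi.1 h2 a).add (HasDerivAt.fun_sum fun i (_ : i ∈ univ) =>
      (hγ.hasDerivAt_comp_right (B.smooth_N a i) hτ hl).mul
        ((hγ.smooth_tangentY (Sum.inl i)).hasDerivAt_right hT hL hτ hl))).deriv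
  rw [hX, hY, add_sub_add_left_eq_sub, ← Finset.sum_sub_distrib]
  refine Finset.sum_congr rfl fun i _ => ?_
  rw [hγ.structure_inl hτ hl]
  ring

/-- The structure equation of the coframe along a flow. -/
theorem structure_eq (hγ : IsCurveFlow B T L γ) (hτ : τ ∈ T) (hl : l ∈ L) (ε : Idx n m) :
    deriv (fun t => tangentX B γ t l ε) τ - deriv (fun s => tangentY B γ τ s ε) l
      = -∑ β, ∑ δ, B.anholonomy ε β δ (γ τ l) * tangentY B γ τ l β * tangentX B γ τ l δ := by
  have hu := hγ.mapsTo τ hτ l hl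
  cases ε with
  | inl i => simp [hγ.structure_inl hτ hl, NBundle.anholonomy_inl hu]
  | inr a =>
    rw [hγ.structure_inr hτ hl]
    have h1 : ∀ x y : Idx n m → ℝ, ∑ β, ∑ δ, B.frameD a β δ (γ τ l) * y β * x δ
        = ∑ i, (∑ δ, B.eD δ (fun z => B.N z a i) (γ τ l) * x δ) * y (Sum.inl i) := by
      intro x y
      rw [Fintype.sum_sum_type]
      simp only [NBundle.frameD, zero_mul, Finset.sum_const_zero, add_zero, Finset.sum_mul]
      exact Finset.sum_congr rfl fun i _ => Finset.sum_congr rfl fun δ _ => by ring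
    have h2 : ∑ β, ∑ δ, B.frameD a δ β (γ τ l) * tangentY B γ τ l β * tangentX B γ τ l δ
        = ∑ β, ∑ δ, B.frameD a β δ (γ τ l) * tangentX B γ τ l β * tangentY B γ τ l δ := by
      rw [Finset.sum_comm]
      exact Finset.sum_congr rfl fun β _ => Finset.sum_congr rfl fun δ _ => by ring
    simp only [NBundle.anholonomy_inr hu, sub_mul, Finset.sum_sub_distrib, h2, h1]
    ring

/-- The curvature of a connection along a flow. -/
theorem curvature_eq (hγ : IsCurveFlow B T L γ) {r : ℕ}
    {Γ : Fin r → Fin r → Idx n m → Coord n m → ℝ} (hΓ : ∀ i j δ, ContDiffOn ℝ ∞ (Γ i j δ) B.U)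
    {P Q : ℝ → ℝ → Matrix (Fin r) (Fin r) ℝ}
    (hP : ∀ τ l i j, P τ l i j = ∑ δ, Γ i j δ (γ τ l) * tangentX B γ τ l δ)
    (hQ : ∀ τ l i j, Q τ l i j = ∑ δ, Γ i j δ (γ τ l) * tangentY B γ τ l δ)
    (hτ : τ ∈ T) (hl : l ∈ L) (i j : Fin r) :
    deriv (fun t => P t l i j) τ - deriv (fun s => Q τ s i j) l
      + (Q τ l * P τ l - P τ l * Q τ l) i j
      = ∑ β, ∑ δ, DConnection.curv B Γ i j β δ (γ τ l) * tangentY B γ τ l β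
          * tangentX B γ τ l δ := by
  have hT := hγ.isOpen_T
  have hL := hγ.isOpen_L
  have h1 := (HasDerivAt.fun_sum fun δ (_ : δ ∈ univ) =>
    (hγ.hasDerivAt_comp_left (hΓ i j δ) hτ hl).fun_mul
      ((hγ.smooth_tangentX δ).hasDerivAt_left hT hL hτ hl)).deriv
  have h2 := (HasDerivAt.fun_sum fun δ (_ : δ ∈ univ) =>
    (hγ.hasDerivAt_comp_right (hΓ i j δ) hτ hl).fun_mul
      ((hγ.smooth_tangentY δ).hasDerivAt_right hT hL hτ hl)).deriv
  set x := tangentX B γ τ l with hx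
  set y := tangentY B γ τ l with hy
  set u := γ τ l with hu
  -- The derivatives of the components of `γ_l` and `γ_τ` assemble, by the structure equation, into
  -- the anholonomy term of the curvature.
  have hW : ∑ ε, Γ i j ε u * deriv (fun t => tangentX B γ t l ε) τ
      - ∑ ε, Γ i j ε u * deriv (fun s => tangentY B γ τ s ε) l
      = -∑ β, ∑ δ, (∑ ε, B.anholonomy ε β δ u * Γ i j ε u) * y β * x δ := by
    rw [← Finset.sum_sub_distrib]
    simp only [← mul_sub, hγ.structure_eq hτ hl, mul_neg, Finset.sum_neg_distrib, Finset.mul_sum,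
      Finset.sum_mul]
    congr 1
    rw [Finset.sum_comm]
    refine Finset.sum_congr rfl fun β _ => ?_
    rw [Finset.sum_comm]
    exact Finset.sum_congr rfl fun δ _ => Finset.sum_congr rfl fun ε _ => by ring
  have hM : ∀ x y : Idx n m → ℝ, ∑ k, (∑ δ, Γ i k δ u * y δ) * (∑ δ, Γ k j δ u * x δ)
      = ∑ β, ∑ δ, (∑ k, Γ i k β u * Γ k j δ u) * y β * x δ := by
    intro x y
    simp only [Finset.sum_mul_sum]
    simp only [Finset.sum_mul]
    rw [Finset.sum_comm]
    refine Finset.sum_congr rfl fun β _ => ?_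
    rw [Finset.sum_comm]
    exact Finset.sum_congr rfl fun δ _ => Finset.sum_congr rfl fun k _ => by ring
  have hS : ∀ (f : Idx n m → Idx n m → ℝ) (x y : Idx n m → ℝ),
      ∑ β, ∑ δ, f β δ * y β * x δ = ∑ β, ∑ δ, f δ β * x β * y δ := by
    intro f x y
    rw [Finset.sum_comm]
    exact Finset.sum_congr rfl fun β _ => Finset.sum_congr rfl fun δ _ => by ring
  have hD : ∀ x y : Idx n m → ℝ, ∑ δ, (∑ β, B.eD β (Γ i j δ) u * y β) * x δ
      = ∑ β, ∑ δ, B.eD β (Γ i j δ) u * y β * x δ := by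
    intro x y
    simp only [Finset.sum_mul]
    exact Finset.sum_comm
  simp only [Matrix.sub_apply, Matrix.mul_apply, hP, hQ, ← hx, ← hy, ← hu, hM]
  rw [h1, h2, Finset.sum_add_distrib, Finset.sum_add_distrib, hD, hD,
    hS (fun β δ => B.eD β (Γ i j δ) u) y x, hS (fun β δ => ∑ k, Γ i k β u * Γ k j δ u) y x]
  simp only [DConnection.curv, add_mul, sub_mul, Finset.sum_add_distrib, Finset.sum_sub_distrib]
  linarith

end IsCurveFlow

end CurveFlow

open scoped ContDiff

namespace CurveFlow

open Finset Matrix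

/-! ## The horizontal and vertical parts of a flow are regular -/

theorem transpose_of_posDef {r : ℕ} {G : Matrix (Fin r) (Fin r) ℝ} (hG : G.PosDef) : Gᵀ = G := by
  rw [← conjTranspose_eq_transpose_of_trivial]
  exact hG.isHermitian

namespace IsCurveFlow

variable {n m : ℕ} {B : NBundle n m} {T L : Set ℝ} {γ : ℝ → ℝ → Coord n m} {τ l : ℝ}
  {D : DConnection B}

theorem smooth_sum (hγ : IsCurveFlow B T L γ) {f : Idx n m → Coord n m → ℝ}
    (hf : ∀ δ, ContDiffOn ℝ ∞ (f δ) B.U) {x : ℝ → ℝ → Idx n m → ℝ}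
    (hx : ∀ δ, Smooth₂ T L fun τ l => x τ l δ) :
    Smooth₂ T L fun τ l => ∑ δ, f δ (γ τ l) * x τ l δ :=
  ContDiffOn.sum fun δ _ => ContDiffOn.mul (hγ.smooth_comp (hf δ)) (hx δ)

/-- The right side is the component of `D_Y γ_l - D_X γ_τ`; the anholonomy part of the torsion is
again supplied by the structure equation. -/
theorem flowTorsion_eq (hγ : IsCurveFlow B T L γ) (hτ : τ ∈ T) (hl : l ∈ L) (α : Idx n m) :
    flowTorsion D γ τ l α =
      deriv (fun t => tangentX B γ t l α) τ - deriv (fun s => tangentY B γ τ s α) l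
      + ∑ δ, (∑ β, D.coeff α δ β (γ τ l) * tangentY B γ τ l β) * tangentX B γ τ l δ
      - ∑ β, (∑ δ, D.coeff α β δ (γ τ l) * tangentX B γ τ l δ) * tangentY B γ τ l β := by
  have h1 : ∑ δ, (∑ β, D.coeff α δ β (γ τ l) * tangentY B γ τ l β) * tangentX B γ τ l δ
      = ∑ β, ∑ δ, D.coeff α δ β (γ τ l) * tangentY B γ τ l β * tangentX B γ τ l δ := by
    simp only [Finset.sum_mul]
    exact Finset.sum_comm
  have h2 : ∑ β, (∑ δ, D.coeff α β δ (γ τ l) * tangentX B γ τ l δ) * tangentY B γ τ l β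
      = ∑ β, ∑ δ, D.coeff α β δ (γ τ l) * tangentY B γ τ l β * tangentX B γ τ l δ := by
    simp only [Finset.sum_mul]
    exact Finset.sum_congr rfl fun β _ => Finset.sum_congr rfl fun δ _ => by ring
  rw [hγ.structure_eq hτ hl, h1, h2]
  simp only [flowTorsion, DConnection.torsion, sub_mul, Finset.sum_sub_distrib]
  ring

/-- Metric compatibility along a flow. -/
theorem sum_metric {r : ℕ} (G : Matrix (Fin r) (Fin r) ℝ) (Γ : Fin r → Fin r → Idx n m → ℝ)
    (x : Idx n m → ℝ) (i j : Fin r) :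
    ∑ δ, (∑ k, (Γ k i δ * G k j + Γ k j δ * G i k)) * x δ
      = ((Matrix.of fun i j => ∑ δ, Γ i j δ * x δ)ᵀ * G
        + G * Matrix.of fun i j => ∑ δ, Γ i j δ * x δ) i j := by
  simp only [Matrix.add_apply, Matrix.mul_apply, transpose_apply, of_apply, Finset.sum_mul,
    Finset.mul_sum, ← Finset.sum_add_distrib]
  rw [Finset.sum_comm]
  exact Finset.sum_congr rfl fun k _ => Finset.sum_congr rfl fun δ _ => by ring

theorem sum_curvature {r : ℕ} (G : Matrix (Fin r) (Fin r) ℝ) (hG : Gᵀ = G) (χ : ℝ)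
    (x y : Fin r → ℝ) (i j : Fin r) :
    ∑ k, ∑ l, χ * ((if i = k then G l j else 0) - (if i = l then G k j else 0)) * y k * x l
      = χ * (y i * (G *ᵥ x) j - x i * (G *ᵥ y) j) := by
  have hs : ∀ k, G k j = G j k := fun k => congrFun (congrFun hG j) k
  have h1 : ∑ k, ∑ l, (if i = k then G l j else 0) * y k * x l = y i * (G *ᵥ x) j := by
    simp only [ite_mul, zero_mul]
    rw [Finset.sum_comm]
    simp only [Finset.sum_ite_eq, Finset.mem_univ, if_true, mulVec, dotProduct, Finset.mul_sum, hs]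
    exact Finset.sum_congr rfl fun _ _ => by ring
  have h2 : ∑ k, ∑ l, (if i = l then G k j else 0) * y k * x l = x i * (G *ᵥ y) j := by
    simp only [ite_mul, zero_mul, Finset.sum_ite_eq, Finset.mem_univ, if_true, mulVec, dotProduct,
      Finset.mul_sum, hs]
    exact Finset.sum_congr rfl fun _ _ => by ring
  rw [← h1, ← h2]
  simp only [← Finset.sum_sub_distrib, Finset.mul_sum]
  exact Finset.sum_congr rfl fun _ _ => Finset.sum_congr rfl fun _ _ => by ring

/-- The mixed blocks of a d-connection vanish, so the horizontal equations close on horizontal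
vectors even though vertical components of `γ_l` and `γ_τ` still enter the matrices `ΓX`, `ΓY`. -/
theorem isRegular_hPart (hγ : IsCurveFlow B T L γ) (hD : D.IsMetric) {χ : ℝ}
    (hχ : D.HasConstHCurvature χ)
    (ht : ∀ τ ∈ T, ∀ l ∈ L, ∀ i, flowTorsion D γ τ l (Sum.inl i) = 0) :
    (hPart D γ).IsRegular χ T L where
  isOpen_T := hγ.isOpen_T
  isOpen_L := hγ.isOpen_L
  interval_L := hγ.interval_L
  smooth_metric i j := hγ.smooth_comp (B.smooth_g i j)
  smooth_ΓX i j := hγ.smooth_sum (D.smooth_hΓ i j) hγ.smooth_tangentX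
  smooth_ΓY i j := hγ.smooth_sum (D.smooth_hΓ i j) hγ.smooth_tangentY
  smooth_X := Smooth₂.pi fun i => hγ.smooth_tangentX (Sum.inl i)
  smooth_Y := Smooth₂.pi fun i => hγ.smooth_tangentY (Sum.inl i)
  symm_metric τ hτ l hl := transpose_of_posDef (B.posDef_g _ (hγ.mapsTo τ hτ l hl))
  metric_X τ hτ l hl i j := by
    refine (hγ.hasDerivAt_comp_right (B.smooth_g i j) hτ hl).deriv.trans ?_
    simp only [hD.horizontal _ (hγ.mapsTo τ hτ l hl)]
    exact sum_metric _ (fun i j δ => D.hΓ i j δ (γ τ l)) _ i j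
  metric_Y τ hτ l hl i j := by
    refine (hγ.hasDerivAt_comp_left (B.smooth_g i j) hτ hl).deriv.trans ?_
    simp only [hD.horizontal _ (hγ.mapsTo τ hτ l hl)]
    exact sum_metric _ (fun i j δ => D.hΓ i j δ (γ τ l)) _ i j
  torsion τ hτ l hl := by
    have hX : Smooth₂ T L (hPart D γ).X := Smooth₂.pi fun i => hγ.smooth_tangentX (Sum.inl i)
    have hY : Smooth₂ T L (hPart D γ).Y := Smooth₂.pi fun i => hγ.smooth_tangentY (Sum.inl i)
    ext i
    have h := ht τ hτ l hl i
    rw [hγ.flowTorsion_eq hτ hl, Fintype.sum_sum_type, Fintype.sum_sum_type] at h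
    have h1 := hasDerivAt_pi.1 (hX.hasDerivAt_left hγ.isOpen_T hγ.isOpen_L hτ hl) i
    have h2 := hasDerivAt_pi.1 (hY.hasDerivAt_right hγ.isOpen_T hγ.isOpen_L hτ hl) i
    simp only [FlowPart.DX, FlowPart.DY, Pi.add_apply]
    rw [← h1.deriv, ← h2.deriv]
    simp only [DConnection.coeff, zero_mul, Finset.sum_const_zero, add_zero] at h
    simp only [mulVec, dotProduct, hPart, of_apply]
    linarith
  curvature τ hτ l hl i j := by
    refine (hγ.curvature_eq D.smooth_hΓ (P := (hPart D γ).ΓX) (Q := (hPart D γ).ΓY)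
      (fun _ _ _ _ => rfl) (fun _ _ _ _ => rfl) hτ hl i j).trans ?_
    have hu := hγ.mapsTo τ hτ l hl
    -- Only the purely horizontal block of curvature directions is nonzero.
    simp only [hχ _ hu, Fintype.sum_sum_type, zero_mul, Finset.sum_const_zero, add_zero]
    exact sum_curvature _ (transpose_of_posDef (B.posDef_g _ hu)) χ _ _ i j

theorem isRegular_vPart (hγ : IsCurveFlow B T L γ) (hD : D.IsMetric) {χ : ℝ}
    (hχ : D.HasConstVCurvature χ)
    (ht : ∀ τ ∈ T, ∀ l ∈ L, ∀ a, flowTorsion D γ τ l (Sum.inr a) = 0) :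
    (vPart D γ).IsRegular χ T L where
  isOpen_T := hγ.isOpen_T
  isOpen_L := hγ.isOpen_L
  interval_L := hγ.interval_L
  smooth_metric a b := hγ.smooth_comp (B.smooth_h a b)
  smooth_ΓX a b := hγ.smooth_sum (D.smooth_vΓ a b) hγ.smooth_tangentX
  smooth_ΓY a b := hγ.smooth_sum (D.smooth_vΓ a b) hγ.smooth_tangentY
  smooth_X := Smooth₂.pi fun a => hγ.smooth_tangentX (Sum.inr a)
  smooth_Y := Smooth₂.pi fun a => hγ.smooth_tangentY (Sum.inr a)
  symm_metric τ hτ l hl := transpose_of_posDef (B.posDef_h _ (hγ.mapsTo τ hτ l hl))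
  metric_X τ hτ l hl a b := by
    refine (hγ.hasDerivAt_comp_right (B.smooth_h a b) hτ hl).deriv.trans ?_
    simp only [hD.vertical _ (hγ.mapsTo τ hτ l hl)]
    exact sum_metric _ (fun a b δ => D.vΓ a b δ (γ τ l)) _ a b
  metric_Y τ hτ l hl a b := by
    refine (hγ.hasDerivAt_comp_left (B.smooth_h a b) hτ hl).deriv.trans ?_
    simp only [hD.vertical _ (hγ.mapsTo τ hτ l hl)]
    exact sum_metric _ (fun a b δ => D.vΓ a b δ (γ τ l)) _ a b
  torsion τ hτ l hl := by
    have hX : Smooth₂ T L (vPart D γ).X := Smooth₂.pi fun a => hγ.smooth_tangentX (Sum.inr a)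
    have hY : Smooth₂ T L (vPart D γ).Y := Smooth₂.pi fun a => hγ.smooth_tangentY (Sum.inr a)
    ext a
    have h := ht τ hτ l hl a
    rw [hγ.flowTorsion_eq hτ hl, Fintype.sum_sum_type, Fintype.sum_sum_type] at h
    have h1 := hasDerivAt_pi.1 (hX.hasDerivAt_left hγ.isOpen_T hγ.isOpen_L hτ hl) a
    have h2 := hasDerivAt_pi.1 (hY.hasDerivAt_right hγ.isOpen_T hγ.isOpen_L hτ hl) a
    simp only [FlowPart.DX, FlowPart.DY, Pi.add_apply]
    rw [← h1.deriv, ← h2.deriv]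
    simp only [DConnection.coeff, zero_mul, Finset.sum_const_zero, zero_add] at h
    simp only [mulVec, dotProduct, vPart, of_apply]
    linarith
  curvature τ hτ l hl a b := by
    refine (hγ.curvature_eq D.smooth_vΓ (P := (vPart D γ).ΓX) (Q := (vPart D γ).ΓY)
      (fun _ _ _ _ => rfl) (fun _ _ _ _ => rfl) hτ hl a b).trans ?_
    have hu := hγ.mapsTo τ hτ l hl
    simp only [hχ _ hu, Fintype.sum_sum_type, zero_mul, Finset.sum_const_zero, zero_add]
    exact sum_curvature _ (transpose_of_posDef (B.posDef_h _ hu)) χ _ _ a b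

end IsCurveFlow

end CurveFlow

theorem mainTheorem1 (p q : ℕ) (hp : 1 ≤ p) (hq : 1 ≤ q)
    (B : CurveFlow.NBundle (p + 1) (q + 1))
    (D : CurveFlow.DConnection B) (hD : D.IsCanonicalType)
    (χh χv : ℝ) (hχh : D.HasConstHCurvature χh) (hχv : D.HasConstVCurvature χv) :
    CurveFlow.IsBiHamiltonianPair p ∧ CurveFlow.IsBiHamiltonianPair q ∧
    ∃ (hR : CurveFlow.FlowHierarchy p) (vR : CurveFlow.FlowHierarchy q),
      hR.IsBiHamiltonian ∧ hR.IsMapHierarchy ∧ vR.IsBiHamiltonian ∧ vR.IsMapHierarchy ∧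
      ∀ (T L : Set ℝ) (γ : ℝ → ℝ → CurveFlow.Coord (p + 1) (q + 1)),
        CurveFlow.IsCurveFlow B T L γ →
        ((CurveFlow.hPart D γ).NonStretching T L →
          (∀ τ ∈ T, ∀ l ∈ L, ∀ i, CurveFlow.flowTorsion D γ τ l (Sum.inl i) = 0) →
          ∀ E, (CurveFlow.hPart D γ).IsParallelFrame T L E →
            CurveFlow.Governs hR χh (CurveFlow.hPart D γ) T L E) ∧
        ((CurveFlow.vPart D γ).NonStretching T L →
          (∀ τ ∈ T, ∀ l ∈ L, ∀ a, CurveFlow.flowTorsion D γ τ l (Sum.inr a) = 0) →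
          ∀ E, (CurveFlow.vPart D γ).IsParallelFrame T L E →
            CurveFlow.Governs vR χv (CurveFlow.vPart D γ) T L E) := by
  refine ⟨CurveFlow.isBiHamiltonianPair p, CurveFlow.isBiHamiltonianPair q,
    CurveFlow.flowHierarchy p (CurveFlow.hierMap p), CurveFlow.flowHierarchy q (CurveFlow.hierMap q),
    CurveFlow.isBiHamiltonian_flowHierarchy _, CurveFlow.isMapHierarchy_flowHierarchy p,
    CurveFlow.isBiHamiltonian_flowHierarchy _, CurveFlow.isMapHierarchy_flowHierarchy q,
    fun T L γ hγ => ⟨fun _ ht E hE => ?_, fun _ ht E hE => ?_⟩⟩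
  · exact (hγ.isRegular_hPart hD.metric hχh ht).governs hE
  · exact (hγ.isRegular_vPart hD.metric hχv ht).governs hE
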